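/- **Theorem 3 (Differentiability).** Let $n\in\mathbb N$, $q>1$ and $\tfrac23q+1<p<q+\tfrac23$ (the sub-critical range). For $a,b\in\mathbb R^n$ let $a\wedge b\in\Lambda^2\mathbb R^n$, where $\Lambda^2\mathbb R^n$ carries the inner product with $\langle a\wedge b,c\wedge d\rangle=\langle a,c\rangle\langle b,d\rangle-\langle a,d\rangle\langle b,c\rangle$, and for a closed curve $\gamma:\mathbb R/\mathbb Z\to\mathbb R^n$ let $$E^{p,q}(\gamma)=\iiint_{(\mathbb R/\mathbb Z)^3}\frac{|\gamma'(u_1)||\gamma'(u_2)||\gamma'(u_3)|}{R^{(p,q)}(\gamma(u_1),\gamma(u_2),\gamma(u_3))}\,du_1\,du_2\,du_3\in[0,\infty],\qquad R^{(p,q)}(x,y,z)=\frac{(|y-z||y-x||z-x|)^p}{|(y-x)\wedge(z-x)|^q},$$ where $1/R^{(p,q)}=0$ on collinear triples. For $s=\frac{3p-2}q-2\in(\frac1q,1)$ let $W=W^{(3p-2)/q-1,q}(\mathbb R/\mathbb Z,\mathbb R^n)=W^{1+s,q}$ be the space of all $f\in W^{1,q}(\mathbb R/\mathbb Z,\mathbb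 R^n)$ with finite norm $$\|f\|_{L^q}+\|f'\|_{L^q}+\Big(\int_{\mathbb R/\mathbb Z}\int_{-1/2}^{1/2}\frac{|f'(u+w)-f'(u)|^q}{|w|^{1+qs}}\,dw\,du\Big)^{1/q};$$ its elements are identified with their continuous representatives. A curve is *embedded* if it is injective on $\mathbb R/\mathbb Z$, *regular* if $|\gamma'|\ge c$ a.e. for some $c>0$, and *parametrized by arc-length* if $|\gamma'|=1$ a.e. (a) The set of all regular embedded curves in $W$ is open in $W$, and $E^{p,q}$ is finite and continuously differentiable ($C^1$) on it. (b) Let $\gamma\in W$ be embedded and parametrized by arc-length, and let $h\in W$. Write $T_{v,w}f=f(u+v)-f(u+w)$, $A=T_{v,0}\gamma\wedge T_{w,0}\gamma$ and $N=|T_{v,w}\gamma||T_{v,0}\gamma||T_{w,0}\gamma|$. Then the first variation $\delta E^{p,q}(\gamma,h)=\frac{d}{d\tau}\big|_{\tau=0}E^{p,q}(\gamma+\tau h)$ exists, and $$\delta E^{p,q}(\gamma,h)=\mathrm{p.v.}\!\!\iiint_{(\mathbb R/\mathbb Z)^3}\Big\{2q\frac{|A|^{q-2}}{N^p}\langle A,\,T_{v,0}\gamma\wedge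 T_{w,0}h\rangle-3p\frac{|A|^q}{N^p}\cdot\frac{\langle T_{v,w}\gamma,T_{v,w}h\rangle}{|T_{v,w}\gamma|^2}+3\frac{|A|^q}{N^p}\langle\gamma'(u),h'(u)\rangle\Big\}\,dw\,dv\,du,$$ where $|A|^{q-2}\langle A,\cdot\rangle:=0$ if $A=0$, and where p.v. denotes the limit as $\varepsilon\searrow0$ of the (absolutely convergent) integrals over the set of all $(u,v,w)$ for which $v$, $w$ and $v-w$ have distance larger than $\varepsilon$ from $0$ in $\mathbb R/\mathbb Z$. In particular the integral may be taken in the ordinary sense whenever the integrand is integrable. If the first term of the integrand is symmetrized in $v$ and $w$, that is, replaced by $$q\frac{|A|^{q-2}}{N^p}\langle A,\,T_{v,0}h\wedge T_{w,0}\gamma+T_{v,0}\gamma\wedge T_{w,0}h\rangle,$$ then the integrand is integrable on $(\mathbb R/\mathbb Z)^3$ for all such $\gamma$ and $h$, and its integral is $\delta E^{p,q}(\gamma,h)$. -/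

import Mathlib

open MeasureTheory Filter Topology Set
open scoped ENNReal ContDiff RealInnerProductSpace

noncomputable section

namespace MengerCurvature

/-- The ambient Euclidean space `ℝⁿ`. -/
abbrev E (n : ℕ) := EuclideanSpace ℝ (Fin n)

/-- The parameter domain `ℝ/ℤ`, with its Haar measure of total mass one as `volume`. -/
abbrev RModZ := UnitAddCircle

/-! ### Sobolev-Slobodeckij spaces of closed curves -/

/-- `g` is a weak derivative of `f` on `ℝ/ℤ`: one has `∫ φ' f = - ∫ φ g` for all smooth
real-valued `φ` on `ℝ/ℤ`. Here `φ'` is the derivative of `φ`. -/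
def IsWeakDeriv {n : ℕ} (f g : RModZ → E n) : Prop :=
  ∀ φ φ' : RModZ → ℝ, ContDiff ℝ ∞ (fun t : ℝ => φ (t : RModZ)) →
    (∀ t : ℝ, HasDerivAt (fun t : ℝ => φ (t : RModZ)) (φ' (t : RModZ)) t) →
    ∫ x, φ' x • f x = - ∫ x, φ x • g x

/-- The measure `dw du` on `(-1/2, 1/2) × ℝ/ℤ`. -/
def slobodeckijMeasure : Measure (ℝ × RModZ) :=
  (volume.restrict (Ioo (-1 / 2 : ℝ) (1 / 2))).prod volume

/-- The weighted difference quotient `(w, u) ↦ |w|^(-(1/ρ + s)) (g(u+w) - g(u))`. The `ρ`-th power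
of its `L^ρ`-norm with respect to `dw du` is `∫∫ |g(u+w) - g(u)|^ρ / |w|^(1+ρs) dw du`. -/
def diffQuot {n : ℕ} (s ρ : ℝ) (g : RModZ → E n) (z : ℝ × RModZ) : E n :=
  |z.1| ^ (-(1 / ρ + s)) • (g (z.2 + (z.1 : RModZ)) - g z.2)

lemma quasi_add : Measure.QuasiMeasurePreserving
    (fun z : ℝ × RModZ => z.2 + (z.1 : RModZ)) slobodeckijMeasure volume := by
  have h : MeasurePreserving (fun z : ℝ × RModZ => (z.1, z.2 + (z.1 : RModZ)))
      slobodeckijMeasure slobodeckijMeasure :=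
    MeasurePreserving.skew_product (g := fun (w : ℝ) (u : RModZ) => u + (w : RModZ))
      (MeasurePreserving.id _) (by fun_prop)
      (ae_of_all _ fun w => (measurePreserving_add_right volume (w : RModZ)).map_eq)
  exact Measure.quasiMeasurePreserving_snd.comp h.quasiMeasurePreserving

lemma quasi_snd : Measure.QuasiMeasurePreserving
    (fun z : ℝ × RModZ => z.2) slobodeckijMeasure volume :=
  Measure.quasiMeasurePreserving_snd

lemma diffQuot_add_ae {n : ℕ} (s ρ : ℝ) {r : ℝ≥0∞} (g₁ g₂ : Lp (E n) r (volume : Measure RModZ)) :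
    diffQuot s ρ ⇑(g₁ + g₂) =ᵐ[slobodeckijMeasure] diffQuot s ρ ⇑g₁ + diffQuot s ρ ⇑g₂ := by
  filter_upwards [quasi_add.ae (Lp.coeFn_add g₁ g₂), quasi_snd.ae (Lp.coeFn_add g₁ g₂)]
    with z h1 h2
  simp only [diffQuot, Pi.add_apply, h1, h2, ← smul_add]
  congr 1
  abel

lemma diffQuot_smul_ae {n : ℕ} (s ρ c : ℝ) {r : ℝ≥0∞} (g : Lp (E n) r (volume : Measure RModZ)) :
    diffQuot s ρ ⇑(c • g) =ᵐ[slobodeckijMeasure] c • diffQuot s ρ ⇑g := by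
  filter_upwards [quasi_add.ae (Lp.coeFn_smul c g), quasi_snd.ae (Lp.coeFn_smul c g)] with z h1 h2
  simp only [diffQuot, Pi.smul_apply, h1, h2, ← smul_sub]
  rw [smul_comm]

lemma integrable_smul {n : ℕ} {ρ : ℝ} (hρ : 1 ≤ ρ) {φ : RModZ → ℝ}
    (hφ : Continuous φ) (g : Lp (E n) (ENNReal.ofReal ρ) (volume : Measure RModZ)) :
    Integrable (fun x => φ x • g x) := by
  have hg : Integrable (⇑g) volume :=
    MemLp.integrable (q := ENNReal.ofReal ρ) (by simpa using hρ) (Lp.memLp g)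
  obtain ⟨C, hC⟩ := (isCompact_range hφ).isBounded.exists_norm_le
  have hb : ∀ᵐ x ∂(volume : Measure RModZ), ‖φ x‖ ≤ C := ae_of_all _ fun x => hC _ ⟨x, rfl⟩
  have hm : AEStronglyMeasurable φ (volume : Measure RModZ) := hφ.aestronglyMeasurable
  have h := Integrable.bdd_smul hg C hm hb
  exact h

lemma continuous_of_lift {φ : RModZ → ℝ} (h : Continuous fun t : ℝ => φ (t : RModZ)) :
    Continuous φ :=
  (QuotientAddGroup.isQuotientMap_mk (N := AddSubgroup.zmultiples (1 : ℝ))).continuous_iff.2 h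

/-- The Sobolev-Slobodeckij space `W^{1+s,ρ}(ℝ/ℤ, ℝⁿ)`. Its elements are given by a function `f` on
`ℝ/ℤ` (every class of functions in `W^{1,ρ}` has exactly one continuous representative, which is the
one that is taken), together with its weak derivative `g ∈ L^ρ` (which is determined by `f`),
subject to the finiteness of the Slobodeckij seminorm of `g`. -/
def sobolevSubmodule (n : ℕ) (s ρ : ℝ) [hρ : Fact (1 ≤ ρ)] :
    Submodule ℝ (C(RModZ, E n) × Lp (E n) (ENNReal.ofReal ρ) (volume : Measure RModZ)) where
  carrier := {z | IsWeakDeriv ⇑z.1 ⇑z.2 ∧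
    MemLp (diffQuot s ρ ⇑z.2) (ENNReal.ofReal ρ) slobodeckijMeasure}
  add_mem' := by
    rintro ⟨f₁, g₁⟩ ⟨f₂, g₂⟩ ⟨h₁, k₁⟩ ⟨h₂, k₂⟩
    refine ⟨fun φ φ' hφ hd => ?_, (k₁.add k₂).ae_eq (diffQuot_add_ae s ρ g₁ g₂).symm⟩
    have hc : Continuous φ := continuous_of_lift hφ.continuous
    have hc' : Continuous φ' := by
      refine continuous_of_lift ?_
      have : (fun t : ℝ => φ' (t : RModZ)) = deriv (fun t : ℝ => φ (t : RModZ)) :=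
        funext fun t => (hd t).deriv.symm
      rw [this]
      exact hφ.continuous_deriv (by simp)
    have e₁ := h₁ φ φ' hφ hd
    have e₂ := h₂ φ φ' hφ hd
    have i₁ : Integrable (fun x => φ' x • f₁ x) :=
      (hc'.smul f₁.continuous).integrable_of_hasCompactSupport (HasCompactSupport.of_compactSpace _)
    have i₂ : Integrable (fun x => φ' x • f₂ x) :=
      (hc'.smul f₂.continuous).integrable_of_hasCompactSupport (HasCompactSupport.of_compactSpace _)
    have hg : ∫ x, φ x • (g₁ + g₂ : Lp (E n) (ENNReal.ofReal ρ) (volume : Measure RModZ)) x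
        = ∫ x, (φ x • g₁ x + φ x • g₂ x) := by
      refine integral_congr_ae ?_
      filter_upwards [Lp.coeFn_add g₁ g₂] with x hx
      rw [hx, Pi.add_apply, smul_add]
    have hf : ∫ x, φ' x • (f₁ + f₂) x = ∫ x, (φ' x • f₁ x + φ' x • f₂ x) := by
      simp only [ContinuousMap.add_apply, smul_add]
    change ∫ x, φ' x • (f₁ + f₂) x
      = - ∫ x, φ x • (g₁ + g₂ : Lp (E n) (ENNReal.ofReal ρ) (volume : Measure RModZ)) x
    rw [hf, hg, integral_add i₁ i₂,
      integral_add (integrable_smul hρ.out hc g₁) (integrable_smul hρ.out hc g₂), e₁, e₂, neg_add]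
  zero_mem' := by
    have hz : ⇑(0 : Lp (E n) (ENNReal.ofReal ρ) (volume : Measure RModZ)) =ᵐ[volume] 0 :=
      Lp.coeFn_zero _ _ _
    refine ⟨fun φ φ' _ _ => ?_, ?_⟩
    · have : ∫ x, φ x • (0 : Lp (E n) (ENNReal.ofReal ρ) (volume : Measure RModZ)) x = 0 := by
        refine integral_eq_zero_of_ae ?_
        filter_upwards [hz] with x hx
        change φ x • (0 : Lp (E n) (ENNReal.ofReal ρ) (volume : Measure RModZ)) x = 0
        rw [hx]
        exact smul_zero _
      change ∫ x, φ' x • (0 : C(RModZ, E n)) x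
        = - ∫ x, φ x • (0 : Lp (E n) (ENNReal.ofReal ρ) (volume : Measure RModZ)) x
      rw [this]
      simp
    · refine (MemLp.zero (ε := E n)).ae_eq (f := 0) ?_
      have h := diffQuot_smul_ae s ρ 0 (0 : Lp (E n) (ENNReal.ofReal ρ) (volume : Measure RModZ))
      rw [zero_smul, zero_smul] at h
      exact h.symm
  smul_mem' := by
    rintro c ⟨f, g⟩ ⟨h, k⟩
    refine ⟨fun φ φ' hφ hd => ?_, (k.const_smul c).ae_eq (diffQuot_smul_ae s ρ c g).symm⟩
    have e := h φ φ' hφ hd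
    have hg : ∫ x, φ x • (c • g : Lp (E n) (ENNReal.ofReal ρ) (volume : Measure RModZ)) x
        = ∫ x, c • (φ x • g x) := by
      refine integral_congr_ae ?_
      filter_upwards [Lp.coeFn_smul c g] with x hx
      rw [hx, Pi.smul_apply, smul_comm]
    have hf : ∫ x, φ' x • (c • f) x = ∫ x, c • (φ' x • f x) := by
      congr 1
      ext1 x
      rw [ContinuousMap.smul_apply, smul_comm]
    change ∫ x, φ' x • (c • f) x
      = - ∫ x, φ x • (c • g : Lp (E n) (ENNReal.ofReal ρ) (volume : Measure RModZ)) x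
    rw [hf, hg, integral_smul, integral_smul, e, smul_neg]

/-- The Sobolev-Slobodeckij space `W^{1+s,ρ}(ℝ/ℤ, ℝⁿ)`, as a type of its own (it carries its own
norm and not the one of the product it is cut out from). -/
def Sobolev (n : ℕ) (s ρ : ℝ) [Fact (1 ≤ ρ)] : Type := sobolevSubmodule n s ρ

namespace Sobolev

variable {n : ℕ} {s ρ : ℝ} [hρ : Fact (1 ≤ ρ)]

instance : AddCommGroup (Sobolev n s ρ) := inferInstanceAs (AddCommGroup (sobolevSubmodule n s ρ))

instance : Module ℝ (Sobolev n s ρ) := inferInstanceAs (Module ℝ (sobolevSubmodule n s ρ))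

/-- A Sobolev curve is used as a function on `ℝ/ℤ` (the continuous representative). -/
instance : CoeFun (Sobolev n s ρ) fun _ => RModZ → E n := ⟨fun γ => ⇑γ.1.1⟩

/-- The (weak) derivative `γ'` of a Sobolev curve. -/
def deriv (γ : Sobolev n s ρ) : Lp (E n) (ENNReal.ofReal ρ) (volume : Measure RModZ) := γ.1.2

/-- The norm `‖f‖_{L^ρ} + ‖f'‖_{L^ρ} + [f]_{W^{1+s,ρ}}`, where
`[f]_{W^{1+s,ρ}} = (∫_{ℝ/ℤ} ∫_{-1/2}^{1/2} |f'(u+w) - f'(u)|^ρ / |w|^{1+ρs} dw du)^{1/ρ}`. -/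
instance : Norm (Sobolev n s ρ) where
  norm γ := (eLpNorm ⇑γ (ENNReal.ofReal ρ) volume).toReal
    + (eLpNorm ⇑γ.deriv (ENNReal.ofReal ρ) volume).toReal
    + (eLpNorm (diffQuot s ρ ⇑γ.deriv) (ENNReal.ofReal ρ) slobodeckijMeasure).toReal

lemma norm_def (γ : Sobolev n s ρ) : ‖γ‖ = (eLpNorm ⇑γ (ENNReal.ofReal ρ) volume).toReal
    + (eLpNorm ⇑γ.deriv (ENNReal.ofReal ρ) volume).toReal
    + (eLpNorm (diffQuot s ρ ⇑γ.deriv) (ENNReal.ofReal ρ) slobodeckijMeasure).toReal := rfl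

lemma coe_add (γ η : Sobolev n s ρ) : ⇑(γ + η) = ⇑γ + ⇑η := rfl

lemma coe_smul (c : ℝ) (γ : Sobolev n s ρ) : ⇑(c • γ) = c • ⇑γ := rfl

lemma deriv_add (γ η : Sobolev n s ρ) : (γ + η).deriv = γ.deriv + η.deriv := rfl

lemma deriv_smul (c : ℝ) (γ : Sobolev n s ρ) : (c • γ).deriv = c • γ.deriv := rfl

lemma ext {γ η : Sobolev n s ρ} (h : ⇑γ = ⇑η) (h' : γ.deriv = η.deriv) : γ = η :=
  Subtype.ext (Prod.ext (DFunLike.coe_injective h) h')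

lemma continuous (γ : Sobolev n s ρ) : Continuous ⇑γ := γ.1.1.continuous

lemma memLp_coe (γ : Sobolev n s ρ) : MemLp ⇑γ (ENNReal.ofReal ρ) volume :=
  γ.continuous.memLp_of_hasCompactSupport (HasCompactSupport.of_compactSpace _)

lemma memLp_diffQuot (γ : Sobolev n s ρ) :
    MemLp (diffQuot s ρ ⇑γ.deriv) (ENNReal.ofReal ρ) slobodeckijMeasure := γ.2.2

lemma one_le_exponent : (1 : ℝ≥0∞) ≤ ENNReal.ofReal ρ := by simpa using hρ.out

lemma toReal_eLpNorm_add_le {α : Type*} [MeasurableSpace α] {μ : Measure α} {r : ℝ≥0∞}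
    (hr : 1 ≤ r) {f g : α → E n} (hf : MemLp f r μ) (hg : MemLp g r μ) :
    (eLpNorm (f + g) r μ).toReal ≤ (eLpNorm f r μ).toReal + (eLpNorm g r μ).toReal := by
  rw [← ENNReal.toReal_add hf.2.ne hg.2.ne]
  exact ENNReal.toReal_mono (ENNReal.add_ne_top.2 ⟨hf.2.ne, hg.2.ne⟩)
    (eLpNorm_add_le hf.1 hg.1 hr)

lemma normedSpaceCore : NormedSpace.Core ℝ (Sobolev n s ρ) where
  norm_nonneg γ := by rw [norm_def]; positivity
  norm_smul c γ := by
    rw [norm_def, norm_def, coe_smul, deriv_smul, eLpNorm_congr_ae (Lp.coeFn_smul c γ.deriv),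
      eLpNorm_congr_ae (diffQuot_smul_ae s ρ c γ.deriv), eLpNorm_const_smul, eLpNorm_const_smul,
      eLpNorm_const_smul]
    simp only [ENNReal.toReal_mul, toReal_enorm]
    ring
  norm_triangle γ η := by
    rw [norm_def, norm_def, norm_def, coe_add, deriv_add,
      eLpNorm_congr_ae (Lp.coeFn_add γ.deriv η.deriv),
      eLpNorm_congr_ae (diffQuot_add_ae s ρ γ.deriv η.deriv)]
    have h1 := toReal_eLpNorm_add_le one_le_exponent γ.memLp_coe η.memLp_coe
    have h2 := toReal_eLpNorm_add_le one_le_exponent (Lp.memLp γ.deriv) (Lp.memLp η.deriv)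
    have h3 := toReal_eLpNorm_add_le one_le_exponent γ.memLp_diffQuot η.memLp_diffQuot
    linarith
  norm_eq_zero_iff γ := by
    have hpos : ENNReal.ofReal ρ ≠ 0 := (zero_lt_one.trans_le one_le_exponent).ne'
    constructor
    · intro h
      rw [norm_def] at h
      have h1 : (eLpNorm ⇑γ (ENNReal.ofReal ρ) volume).toReal = 0 := by
        have a := ENNReal.toReal_nonneg (a := eLpNorm ⇑γ (ENNReal.ofReal ρ) volume)
        have b := ENNReal.toReal_nonneg (a := eLpNorm ⇑γ.deriv (ENNReal.ofReal ρ) volume)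
        have c := ENNReal.toReal_nonneg
          (a := eLpNorm (diffQuot s ρ ⇑γ.deriv) (ENNReal.ofReal ρ) slobodeckijMeasure)
        linarith
      have h2 : (eLpNorm ⇑γ.deriv (ENNReal.ofReal ρ) volume).toReal = 0 := by
        have b := ENNReal.toReal_nonneg (a := eLpNorm ⇑γ.deriv (ENNReal.ofReal ρ) volume)
        have c := ENNReal.toReal_nonneg
          (a := eLpNorm (diffQuot s ρ ⇑γ.deriv) (ENNReal.ofReal ρ) slobodeckijMeasure)
        linarith
      rw [ENNReal.toReal_eq_zero_iff, or_iff_left γ.memLp_coe.2.ne,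
        eLpNorm_eq_zero_iff γ.memLp_coe.1 hpos] at h1
      rw [ENNReal.toReal_eq_zero_iff, or_iff_left (Lp.memLp γ.deriv).2.ne,
        eLpNorm_eq_zero_iff (Lp.memLp γ.deriv).1 hpos] at h2
      have h3 : ⇑γ = 0 := (γ.continuous.ae_eq_iff_eq volume continuous_zero).1 h1
      refine ext h3 ?_
      exact (Lp.eq_zero_iff_ae_eq_zero).2 h2
    · rintro rfl
      have h : ‖(0 : Sobolev n s ρ)‖ = ‖(0 : ℝ) • (0 : Sobolev n s ρ)‖ := by rw [zero_smul]
      have e : diffQuot s ρ ⇑((0 : ℝ) • (0 : Sobolev n s ρ)).deriv =ᵐ[slobodeckijMeasure] 0 := by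
        rw [deriv_smul]
        refine (diffQuot_smul_ae s ρ 0 _).trans (by simp)
      have e' : ⇑((0 : ℝ) • (0 : Sobolev n s ρ)).deriv =ᵐ[volume] 0 := by
        rw [deriv_smul]
        refine (Lp.coeFn_smul (0 : ℝ) _).trans (by simp)
      rw [h, norm_def, eLpNorm_congr_ae e, eLpNorm_congr_ae e', coe_smul, zero_smul]
      simp

instance : NormedAddCommGroup (Sobolev n s ρ) := NormedAddCommGroup.ofCore normedSpaceCore

instance : NormedSpace ℝ (Sobolev n s ρ) := NormedSpace.ofCore normedSpaceCore

/-- A curve is embedded if it is injective on `ℝ/ℤ`. -/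
def IsEmbedded (γ : Sobolev n s ρ) : Prop := Function.Injective ⇑γ

/-- A curve is regular if `|γ'| ≥ c` almost everywhere for some `c > 0`. -/
def IsRegular (γ : Sobolev n s ρ) : Prop := ∃ c > 0, ∀ᵐ u, c ≤ ‖γ.deriv u‖

/-- A curve is parametrized by arc-length if `|γ'| = 1` almost everywhere. -/
def IsArcLength (γ : Sobolev n s ρ) : Prop := ∀ᵐ u, ‖γ.deriv u‖ = 1

end Sobolev

instance factOneLe {q : ℝ} [h : Fact (1 < q)] : Fact (1 ≤ q) := ⟨h.out.le⟩

/-- The energy space `W^{(3p-2)/q-1,q}(ℝ/ℤ, ℝⁿ)`, that is, `W^{1+s,q}` for `s = (3p-2)/q - 2`. -/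
abbrev EnergySpace (n : ℕ) (p q : ℝ) [Fact (1 < q)] := Sobolev n ((3 * p - 2) / q - 2) q

/-- The set of all regular embedded curves in the energy space. -/
def regularEmbedded (n : ℕ) (p q : ℝ) [Fact (1 < q)] : Set (EnergySpace n p q) :=
  {γ | γ.IsRegular ∧ γ.IsEmbedded}

/-! ### Generalized integral Menger curvature -/

/-- The wedge product `a ∧ b ∈ Λ²ℝⁿ`, with the canonical inner product
`⟨a ∧ b, c ∧ d⟩ = ⟨a, c⟩⟨b, d⟩ - ⟨a, d⟩⟨b, c⟩` of Mathlib on `Λ²ℝⁿ`. -/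
def wedge {n : ℕ} (a b : E n) : ⋀[ℝ]^2 (E n) := exteriorPower.ιMulti ℝ 2 ![a, b]

/-- `1 / R^{(p,q)}(x,y,z) = |(y-x) ∧ (z-x)|^q / (|y-z| |y-x| |z-x|)^p`. -/
def invR {n : ℕ} (p q : ℝ) (x y z : E n) : ℝ :=
  ‖wedge (y - x) (z - x)‖ ^ q / (‖y - z‖ * ‖y - x‖ * ‖z - x‖) ^ p

/-- The generalized integral Menger curvature of a curve, with values in `[0, ∞]`:
`∭ |γ'(u₁)| |γ'(u₂)| |γ'(u₃)| / R^{(p,q)}(γ(u₁), γ(u₂), γ(u₃)) du₁ du₂ du₃`. -/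
def energy {n : ℕ} {s ρ : ℝ} [Fact (1 ≤ ρ)] (p q : ℝ) (γ : Sobolev n s ρ) : ℝ≥0∞ :=
  ∫⁻ x : RModZ × RModZ × RModZ, ENNReal.ofReal
    (‖γ.deriv x.1‖ * ‖γ.deriv x.2.1‖ * ‖γ.deriv x.2.2‖ * invR p q (γ x.1) (γ x.2.1) (γ x.2.2))

/-- The difference `T_{v,w} f = f(u + v) - f(u + w)`. -/
def T {n : ℕ} (f : RModZ → E n) (u v w : RModZ) : E n := f (u + v) - f (u + w)

section FirstVariation

variable {n : ℕ} {s ρ : ℝ} [Fact (1 ≤ ρ)]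

/-- The common denominator `(|T_{v,w}γ| |T_{v,0}γ| |T_{w,0}γ|)^p`. -/
def denom (p : ℝ) (γ : Sobolev n s ρ) (u v w : RModZ) : ℝ :=
  (‖T γ u v w‖ * ‖T γ u v 0‖ * ‖T γ u w 0‖) ^ p

/-- The first term of the first variation,
`2q |T_{v,0}γ ∧ T_{w,0}γ|^{q-2} / (...)^p * ⟨T_{v,0}γ ∧ T_{w,0}γ, T_{v,0}γ ∧ T_{w,0}h⟩`. -/
def wedgeTerm (p q : ℝ) (γ h : Sobolev n s ρ) (u v w : RModZ) : ℝ :=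
  2 * q * (‖wedge (T γ u v 0) (T γ u w 0)‖ ^ (q - 2) / denom p γ u v w) *
    ⟪wedge (T γ u v 0) (T γ u w 0), wedge (T γ u v 0) (T h u w 0)⟫

/-- The mean of the first term over the two orderings of `v` and `w`,
`q |T_{v,0}γ ∧ T_{w,0}γ|^{q-2} / (...)^p *
  ⟨T_{v,0}γ ∧ T_{w,0}γ, T_{v,0}h ∧ T_{w,0}γ + T_{v,0}γ ∧ T_{w,0}h⟩`. -/
def wedgeTermSymm (p q : ℝ) (γ h : Sobolev n s ρ) (u v w : RModZ) : ℝ :=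
  q * (‖wedge (T γ u v 0) (T γ u w 0)‖ ^ (q - 2) / denom p γ u v w) *
    ⟪wedge (T γ u v 0) (T γ u w 0),
      wedge (T h u v 0) (T γ u w 0) + wedge (T γ u v 0) (T h u w 0)⟫

/-- The second and the third term of the first variation,
`-3p |T_{v,0}γ ∧ T_{w,0}γ|^q / (...)^p * ⟨T_{v,w}γ, T_{v,w}h⟩ / |T_{v,w}γ|^2
  + 3 |T_{v,0}γ ∧ T_{w,0}γ|^q / (...)^p * ⟨γ'(u), h'(u)⟩`. -/
def lowerTerms (p q : ℝ) (γ h : Sobolev n s ρ) (u v w : RModZ) : ℝ :=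
  -(3 * p * (‖wedge (T γ u v 0) (T γ u w 0)‖ ^ q / denom p γ u v w) *
      (⟪T γ u v w, T h u v w⟫ / ‖T γ u v w‖ ^ 2))
    + 3 * (‖wedge (T γ u v 0) (T γ u w 0)‖ ^ q / denom p γ u v w) * ⟪γ.deriv u, h.deriv u⟫

/-- The integrand of the first variation, as a function of `(u, v, w)`. -/
def variationIntegrand (p q : ℝ) (γ h : Sobolev n s ρ) (x : RModZ × RModZ × RModZ) : ℝ :=
  wedgeTerm p q γ h x.1 x.2.1 x.2.2 + lowerTerms p q γ h x.1 x.2.1 x.2.2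

/-- The integrand of the first variation, its first term being symmetrized in `v` and `w`. -/
def variationIntegrandSymm (p q : ℝ) (γ h : Sobolev n s ρ) (x : RModZ × RModZ × RModZ) : ℝ :=
  wedgeTermSymm p q γ h x.1 x.2.1 x.2.2 + lowerTerms p q γ h x.1 x.2.1 x.2.2

end FirstVariation

/-- The set of all `(u, v, w)` for which the three parameters `u`, `u + v`, `u + w` have mutual
distance larger than `ε` in `ℝ/ℤ`. -/
def offDiagonal (ε : ℝ) : Set (RModZ × RModZ × RModZ) :=
  {x | ε < ‖x.2.1‖ ∧ ε < ‖x.2.2‖ ∧ ε < ‖x.2.1 - x.2.2‖}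

end MengerCurvature

end

open MeasureTheory Filter Topology Set
open scoped ENNReal ContDiff RealInnerProductSpace

noncomputable section

namespace MengerCurvature

/-! ### Continuous homogeneous maps and the `q`-th power of the `L^q`-norm -/

section Homogeneous

variable {F G : Type*} [NormedAddCommGroup F] [NormedSpace ℝ F] [ProperSpace F]
  [NormedAddCommGroup G] [NormedSpace ℝ G]

/-! The energy is the q-th power of an L^q-norm of a map that depends on the curve in a C¹ way. Let
D be the product of the three parameter distances, and let B(γ, η) be D^(-p/q) times the polarized
area 2-vector (`areaQuot`), so that B(γ, γ)/2 is the normalized area itself. On the triples of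
distinct parameters E(γ) = ‖e^Λ(γ) · B(γ, γ)/2‖_q^q, where e^(qΛ) is the product of the three speeds
divided by the p-th power of the product of the three secant lengths, each secant length being
divided by its parameter distance.

Four facts make this a composition of C¹ maps. The lower bound on p says that s > 1/q, so the Morrey
embedding (`exists_continuous_representative`) puts W into C¹; a regular embedded curve is then
bi-Lipschitz, and stays so under small perturbations (`exists_isBiLipschitz`,
`IsBiLipschitz.eventually`), which already gives openness. Secondly, B is a bounded bilinear map
from W × W to L^q (`exists_lintegral_areaQuot_le`). This is the analytic core: after a cyclic
permutation the side between the first and the third parameter is the shortest, the area becomes a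
difference of mean derivatives, and integrating out the remaining variables leaves exactly the
Slobodeckij seminorm. Thirdly, Λ is C¹ with values in the bounded continuous functions, because the
exponential of this Banach algebra is locally invertible (`exists_log_bddFun`). Finally, ψ ↦ ∫ ‖ψ‖^q
is C¹ on L^q for q > 1 (`contDiff_integral_norm_rpow`). The combination is
`contDiffAt_weighted_integral`.

The chain rule gives the variation as an absolutely convergent integral over triples. At unit speed
its three speed terms are cyclic images of each other, and so are its three secant terms, so
invariance of the measure replaces each sum by three times one term. This is the symmetrized
formula. The unsymmetrized area term has the same integral on every domain invariant under v ↔ w on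
which it is integrable, in particular off an ε-neighbourhood of the diagonals, and dominated
convergence gives the principal value. -/

lemma exists_norm_le_of_homogeneous {J : F → G} {r : ℝ} (hr : 0 < r) (hJ : Continuous J)
    (hhom : ∀ t : ℝ, 0 < t → ∀ x, J (t • x) = t ^ r • J x) (h0 : J 0 = 0) :
    ∃ K, 0 ≤ K ∧ ∀ x, ‖J x‖ ≤ K * ‖x‖ ^ r := by
  obtain ⟨K, hK⟩ := (isCompact_closedBall (0 : F) 1).exists_bound_of_continuousOn
    hJ.continuousOn
  have hK0 : 0 ≤ K := (norm_nonneg _).trans (hK 0 (by simp))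
  refine ⟨K, hK0, fun x => ?_⟩
  rcases eq_or_ne x 0 with rfl | hx
  · simp [h0, Real.zero_rpow hr.ne']
  · have hx' : 0 < ‖x‖ := norm_pos_iff.2 hx
    have e : J x = ‖x‖ ^ r • J (‖x‖⁻¹ • x) := by
      rw [← hhom _ hx', smul_smul, mul_inv_cancel₀ hx'.ne', one_smul]
    rw [e, norm_smul, Real.norm_of_nonneg (by positivity), mul_comm]
    gcongr
    refine hK _ ?_
    simp [norm_smul, hx'.ne']

/-- If b is small relative to a, scaling to ‖a‖ = 1 reduces to uniform continuity of J on a ball.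
Otherwise ‖a‖ is controlled by ‖b‖ and the growth bound for each of the two values suffices. -/
lemma exists_norm_sub_le_of_homogeneous {J : F → G} {r : ℝ} (hr : 0 < r) (hJ : Continuous J)
    (hhom : ∀ t : ℝ, 0 < t → ∀ x, J (t • x) = t ^ r • J x) (h0 : J 0 = 0) {ε : ℝ} (hε : 0 < ε) :
    ∃ C, 0 ≤ C ∧ ∀ a b, ‖J (a + b) - J a‖ ≤ ε * ‖a‖ ^ r + C * ‖b‖ ^ r := by
  obtain ⟨K, hK0, hK⟩ := exists_norm_le_of_homogeneous hr hJ hhom h0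
  have huc := (isCompact_closedBall (0 : F) 2).uniformContinuousOn_of_continuous hJ.continuousOn
  obtain ⟨δ, hδ, hδ'⟩ := Metric.uniformContinuousOn_iff.1 huc ε hε
  set d := min δ 1 with hd
  have hd0 : 0 < d := lt_min hδ one_pos
  -- When d‖a‖ ≤ ‖b‖, both a and a + b have norm at most (1 + 1/d)‖b‖; the factor 2 is for the two
  -- values of J.
  refine ⟨2 * K * (1 + 1 / d) ^ r, by positivity, fun a b => ?_⟩
  by_cases hab : ‖b‖ < d * ‖a‖
  · have ha : 0 < ‖a‖ := by
      by_contra h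
      have : ‖a‖ = 0 := le_antisymm (not_lt.1 h) (norm_nonneg a)
      rw [this, mul_zero] at hab
      exact absurd hab (not_lt.2 (norm_nonneg b))
    have e : ∀ x, J x = ‖a‖ ^ r • J (‖a‖⁻¹ • x) := fun x => by
      rw [← hhom _ ha, smul_smul, mul_inv_cancel₀ ha.ne', one_smul]
    have hb : ‖‖a‖⁻¹ • b‖ < d := by
      rw [norm_smul, norm_inv, norm_norm, inv_mul_lt_iff₀ ha, mul_comm]; exact hab
    have ha1 : ‖‖a‖⁻¹ • a‖ = 1 := by simp [norm_smul, ha.ne']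
    have key : ‖J (‖a‖⁻¹ • (a + b)) - J (‖a‖⁻¹ • a)‖ ≤ ε := by
      rw [← dist_eq_norm]
      refine (hδ' _ ?_ _ ?_ ?_).le
      · rw [mem_closedBall_zero_iff, smul_add]
        refine (norm_add_le _ _).trans ?_
        have := min_le_right δ 1
        linarith
      · rw [mem_closedBall_zero_iff, ha1]; norm_num
      · rw [dist_eq_norm, smul_add, add_sub_cancel_left]
        exact hb.trans_le (min_le_left _ _)
    rw [e (a + b), e a, ← smul_sub, norm_smul, Real.norm_of_nonneg (by positivity)]
    have : ‖a‖ ^ r * ‖J (‖a‖⁻¹ • (a + b)) - J (‖a‖⁻¹ • a)‖ ≤ ‖a‖ ^ r * ε := by gcongr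
    have h2 : 0 ≤ 2 * K * (1 + 1 / d) ^ r * ‖b‖ ^ r := by positivity
    linarith
  · rw [not_lt] at hab
    have ha : ‖a‖ ≤ 1 / d * ‖b‖ := by
      rw [div_mul_eq_mul_div, one_mul, le_div_iff₀ hd0, mul_comm]; exact hab
    have h1 : ‖J (a + b)‖ ≤ K * ((1 + 1 / d) ^ r * ‖b‖ ^ r) := by
      rw [← Real.mul_rpow (by positivity) (norm_nonneg _)]
      refine (hK _).trans ?_
      gcongr
      refine (norm_add_le _ _).trans ?_
      linarith
    have h2 : ‖J a‖ ≤ K * ((1 + 1 / d) ^ r * ‖b‖ ^ r) := by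
      rw [← Real.mul_rpow (by positivity) (norm_nonneg _)]
      refine (hK _).trans ?_
      gcongr
      linarith [norm_nonneg b]
    have h3 : 0 ≤ ε * ‖a‖ ^ r := by positivity
    have := norm_sub_le (J (a + b)) (J a)
    linarith

end Homogeneous

/-! ### The q-th power of the norm and its derivative -/

section NormPow

variable {F : Type*} [NormedAddCommGroup F] [InnerProductSpace ℝ F]

/-- The derivative of `x ↦ ‖x‖ ^ q`. -/
def normPowDeriv (q : ℝ) (x : F) : F →L[ℝ] ℝ := (q * ‖x‖ ^ (q - 2)) • innerSL ℝ x

lemma normPowDeriv_apply (q : ℝ) (x y : F) :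
    normPowDeriv q x y = q * ‖x‖ ^ (q - 2) * ⟪x, y⟫ := by
  simp [normPowDeriv]

lemma hasFDerivAt_normPow {q : ℝ} (hq : 1 < q) (x : F) :
    HasFDerivAt (fun x : F => ‖x‖ ^ q) (normPowDeriv q x) x := hasFDerivAt_norm_rpow x hq

lemma continuous_normPowDeriv {q : ℝ} (hq : 1 < q) : Continuous (normPowDeriv q (F := F)) := by
  have h := (contDiff_norm_rpow (E := F) hq).continuous_fderiv (by simp)
  convert h using 1
  ext1 x
  exact (hasFDerivAt_normPow hq x).fderiv.symm

lemma normPowDeriv_smul {q t : ℝ} (ht : 0 < t) (x : F) :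
    normPowDeriv q (t • x) = t ^ (q - 1) • normPowDeriv q x := by
  have : q - 1 = (q - 2) + 1 := by ring
  ext y
  simp only [normPowDeriv_apply, norm_smul, Real.norm_of_nonneg ht.le, real_inner_smul_left,
    _root_.smul_apply, smul_eq_mul]
  rw [Real.mul_rpow ht.le (norm_nonneg _), this, Real.rpow_add ht, Real.rpow_one]
  ring

lemma normPowDeriv_zero (q : ℝ) : normPowDeriv q (0 : F) = 0 := by
  ext y; simp [normPowDeriv_apply]

/-- The derivative is continuous and homogeneous of degree q - 1 > 0. Using only this avoids a
distinction between q < 2, where it is merely Hölder continuous, and q ≥ 2. -/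
lemma exists_norm_normPowDeriv_sub_le [ProperSpace F] {q : ℝ} (hq : 1 < q) {ε : ℝ} (hε : 0 < ε) :
    ∃ C, 0 ≤ C ∧ ∀ a b : F, ‖normPowDeriv q (a + b) - normPowDeriv q a‖
      ≤ ε * ‖a‖ ^ (q - 1) + C * ‖b‖ ^ (q - 1) :=
  exists_norm_sub_le_of_homogeneous (by linarith) (continuous_normPowDeriv hq)
    (fun _ ht x => normPowDeriv_smul ht x) (normPowDeriv_zero q) hε

lemma exists_norm_normPowDeriv_le [ProperSpace F] {q : ℝ} (hq : 1 < q) :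
    ∃ C, 0 ≤ C ∧ ∀ a : F, ‖normPowDeriv q a‖ ≤ C * ‖a‖ ^ (q - 1) :=
  exists_norm_le_of_homogeneous (by linarith) (continuous_normPowDeriv hq)
    (fun _ ht x => normPowDeriv_smul ht x) (normPowDeriv_zero q)

/-- Mean value inequality on the segment from a to a + b, with the oscillation of the derivative
bounded by the previous estimate. -/
lemma exists_normPow_remainder_le [ProperSpace F] {q : ℝ} (hq : 1 < q) {ε : ℝ} (hε : 0 < ε) :
    ∃ C, 0 ≤ C ∧ ∀ a b : F, |‖a + b‖ ^ q - ‖a‖ ^ q - normPowDeriv q a b|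
      ≤ ε * (‖a‖ ^ (q - 1) * ‖b‖) + C * ‖b‖ ^ q := by
  obtain ⟨C, hC, h⟩ := exists_norm_normPowDeriv_sub_le (F := F) hq hε
  refine ⟨C, hC, fun a b => ?_⟩
  have hb : ‖b‖ ^ q = ‖b‖ ^ (q - 1) * ‖b‖ := by
    rw [← Real.rpow_add_one' (norm_nonneg _) (by linarith)]; congr 1; ring
  have := Convex.norm_image_sub_le_of_norm_hasFDerivWithin_le' (s := segment ℝ a (a + b))
    (f := fun x : F => ‖x‖ ^ q) (f' := normPowDeriv q) (φ := normPowDeriv q a)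
    (C := ε * ‖a‖ ^ (q - 1) + C * ‖b‖ ^ (q - 1)) (x := a) (y := a + b)
    (fun x _ => (hasFDerivAt_normPow hq x).hasFDerivWithinAt) ?_ (convex_segment _ _)
    (left_mem_segment _ _ _) (right_mem_segment _ _ _)
  · rw [add_sub_cancel_left, Real.norm_eq_abs] at this
    rw [hb]
    linarith
  · intro x hx
    rw [segment_eq_image'] at hx
    obtain ⟨t, ht, rfl⟩ := hx
    simp only [add_sub_cancel_left]
    refine (h a (t • b)).trans ?_
    have : ‖t • b‖ ≤ ‖b‖ := by
      rw [norm_smul, Real.norm_of_nonneg ht.1]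
      exact mul_le_of_le_one_left (norm_nonneg _) ht.2
    have : ‖t • b‖ ^ (q - 1) ≤ ‖b‖ ^ (q - 1) :=
      Real.rpow_le_rpow (norm_nonneg _) this (by linarith)
    gcongr

end NormPow

/-! ### Continuous differentiability of the q-th power of the `L^q`-norm -/

section LpPower

lemma continuousAt_of_norm_sub_lt {X Y : Type*} [TopologicalSpace X] [SeminormedAddCommGroup Y]
    {f : X → Y} {a : X} (h : ∀ c : ℝ, 0 < c → ∀ᶠ x in 𝓝 a, ‖f x - f a‖ < c) :
    ContinuousAt f a := by
  refine Metric.continuousAt_iff'.2 fun c hc => ?_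
  simpa only [dist_eq_norm] using h c hc


variable {α : Type*} [MeasurableSpace α] {μ : Measure α}
  {F : Type*} [NormedAddCommGroup F] {q : ℝ}

lemma integral_norm_rpow_eq (hq : 1 < q) (ψ : Lp F (ENNReal.ofReal q) μ) :
    ∫ x, ‖ψ x‖ ^ q ∂μ = ‖ψ‖ ^ q := by
  have h0 : 0 ≤ ∫ x, ‖ψ x‖ ^ q ∂μ := integral_nonneg fun x => by positivity
  rw [Lp.norm_def, (Lp.memLp ψ).eLpNorm_eq_integral_rpow_norm (by simp; linarith) (by simp),
    ENNReal.toReal_ofReal (by positivity), ENNReal.toReal_ofReal (by linarith),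
    ← Real.rpow_mul h0, inv_mul_cancel₀ (by linarith), Real.rpow_one]

lemma integrable_norm_rpow (hq : 1 < q) (ψ : Lp F (ENNReal.ofReal q) μ) :
    Integrable (fun x => ‖ψ x‖ ^ q) μ := by
  have := (Lp.memLp ψ).norm_rpow (by simp; linarith) (by simp)
  rw [ENNReal.toReal_ofReal (by linarith)] at this
  exact memLp_one_iff_integrable.1 this

lemma memLp_norm_rpow_sub_one (hq : 1 < q) (ψ : Lp F (ENNReal.ofReal q) μ) :
    MemLp (fun x => ‖ψ x‖ ^ (q - 1)) (ENNReal.ofReal (q / (q - 1))) μ := by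
  have := (Lp.memLp ψ).norm_rpow_div (ENNReal.ofReal (q - 1))
  rwa [ENNReal.toReal_ofReal (by linarith), ← ENNReal.ofReal_div_of_pos (by linarith)] at this

lemma integrable_norm_rpow_mul (hq : 1 < q) (ψ φ : Lp F (ENNReal.ofReal q) μ) :
    Integrable (fun x => ‖ψ x‖ ^ (q - 1) * ‖φ x‖) μ := by
  have hc : (q / (q - 1)).HolderConjugate q := (Real.HolderConjugate.conjExponent hq).symm
  have := hc.ennrealOfReal
  exact (memLp_norm_rpow_sub_one hq ψ).integrable_mul (Lp.memLp φ).norm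

/-- Hölder's inequality with the conjugate exponents q/(q-1) and q. -/
lemma integral_norm_rpow_mul_le (hq : 1 < q) (ψ φ : Lp F (ENNReal.ofReal q) μ) :
    ∫ x, ‖ψ x‖ ^ (q - 1) * ‖φ x‖ ∂μ ≤ ‖ψ‖ ^ (q - 1) * ‖φ‖ := by
  have hc : (q / (q - 1)).HolderConjugate q := (Real.HolderConjugate.conjExponent hq).symm
  have h := integral_mul_le_Lp_mul_Lq_of_nonneg (μ := μ) hc
    (f := fun x => ‖ψ x‖ ^ (q - 1)) (g := fun x => ‖φ x‖)
    (ae_of_all _ fun x => by positivity) (ae_of_all _ fun x => by positivity)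
    (memLp_norm_rpow_sub_one hq ψ) (Lp.memLp φ).norm
  have h1 : 0 ≤ ‖ψ‖ := ENNReal.toReal_nonneg
  have h2 : 0 ≤ ‖φ‖ := ENNReal.toReal_nonneg
  have hq1 : q - 1 ≠ 0 := by linarith
  have hq0 : q ≠ 0 := by linarith
  have e : ∀ x, (‖ψ x‖ ^ (q - 1)) ^ (q / (q - 1)) = ‖ψ x‖ ^ q := fun x => by
    rw [← Real.rpow_mul (norm_nonneg _)]; congr 1; field_simp
  simp only [e] at h
  rw [integral_norm_rpow_eq hq, integral_norm_rpow_eq hq, ← Real.rpow_mul h1,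
    ← Real.rpow_mul h2] at h
  refine h.trans_eq ?_
  rw [mul_one_div_cancel hq0, Real.rpow_one]
  congr 2
  field_simp

variable [InnerProductSpace ℝ F]

lemma aestronglyMeasurable_normPowDeriv (hq : 1 < q) (ψ φ : Lp F (ENNReal.ofReal q) μ) :
    AEStronglyMeasurable (fun x => normPowDeriv q (ψ x) (φ x)) μ :=
  (ContinuousLinearMap.apply ℝ ℝ (E := F)).flip.aestronglyMeasurable_comp₂
    ((continuous_normPowDeriv hq).comp_aestronglyMeasurable (Lp.aestronglyMeasurable ψ))
    (Lp.aestronglyMeasurable φ)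

variable [ProperSpace F]

lemma integrable_normPowDeriv (hq : 1 < q) (ψ φ : Lp F (ENNReal.ofReal q) μ) :
    Integrable (fun x => normPowDeriv q (ψ x) (φ x)) μ := by
  obtain ⟨C, hC, h⟩ := exists_norm_normPowDeriv_le (F := F) hq
  refine ((integrable_norm_rpow_mul hq ψ φ).const_mul C).mono'
    (aestronglyMeasurable_normPowDeriv hq ψ φ) (ae_of_all _ fun x => ?_)
  refine (ContinuousLinearMap.le_opNorm _ _).trans ?_
  rw [← mul_assoc]
  gcongr
  exact h _

lemma exists_norm_integral_normPowDeriv_le (hq : 1 < q) : ∃ C, 0 ≤ C ∧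
    ∀ ψ φ : Lp F (ENNReal.ofReal q) μ,
      ‖∫ x, normPowDeriv q (ψ x) (φ x) ∂μ‖ ≤ C * ‖ψ‖ ^ (q - 1) * ‖φ‖ := by
  obtain ⟨C, hC, h⟩ := exists_norm_normPowDeriv_le (F := F) hq
  refine ⟨C, hC, fun ψ φ => ?_⟩
  calc ‖∫ x, normPowDeriv q (ψ x) (φ x) ∂μ‖
      ≤ ∫ x, C * (‖ψ x‖ ^ (q - 1) * ‖φ x‖) ∂μ := by
        refine norm_integral_le_of_norm_le ((integrable_norm_rpow_mul hq ψ φ).const_mul C)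
          (ae_of_all _ fun x => ?_)
        refine (ContinuousLinearMap.le_opNorm _ _).trans ?_
        rw [← mul_assoc]
        gcongr
        exact h _
    _ ≤ C * ‖ψ‖ ^ (q - 1) * ‖φ‖ := by
        rw [integral_const_mul, mul_assoc]
        gcongr
        exact integral_norm_rpow_mul_le hq ψ φ

/-- The derivative of `ψ ↦ ∫ ‖ψ‖ ^ q` on `L^q`. -/
def lpPowDeriv [hq : Fact (1 < q)] [Fact (1 ≤ ENNReal.ofReal q)] (ψ : Lp F (ENNReal.ofReal q) μ) :
    Lp F (ENNReal.ofReal q) μ →L[ℝ] ℝ :=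
  LinearMap.mkContinuous
    { toFun := fun φ => ∫ x, normPowDeriv q (ψ x) (φ x) ∂μ
      map_add' := fun φ₁ φ₂ => by
        rw [← integral_add (integrable_normPowDeriv hq.out ψ φ₁)
          (integrable_normPowDeriv hq.out ψ φ₂)]
        refine integral_congr_ae ?_
        filter_upwards [Lp.coeFn_add φ₁ φ₂] with x hx
        rw [hx, Pi.add_apply, map_add]
      map_smul' := fun c φ => by
        rw [RingHom.id_apply, ← integral_smul]
        refine integral_congr_ae ?_
        filter_upwards [Lp.coeFn_smul c φ] with x hx
        rw [hx, Pi.smul_apply, map_smul] }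
    ((exists_norm_integral_normPowDeriv_le (μ := μ) (F := F) hq.out).choose * ‖ψ‖ ^ (q - 1))
    ((exists_norm_integral_normPowDeriv_le (μ := μ) (F := F) hq.out).choose_spec.2 ψ)

variable [hq : Fact (1 < q)] [Fact (1 ≤ ENNReal.ofReal q)]

lemma lpPowDeriv_apply (ψ φ : Lp F (ENNReal.ofReal q) μ) :
    lpPowDeriv ψ φ = ∫ x, normPowDeriv q (ψ x) (φ x) ∂μ := rfl

/-- Integrating the pointwise remainder and applying Hölder bounds it by (ε‖ψ‖^(q-1) +
C‖φ‖^(q-1))‖φ‖. Here ε is fixed first, depending on ψ, and then φ is taken small depending on C. -/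
lemma hasFDerivAt_integral_norm_rpow (ψ : Lp F (ENNReal.ofReal q) μ) :
    HasFDerivAt (fun ψ : Lp F (ENNReal.ofReal q) μ => ∫ x, ‖ψ x‖ ^ q ∂μ) (lpPowDeriv ψ) ψ := by
  have hq1 := hq.out
  rw [hasFDerivAt_iff_isLittleO_nhds_zero, Asymptotics.isLittleO_iff]
  intro c hc
  -- This makes the ψ-term at most c/2; the summand 1 keeps the denominator positive when ψ = 0.
  set ε := c / 2 / (‖ψ‖ ^ (q - 1) + 1) with hε
  have hε0 : 0 < ε := by positivity
  obtain ⟨C, hC, h⟩ := exists_normPow_remainder_le (F := F) hq1 hε0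
  have hlim : Tendsto (fun φ : Lp F (ENNReal.ofReal q) μ => C * ‖φ‖ ^ (q - 1)) (𝓝 0) (𝓝 0) := by
    have : Continuous fun φ : Lp F (ENNReal.ofReal q) μ => C * ‖φ‖ ^ (q - 1) :=
      continuous_const.mul (continuous_norm.rpow_const fun _ => Or.inr (by linarith))
    convert this.tendsto 0
    simp [Real.zero_rpow (by linarith : q - 1 ≠ 0)]
  filter_upwards [hlim.eventually (gt_mem_nhds (half_pos hc))] with φ hφ
  have hint : ∫ x, ‖(ψ + φ) x‖ ^ q ∂μ - ∫ x, ‖ψ x‖ ^ q ∂μ - lpPowDeriv ψ φ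
      = ∫ x, (‖ψ x + φ x‖ ^ q - ‖ψ x‖ ^ q - normPowDeriv q (ψ x) (φ x)) ∂μ := by
    have e : (fun x => ‖(ψ + φ) x‖ ^ q) =ᵐ[μ] fun x => ‖ψ x + φ x‖ ^ q := by
      filter_upwards [Lp.coeFn_add ψ φ] with x hx
      rw [hx, Pi.add_apply]
    have i := (integrable_norm_rpow hq1 (ψ + φ)).congr e
    have i₂ : Integrable (fun x => ‖ψ x + φ x‖ ^ q - ‖ψ x‖ ^ q) μ :=
      i.sub (integrable_norm_rpow hq1 ψ)
    rw [integral_sub i₂ (integrable_normPowDeriv hq1 ψ φ),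
      integral_sub i (integrable_norm_rpow hq1 ψ), integral_congr_ae e, lpPowDeriv_apply]
  rw [hint]
  calc ‖∫ x, (‖ψ x + φ x‖ ^ q - ‖ψ x‖ ^ q - normPowDeriv q (ψ x) (φ x)) ∂μ‖
      ≤ ∫ x, (ε * (‖ψ x‖ ^ (q - 1) * ‖φ x‖) + C * ‖φ x‖ ^ q) ∂μ :=
        norm_integral_le_of_norm_le (((integrable_norm_rpow_mul hq1 ψ φ).const_mul ε).add
          ((integrable_norm_rpow hq1 φ).const_mul C)) (ae_of_all _ fun x => h _ _)
    _ = ε * (∫ x, ‖ψ x‖ ^ (q - 1) * ‖φ x‖ ∂μ) + C * ‖φ‖ ^ q := by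
        rw [integral_add ((integrable_norm_rpow_mul hq1 ψ φ).const_mul ε)
          ((integrable_norm_rpow hq1 φ).const_mul C), integral_const_mul, integral_const_mul,
          integral_norm_rpow_eq hq1]
    _ ≤ ε * (‖ψ‖ ^ (q - 1) * ‖φ‖) + C * (‖φ‖ ^ (q - 1) * ‖φ‖) := by
        have hb : ‖φ‖ ^ q = ‖φ‖ ^ (q - 1) * ‖φ‖ := by
          rw [← Real.rpow_add_one' (norm_nonneg _) (by linarith)]; congr 1; ring
        rw [hb]
        gcongr
        exact integral_norm_rpow_mul_le hq1 ψ φ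
    _ ≤ c * ‖φ‖ := by
        have h1 : ε * ‖ψ‖ ^ (q - 1) ≤ c / 2 := by
          rw [hε, div_mul_eq_mul_div, div_le_iff₀ (by positivity)]
          have := hc.le
          gcongr
          linarith
        have h2 : (ε * ‖ψ‖ ^ (q - 1) + C * ‖φ‖ ^ (q - 1)) * ‖φ‖ ≤ c * ‖φ‖ := by
          gcongr
          linarith
        linarith

/-- The pointwise oscillation bound of the derivative, tested against η and integrated with Hölder.
It yields norm continuity of the derivative by the same order of choices as for differentiability.
-/
lemma exists_norm_lpPowDeriv_sub_le {ε : ℝ} (hε0 : 0 < ε) : ∃ C, 0 ≤ C ∧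
    ∀ φ ψ : Lp F (ENNReal.ofReal q) μ,
      ‖lpPowDeriv φ - lpPowDeriv ψ‖ ≤ ε * ‖ψ‖ ^ (q - 1) + C * ‖φ - ψ‖ ^ (q - 1) := by
  have hq1 := hq.out
  obtain ⟨C, hC, h⟩ := exists_norm_normPowDeriv_sub_le (F := F) hq1 hε0
  refine ⟨C, hC, fun φ ψ => ContinuousLinearMap.opNorm_le_bound _ (by positivity) fun η => ?_⟩
  have hsub : (lpPowDeriv φ - lpPowDeriv ψ) η
      = ∫ x, (normPowDeriv q (φ x) (η x) - normPowDeriv q (ψ x) (η x)) ∂μ :=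
    (integral_sub (integrable_normPowDeriv hq1 φ η) (integrable_normPowDeriv hq1 ψ η)).symm
  rw [hsub]
  calc ‖∫ x, (normPowDeriv q (φ x) (η x) - normPowDeriv q (ψ x) (η x)) ∂μ‖
      ≤ ∫ x, (ε * (‖ψ x‖ ^ (q - 1) * ‖η x‖) + C * (‖(φ - ψ) x‖ ^ (q - 1) * ‖η x‖)) ∂μ := by
        refine norm_integral_le_of_norm_le (((integrable_norm_rpow_mul hq1 ψ η).const_mul ε).add
          ((integrable_norm_rpow_mul hq1 (φ - ψ) η).const_mul C)) ?_
        filter_upwards [Lp.coeFn_sub φ ψ] with x hx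
        have hk := h (ψ x) (φ x - ψ x)
        rw [add_sub_cancel] at hk
        rw [hx, Pi.sub_apply]
        refine (ContinuousLinearMap.le_opNorm (normPowDeriv q (φ x) - normPowDeriv q (ψ x))
          (η x)).trans ?_
        rw [← mul_assoc, ← mul_assoc, ← add_mul]
        gcongr
    _ = ε * (∫ x, ‖ψ x‖ ^ (q - 1) * ‖η x‖ ∂μ)
        + C * (∫ x, ‖(φ - ψ) x‖ ^ (q - 1) * ‖η x‖ ∂μ) := by
        rw [integral_add ((integrable_norm_rpow_mul hq1 ψ η).const_mul ε)
          ((integrable_norm_rpow_mul hq1 (φ - ψ) η).const_mul C), integral_const_mul,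
          integral_const_mul]
    _ ≤ ε * (‖ψ‖ ^ (q - 1) * ‖η‖) + C * (‖φ - ψ‖ ^ (q - 1) * ‖η‖) := by
        gcongr
        · exact integral_norm_rpow_mul_le hq1 ψ η
        · exact integral_norm_rpow_mul_le hq1 (φ - ψ) η
    _ = (ε * ‖ψ‖ ^ (q - 1) + C * ‖φ - ψ‖ ^ (q - 1)) * ‖η‖ := by ring

lemma continuous_lpPowDeriv : Continuous (lpPowDeriv (μ := μ) (F := F) (q := q)) := by
  have hq1 := hq.out
  rw [continuous_iff_continuousAt]
  intro ψ
  refine continuousAt_of_norm_sub_lt (Y := Lp F (ENNReal.ofReal q) μ →L[ℝ] ℝ) fun c hc => ?_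
  set ε := c / 2 / (‖ψ‖ ^ (q - 1) + 1) with hε
  have hε0 : 0 < ε := by positivity
  obtain ⟨C, hC, h⟩ := exists_norm_lpPowDeriv_sub_le (q := q) (μ := μ) (F := F) hε0
  have hlim : Tendsto (fun φ : Lp F (ENNReal.ofReal q) μ => C * ‖φ - ψ‖ ^ (q - 1)) (𝓝 ψ) (𝓝 0) := by
    have : Continuous fun φ : Lp F (ENNReal.ofReal q) μ => C * ‖φ - ψ‖ ^ (q - 1) :=
      continuous_const.mul ((continuous_id.sub continuous_const).norm.rpow_const
        fun _ => Or.inr (by linarith))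
    convert this.tendsto ψ
    simp [Real.zero_rpow (by linarith : q - 1 ≠ 0)]
  filter_upwards [hlim.eventually (gt_mem_nhds (half_pos hc))] with φ hφ
  have hb := h φ ψ
  have h1 : ε * ‖ψ‖ ^ (q - 1) ≤ c / 2 := by
    rw [hε, div_mul_eq_mul_div, div_le_iff₀ (by positivity)]
    have := hc.le
    gcongr
    linarith
  linarith

lemma contDiff_integral_norm_rpow :
    ContDiff ℝ 1 (fun ψ : Lp F (ENNReal.ofReal q) μ => ∫ x, ‖ψ x‖ ^ q ∂μ) :=
  contDiff_one_iff_hasFDerivAt.2 ⟨_, continuous_lpPowDeriv, hasFDerivAt_integral_norm_rpow⟩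

end LpPower

/-! ### The wedge product -/

section Wedge

variable {n : ℕ}

lemma inner_wedge (a b c d : E n) : ⟪wedge a b, wedge c d⟫ = ⟪a, c⟫ * ⟪b, d⟫ - ⟪a, d⟫ * ⟪b, c⟫ := by
  rw [wedge, wedge, exteriorPower.inner_ιMulti_ιMulti, Matrix.det_fin_two]
  simp [mul_comm]

/-- By the Gram determinant, ‖a ∧ b‖² = ‖a‖²‖b‖² - ⟪a, b⟫². -/
lemma norm_wedge_le (a b : E n) : ‖wedge a b‖ ≤ ‖a‖ * ‖b‖ := by
  have h : ‖wedge a b‖ ^ 2 ≤ (‖a‖ * ‖b‖) ^ 2 := by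
    rw [← real_inner_self_eq_norm_sq, inner_wedge, real_inner_self_eq_norm_sq,
      real_inner_self_eq_norm_sq, real_inner_comm]
    nlinarith [mul_self_nonneg (⟪b, a⟫ : ℝ)]
  exact le_of_sq_le_sq h (by positivity)

lemma wedge_add_left (a b c : E n) : wedge (a + b) c = wedge a c + wedge b c := by
  have e : ∀ x, Function.update ![a, c] 0 x = ![x, c] := fun x => by
    ext i; fin_cases i <;> simp
  have := (exteriorPower.ιMulti ℝ 2 (M := E n)).map_update_add ![a, c] 0 a b
  rwa [e, e, e] at this

lemma wedge_smul_left (t : ℝ) (a c : E n) : wedge (t • a) c = t • wedge a c := by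
  have e : ∀ x, Function.update ![a, c] 0 x = ![x, c] := fun x => by
    ext i; fin_cases i <;> simp
  have := (exteriorPower.ιMulti ℝ 2 (M := E n)).map_update_smul ![a, c] 0 t a
  rwa [e, e] at this

lemma wedge_self (a : E n) : wedge a a = 0 :=
  (exteriorPower.ιMulti ℝ 2 (M := E n)).map_eq_zero_of_eq ![a, a] (i := 0) (j := 1) rfl (by decide)

lemma wedge_swap (a b : E n) : wedge a b = - wedge b a := by
  have := (exteriorPower.ιMulti ℝ 2 (M := E n)).map_swap ![b, a] (i := 0) (j := 1) (by decide)
  rw [wedge, wedge, ← this]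
  congr 1
  ext i
  fin_cases i <;> simp

/-- The wedge product as a continuous bilinear map. -/
def wedgeL (n : ℕ) : E n →L[ℝ] E n →L[ℝ] ⋀[ℝ]^2 (E n) :=
  LinearMap.mkContinuous₂ (LinearMap.mk₂ ℝ wedge wedge_add_left wedge_smul_left
    (fun a b c => by
      rw [wedge_swap a, wedge_add_left, wedge_swap b a, wedge_swap c a, neg_add, neg_neg, neg_neg])
    (fun t a b => by rw [wedge_swap a, wedge_smul_left, wedge_swap b a, smul_neg, neg_neg]))
    1 (fun a b => by rw [one_mul]; exact norm_wedge_le a b)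

@[simp] lemma wedgeL_apply (a b : E n) : wedgeL n a b = wedge a b := rfl

end Wedge

/-! ### Continuity of functions with finite Slobodeckij seminorm -/

section Jensen

variable {α β : Type*} [MeasurableSpace α] [MeasurableSpace β]

lemma rpow_lintegral_le {μ : Measure α} [IsProbabilityMeasure μ] {q : ℝ} (hq : 1 < q)
    {f : α → ℝ≥0∞} (hf : AEMeasurable f μ) : (∫⁻ x, f x ∂μ) ^ q ≤ ∫⁻ x, f x ^ q ∂μ := by
  have h := ENNReal.lintegral_mul_le_Lp_mul_Lq μ (Real.HolderConjugate.conjExponent hq) hf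
    (g := fun _ => 1) aemeasurable_const
  simp only [Pi.mul_apply, mul_one, ENNReal.one_rpow, lintegral_const, measure_univ] at h
  calc (∫⁻ x, f x ∂μ) ^ q ≤ ((∫⁻ x, f x ^ q ∂μ) ^ (1 / q)) ^ q := by gcongr
    _ = _ := by rw [← ENNReal.rpow_mul, one_div_mul_cancel (by linarith), ENNReal.rpow_one]

/-- The difference of two means is the mean of f(x) - g(y) over the product probability measure, to
which Jensen's inequality applies. -/
lemma enorm_integral_sub_integral_rpow_le {G : Type*} [NormedAddCommGroup G] [NormedSpace ℝ G]
    [CompleteSpace G] {μ : Measure α} {ν : Measure β} [IsProbabilityMeasure μ]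
    [IsProbabilityMeasure ν] {q : ℝ} (hq : 1 < q) {f : α → G} {g : β → G}
    (hf : Integrable f μ) (hg : Integrable g ν) :
    ‖∫ x, f x ∂μ - ∫ y, g y ∂ν‖ₑ ^ q ≤ ∫⁻ x, ∫⁻ y, ‖f x - g y‖ₑ ^ q ∂ν ∂μ := by
  have hfg : AEStronglyMeasurable (fun z : α × β => f z.1 - g z.2) (μ.prod ν) :=
    hf.1.comp_fst.sub hg.1.comp_snd
  have e : ∫ x, f x ∂μ - ∫ y, g y ∂ν = ∫ z, (f z.1 - g z.2) ∂(μ.prod ν) := by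
    rw [integral_sub (hf.comp_fst ν) (hg.comp_snd μ), integral_fun_fst, integral_fun_snd]
    simp
  rw [e, ← lintegral_prod (fun z : α × β => ‖f z.1 - g z.2‖ₑ ^ q) (by fun_prop)]
  calc ‖∫ z, (f z.1 - g z.2) ∂(μ.prod ν)‖ₑ ^ q
      ≤ (∫⁻ z, ‖f z.1 - g z.2‖ₑ ∂(μ.prod ν)) ^ q := by
        gcongr
        exact enorm_integral_le_lintegral_enorm _
    _ ≤ _ := rpow_lintegral_le hq (by fun_prop)

end Jensen

variable {n : ℕ}

instance : IsProbabilityMeasure (volume : Measure RModZ) := ⟨by simp⟩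

/-- The `q`-th power of the `L^q`-norm of `g(· + w) - g`. -/
def modulus (q : ℝ) (g : RModZ → E n) (w : ℝ) : ℝ≥0∞ :=
  ∫⁻ u, ‖g (u + (w : RModZ)) - g u‖ₑ ^ q

/-- The `q`-th power of the Slobodeckij seminorm. -/
def slobodeckij (s q : ℝ) (g : RModZ → E n) : ℝ≥0∞ :=
  ∫⁻ w in Ioo (-1 / 2 : ℝ) (1 / 2), ENNReal.ofReal (|w| ^ (-(1 + q * s))) * modulus q g w

lemma slobodeckij_eq {s q : ℝ} (hq : 1 < q) {g : RModZ → E n} (hg : StronglyMeasurable g) :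
    slobodeckij s q g = eLpNorm (diffQuot s q g) (ENNReal.ofReal q) slobodeckijMeasure ^ q := by
  have hq0 : q ≠ 0 := by linarith
  have hm : Measurable g := hg.measurable
  rw [eLpNorm_eq_lintegral_rpow_enorm_toReal (by simp; linarith) (by simp),
    ENNReal.toReal_ofReal (by linarith), ← ENNReal.rpow_mul, one_div_mul_cancel hq0,
    ENNReal.rpow_one, slobodeckijMeasure, lintegral_prod _ (by unfold diffQuot; fun_prop),
    slobodeckij]
  refine lintegral_congr fun w => ?_
  rw [modulus, ← lintegral_const_mul _ (by fun_prop)]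
  refine lintegral_congr fun u => ?_
  rw [diffQuot, enorm_smul, ENNReal.mul_rpow_of_nonneg _ _ (by linarith)]
  congr 1
  rw [Real.enorm_eq_ofReal (by positivity), ENNReal.ofReal_rpow_of_nonneg (by positivity)
    (by linarith), ← Real.rpow_mul (abs_nonneg _)]
  congr 2
  field_simp

lemma modulus_zero {q : ℝ} (hq : 1 < q) (g : RModZ → E n) : modulus q g 0 = 0 := by
  simp only [modulus, AddCircle.coe_zero, add_zero, sub_self, enorm_zero]
  rw [ENNReal.zero_rpow_of_pos (by linarith)]
  simp

lemma measurable_modulus {q : ℝ} {g : RModZ → E n} (hg : Measurable g) :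
    Measurable (modulus q g) := by
  unfold modulus
  refine Measurable.lintegral_prod_right' (f := fun z : ℝ × RModZ =>
    ‖g (z.2 + (z.1 : RModZ)) - g z.2‖ₑ ^ q) ?_
  fun_prop

/-- For 0 < |w| < δ the weight of the seminorm is at least δ^(-(1+qs)). -/
lemma lintegral_modulus_le {s q : ℝ} (hq : 1 < q) (hs : 0 < s) (g : RModZ → E n) {δ : ℝ}
    (hδ : 0 < δ) (hδ' : δ ≤ 1 / 2) :
    ∫⁻ w in Ioo (-δ) δ, modulus q g w ≤ ENNReal.ofReal (δ ^ (1 + q * s)) * slobodeckij s q g := by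
  have h1 : ∀ w ∈ Ioo (-δ) δ, modulus q g w ≤ ENNReal.ofReal (δ ^ (1 + q * s)) *
      (ENNReal.ofReal (|w| ^ (-(1 + q * s))) * modulus q g w) := by
    intro w hw
    -- At w = 0 the real power of the weight is 0 by convention, so there the vanishing of the
    -- modulus is needed.
    rcases eq_or_ne w 0 with rfl | h0
    · rw [modulus_zero hq]; simp
    · have hw0 : 0 < |w| := abs_pos.2 h0
      have hwδ : |w| ≤ δ := (abs_lt.2 hw).le
      rw [← mul_assoc, ← ENNReal.ofReal_mul (by positivity)]
      refine le_mul_of_one_le_left (by simp) ?_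
      rw [ENNReal.one_le_ofReal, Real.rpow_neg hw0.le, ← div_eq_mul_inv,
        one_le_div (by positivity)]
      have : 0 < q * s := by positivity
      gcongr
  calc ∫⁻ w in Ioo (-δ) δ, modulus q g w
      ≤ ∫⁻ w in Ioo (-δ) δ, ENNReal.ofReal (δ ^ (1 + q * s)) *
          (ENNReal.ofReal (|w| ^ (-(1 + q * s))) * modulus q g w) :=
        setLIntegral_mono' measurableSet_Ioo h1
    _ = ENNReal.ofReal (δ ^ (1 + q * s)) * ∫⁻ w in Ioo (-δ) δ,
          (ENNReal.ofReal (|w| ^ (-(1 + q * s))) * modulus q g w) :=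
        lintegral_const_mul' _ _ (by simp)
    _ ≤ _ := by
        gcongr
        unfold slobodeckij
        refine lintegral_mono_set (Ioo_subset_Ioo (by linarith) (by linarith))

lemma setLIntegral_comp_coe_le (f : RModZ → ℝ≥0∞) (u : RModZ) {s : Set ℝ} (hs : s ⊆ Ioc 0 1) :
    ∫⁻ t in s, f (u + (t : RModZ)) ≤ ∫⁻ x, f x := by
  calc ∫⁻ t in s, f (u + (t : RModZ)) ≤ ∫⁻ t in Ioc (0 : ℝ) (0 + 1), f (u + (t : RModZ)) :=
        lintegral_mono_set (by simpa using hs)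
    _ = ∫⁻ x, f x := by
        rw [UnitAddCircle.lintegral_preimage 0 (fun x => f (u + x)), lintegral_add_left_eq_self]

/-- The mean of `g` over the interval from `u` to `u + δ`. -/
def forwardMean (g : RModZ → E n) (δ : ℝ) (u : RModZ) : E n :=
  δ⁻¹ • ∫ t in (0 : ℝ)..δ, g (u + (t : RModZ))

lemma locallyIntegrable_comp_coe {g : RModZ → E n} (hg : Integrable g) (a b : ℝ) :
    IntervalIntegrable (fun t : ℝ => g (t : RModZ)) volume a b := by
  have hper : Function.Periodic (fun t : ℝ => g (t : RModZ)) 1 := fun t => by simp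
  refine hper.intervalIntegrable₀ one_ne_zero ?_ a b
  have h := ((UnitAddCircle.measurePreserving_mk 0).integrable_comp hg.1).2 hg
  rw [zero_add] at h
  rw [intervalIntegrable_iff_integrableOn_Ioc_of_le zero_le_one]
  exact h

lemma forwardMean_coe (g : RModZ → E n) (δ x : ℝ) :
    forwardMean g δ (x : RModZ) = δ⁻¹ • ∫ t in x..x + δ, g (t : RModZ) := by
  have := intervalIntegral.integral_comp_add_left (a := 0) (b := δ)
    (fun t : ℝ => g (t : RModZ)) x
  rw [add_zero] at this
  rw [forwardMean, ← this]
  simp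

lemma continuous_of_comp_coe {G : Type*} [TopologicalSpace G] {φ : RModZ → G}
    (h : Continuous fun t : ℝ => φ (t : RModZ)) : Continuous φ :=
  (QuotientAddGroup.isQuotientMap_mk (N := AddSubgroup.zmultiples (1 : ℝ))).continuous_iff.2 h

lemma continuous_forwardMean {g : RModZ → E n} (hg : Integrable g) (δ : ℝ) :
    Continuous (forwardMean g δ) := by
  refine continuous_of_comp_coe ?_
  have hi := locallyIntegrable_comp_coe hg
  have hc := intervalIntegral.continuous_primitive hi 0
  have e : (fun x : ℝ => forwardMean g δ (x : RModZ)) = fun x : ℝ =>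
      δ⁻¹ • ((∫ t in (0 : ℝ)..x + δ, g (t : RModZ)) - ∫ t in (0 : ℝ)..x, g (t : RModZ)) := by
    ext1 x
    rw [forwardMean_coe, intervalIntegral.integral_interval_sub_left (hi _ _) (hi _ _)]
  rw [e]
  exact ((hc.comp (continuous_id.add continuous_const)).sub hc).const_smul δ⁻¹

lemma norm_forwardMean_le {g : RModZ → E n} (hg : Integrable g) {δ : ℝ} (hδ : 0 < δ) (hδ' : δ ≤ 1)
    (u : RModZ) : ‖forwardMean g δ u‖ ≤ δ⁻¹ * ∫ x, ‖g x‖ := by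
  rw [forwardMean, norm_smul, Real.norm_of_nonneg (by positivity)]
  gcongr
  rw [intervalIntegral.integral_of_le hδ.le]
  refine (norm_integral_le_integral_norm _).trans ?_
  rw [integral_eq_lintegral_of_nonneg_ae (ae_of_all _ fun _ => norm_nonneg _),
    integral_eq_lintegral_of_nonneg_ae (ae_of_all _ fun _ => norm_nonneg _) hg.1.norm]
  · refine ENNReal.toReal_mono hg.norm.lintegral_lt_top.ne ?_
    exact setLIntegral_comp_coe_le (fun x => ENNReal.ofReal ‖g x‖) u
      (Ioc_subset_Ioc_right hδ')
  · have h := (measurePreserving_add_left volume u).comp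
      (UnitAddCircle.measurePreserving_mk 0)
    have := hg.1.norm.comp_measurePreserving h
    refine this.mono_measure (Measure.restrict_mono ?_ le_rfl)
    simpa using Ioc_subset_Ioc_right hδ'

/-- Substitute x = y + w and integrate over y first. The range of y is then enlarged to a full
period, which removes the dependence on the base point u. -/
lemma lintegral_lintegral_sub_le {q : ℝ} {g : RModZ → E n} (hg : Measurable g) (u : RModZ) {δ : ℝ}
    (hδ : 0 < δ) (hδ' : δ ≤ 1 / 2) :
    ∫⁻ x in Ioc 0 δ, ∫⁻ y in Ioc 0 (δ / 2), ‖g (u + (x : RModZ)) - g (u + (y : RModZ))‖ₑ ^ q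
      ≤ ∫⁻ w in Ioo (-δ) δ, modulus q g w := by
  have hinner : ∀ y ∈ Ioc 0 (δ / 2),
      ∫⁻ x in Ioc 0 δ, ‖g (u + (x : RModZ)) - g (u + (y : RModZ))‖ₑ ^ q
        ≤ ∫⁻ w in Ioo (-δ) δ, ‖g ((u + (y : RModZ)) + (w : RModZ)) - g (u + (y : RModZ))‖ₑ ^ q := by
    intro y hy
    rw [← lintegral_indicator measurableSet_Ioc, ← lintegral_indicator measurableSet_Ioo,
      ← lintegral_add_left_eq_self _ y]
    refine lintegral_mono fun w => ?_
    by_cases hw : y + w ∈ Ioc 0 δ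
    · have hw' : w ∈ Ioo (-δ) δ := ⟨by linarith [hw.1, hy.2], by linarith [hw.2, hy.1]⟩
      rw [indicator_of_mem hw, indicator_of_mem hw', AddCircle.coe_add, add_assoc]
    · rw [indicator_of_notMem hw]; exact zero_le
  calc ∫⁻ x in Ioc 0 δ, ∫⁻ y in Ioc 0 (δ / 2),
        ‖g (u + (x : RModZ)) - g (u + (y : RModZ))‖ₑ ^ q
      = ∫⁻ y in Ioc 0 (δ / 2), ∫⁻ x in Ioc 0 δ,
        ‖g (u + (x : RModZ)) - g (u + (y : RModZ))‖ₑ ^ q :=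
        lintegral_lintegral_swap (by unfold Function.uncurry; fun_prop)
    _ ≤ ∫⁻ y in Ioc 0 (δ / 2), ∫⁻ w in Ioo (-δ) δ,
        ‖g ((u + (y : RModZ)) + (w : RModZ)) - g (u + (y : RModZ))‖ₑ ^ q :=
        setLIntegral_mono' measurableSet_Ioc hinner
    _ = ∫⁻ w in Ioo (-δ) δ, ∫⁻ y in Ioc 0 (δ / 2),
        ‖g ((u + (y : RModZ)) + (w : RModZ)) - g (u + (y : RModZ))‖ₑ ^ q :=
        lintegral_lintegral_swap (by unfold Function.uncurry; fun_prop)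
    _ ≤ _ := by
        refine lintegral_mono fun w => ?_
        exact setLIntegral_comp_coe_le (fun x => ‖g (x + (w : RModZ)) - g x‖ₑ ^ q) u
          (Ioc_subset_Ioc_right (by linarith))

lemma forwardMean_eq_integral (g : RModZ → E n) {δ : ℝ} (hδ : 0 < δ) (u : RModZ) :
    forwardMean g δ u
      = ∫ t, g (u + (t : RModZ)) ∂(ENNReal.ofReal δ⁻¹ • volume.restrict (Ioc 0 δ)) := by
  rw [integral_smul_measure, ENNReal.toReal_ofReal (by positivity), forwardMean,
    intervalIntegral.integral_of_le hδ.le]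

lemma isProbabilityMeasure_smul_restrict {δ : ℝ} (hδ : 0 < δ) :
    IsProbabilityMeasure (ENNReal.ofReal δ⁻¹ • (volume : Measure ℝ).restrict (Ioc 0 δ)) := by
  constructor
  simp only [Measure.smul_apply, Measure.restrict_apply_univ, Real.volume_Ioc, sub_zero,
    smul_eq_mul]
  rw [← ENNReal.ofReal_mul (by positivity), inv_mul_cancel₀ hδ.ne', ENNReal.ofReal_one]

lemma integrable_comp_add_coe {g : RModZ → E n} (hg : Integrable g) (u : RModZ) {δ : ℝ}
    (hδ' : δ ≤ 1) :
    IntegrableOn (fun t : ℝ => g (u + (t : RModZ))) (Ioc 0 δ) := by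
  have h := (measurePreserving_add_left volume u).comp (UnitAddCircle.measurePreserving_mk 0)
  have := (h.integrable_comp hg.1).2 hg
  refine this.mono_measure (Measure.restrict_mono ?_ le_rfl)
  simpa using Ioc_subset_Ioc_right hδ'

/-- Jensen for the two normalized interval measures produces the factor 2δ^(-2); the small-scale
bound of the modulus contributes δ^(1+qs). The remaining exponent qs - 1 is positive exactly when s
> 1/q. -/
lemma enorm_forwardMean_sub_le {s q : ℝ} (hq : 1 < q) (hs : 0 < s) {g : RModZ → E n}
    (hg : Measurable g) (hgi : Integrable g) (u : RModZ) {δ : ℝ} (hδ : 0 < δ) (hδ' : δ ≤ 1 / 2) :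
    ‖forwardMean g δ u - forwardMean g (δ / 2) u‖ₑ ^ q
      ≤ ENNReal.ofReal (2 * δ ^ (q * s - 1)) * slobodeckij s q g := by
  have hδ2 : 0 < δ / 2 := by positivity
  have := isProbabilityMeasure_smul_restrict hδ
  have := isProbabilityMeasure_smul_restrict hδ2
  rw [forwardMean_eq_integral g hδ, forwardMean_eq_integral g hδ2]
  refine (enorm_integral_sub_integral_rpow_le hq
    ((integrable_comp_add_coe hgi u (by linarith)).smul_measure (by simp))
    ((integrable_comp_add_coe hgi u (by linarith)).smul_measure (by simp))).trans ?_
  rw [lintegral_smul_measure]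
  simp only [lintegral_smul_measure, smul_eq_mul]
  rw [lintegral_const_mul' _ _ (by simp), ← mul_assoc]
  have h := (lintegral_lintegral_sub_le (q := q) hg u hδ hδ').trans
    (lintegral_modulus_le hq hs g hδ hδ')
  refine (mul_le_mul_right h _).trans_eq ?_
  rw [← mul_assoc, ← ENNReal.ofReal_mul (by positivity), ← ENNReal.ofReal_mul (by positivity)]
  congr 2
  have e : 1 + q * s = (q * s - 1) + 1 + 1 := by ring
  rw [e, Real.rpow_add_one hδ.ne', Real.rpow_add_one hδ.ne']
  field_simp

lemma ae_of_ae_coe {P : RModZ → Prop} (hP : MeasurableSet {u | P u})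
    (h : ∀ᵐ x : ℝ, P (x : RModZ)) : ∀ᵐ u, P u := by
  rw [← (UnitAddCircle.measurePreserving_mk 0).map_eq]
  exact (ae_map_iff (UnitAddCircle.measurePreserving_mk 0).measurable.aemeasurable hP).2
    (ae_restrict_of_ae h)

/-- Lebesgue's differentiation theorem for the periodic lift of g. -/
lemma ae_tendsto_forwardMean {g : RModZ → E n} (hg : Integrable g) :
    ∀ᵐ x : ℝ, Tendsto (fun k : ℕ => forwardMean g ((1 / 2) ^ (k + 1)) (x : RModZ)) atTop
      (𝓝 (g (x : RModZ))) := by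
  have hi := locallyIntegrable_comp_coe hg
  have hloc : LocallyIntegrable (fun t : ℝ => g (t : RModZ)) := by
    rw [locallyIntegrable_iff]
    intro k hk
    obtain ⟨R, hR⟩ := hk.isBounded.subset_closedBall 0
    rw [Real.closedBall_eq_Icc] at hR
    exact ((intervalIntegrable_iff_integrableOn_Icc_of_le (a := 0 - |R|) (b := 0 + |R|)
      (by linarith [abs_nonneg R]) (by simp)).1 (hi _ _)).mono_set
      (hR.trans (Icc_subset_Icc (by linarith [le_abs_self R]) (by linarith [le_abs_self R])))
  filter_upwards [LocallyIntegrable.ae_hasDerivAt_integral hloc] with x hx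
  have h := (hx 0).tendsto_slope_zero_right
  have hlim : Tendsto (fun k : ℕ => ((1 / 2 : ℝ)) ^ (k + 1)) atTop (𝓝[>] 0) := by
    refine tendsto_nhdsWithin_iff.2 ⟨?_, Eventually.of_forall fun k => by
      simp only [mem_Ioi]; positivity⟩
    exact (tendsto_pow_atTop_nhds_zero_of_lt_one (by norm_num) (by norm_num)).comp
      (tendsto_add_atTop_nat 1)
  refine (h.comp hlim).congr fun k => ?_
  rw [forwardMean_coe, Function.comp_apply,
    intervalIntegral.integral_interval_sub_left (hi _ _) (hi _ _)]

/-- The Morrey embedding: a function in `L^q` with finite Slobodeckij seminorm of order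
`s > 1/q` has a continuous representative. -/
theorem exists_continuous_representative {s q : ℝ} (hq : 1 < q) (hs : 1 / q < s) : ∃ K, 0 ≤ K ∧
    ∀ g : RModZ → E n, StronglyMeasurable g → MemLp g (ENNReal.ofReal q) →
      MemLp (diffQuot s q g) (ENNReal.ofReal q) slobodeckijMeasure →
      ∃ A : C(RModZ, E n), ⇑A =ᵐ[volume] g ∧
        ‖A‖ ≤ K * ((eLpNorm g (ENNReal.ofReal q) volume).toReal
          + (eLpNorm (diffQuot s q g) (ENNReal.ofReal q) slobodeckijMeasure).toReal) := by
  have hq0 : 0 < q := by linarith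
  have hs0 : 0 < s := lt_trans (by positivity) hs
  set σ := s - 1 / q with hσ
  have hσ0 : 0 < σ := by linarith
  set r := (1 / 2 : ℝ) ^ σ with hr
  have hr0 : 0 < r := by positivity
  have hr1 : r < 1 := Real.rpow_lt_one (by norm_num) (by norm_num) hσ0
  -- The 2 bounds the first mean, taken over an interval of length 1/2. The other summand comes from
  -- the geometric series of the differences of successive means.
  refine ⟨2 + 2 ^ (1 / q) * r / (1 - r), add_nonneg zero_le_two
    (div_nonneg (by positivity) (by linarith)), fun g hgm hgq hS => ?_⟩
  set N := (eLpNorm (diffQuot s q g) (ENNReal.ofReal q) slobodeckijMeasure).toReal with hN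
  have hgi : Integrable g := hgq.integrable (by simpa using hq.le)
  set A : ℕ → C(RModZ, E n) := fun k =>
    ⟨forwardMean g ((1 / 2) ^ (k + 1)), continuous_forwardMean hgi _⟩ with hA
  -- The q-th root of the dyadic estimate: since δ^(s-1/q) = r^(k+1) for δ = 2^(-(k+1)), the means
  -- converge uniformly and their limit is continuous.
  have hstep : ∀ k, dist (A k) (A (k + 1)) ≤ (2 ^ (1 / q) * N * r) * r ^ k := by
    intro k
    rw [ContinuousMap.dist_le (by positivity)]
    intro u
    set δ := (1 / 2 : ℝ) ^ (k + 1) with hδ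
    have hδ0 : 0 < δ := by positivity
    have hδ1 : δ ≤ 1 / 2 := by
      rw [hδ, pow_succ]
      exact mul_le_of_le_one_left (by norm_num) (pow_le_one₀ (by norm_num) (by norm_num))
    have h := enorm_forwardMean_sub_le hq hs0 hgm.measurable hgi u hδ0 hδ1
    rw [slobodeckij_eq hq hgm, ← ENNReal.ofReal_toReal hS.2.ne, ← ofReal_norm,
      ENNReal.ofReal_rpow_of_nonneg (by positivity) hq0.le,
      ENNReal.ofReal_rpow_of_nonneg (by positivity) hq0.le, ← ENNReal.ofReal_mul (by positivity),
      ENNReal.ofReal_le_ofReal_iff (by positivity)] at h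
    have e : δ / 2 = (1 / 2 : ℝ) ^ (k + 1 + 1) := by rw [hδ, pow_succ _ (k + 1)]; ring
    have hd : dist (A k u) (A (k + 1) u) = ‖forwardMean g δ u - forwardMean g (δ / 2) u‖ := by
      rw [dist_eq_norm, e]; rfl
    rw [hd]
    have hx : 2 * δ ^ (q * s - 1) * N ^ q = (2 ^ (1 / q) * N * r * r ^ k) ^ q := by
      have e1 : 2 ^ (1 / q) * N * r * r ^ k = 2 ^ (1 / q) * N * r ^ (k + 1) := by
        rw [pow_succ]; ring
      have e2 : r ^ (k + 1) = δ ^ σ := by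
        rw [hr, hδ, ← Real.rpow_natCast, ← Real.rpow_natCast, ← Real.rpow_mul (by norm_num),
          ← Real.rpow_mul (by norm_num), mul_comm]
      rw [e1, e2, Real.mul_rpow (by positivity) (by positivity),
        Real.mul_rpow (by positivity) (by positivity), ← Real.rpow_mul (by norm_num),
        one_div_mul_cancel hq0.ne', Real.rpow_one, ← Real.rpow_mul hδ0.le]
      have : σ * q = q * s - 1 := by rw [hσ]; field_simp
      rw [this]; ring
    rw [← hN, hx] at h
    exact (Real.rpow_le_rpow_iff (norm_nonneg _) (by positivity) hq0).1 h
  obtain ⟨B, hB⟩ := cauchySeq_tendsto_of_complete (cauchySeq_of_le_geometric r _ hr1 hstep)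
  refine ⟨B, ?_, ?_⟩
  · refine ae_of_ae_coe (measurableSet_eq_fun B.continuous.measurable hgm.measurable) ?_
    filter_upwards [ae_tendsto_forwardMean hgi] with x hx
    have h1 : Tendsto (fun k => A k (x : RModZ)) atTop (𝓝 (B (x : RModZ))) :=
      (ContinuousMap.tendsto_iff_tendstoUniformly.1 hB).tendsto_at _
    exact tendsto_nhds_unique h1 hx
  · have h0 : ‖A 0‖ ≤ 2 * (eLpNorm g (ENNReal.ofReal q) volume).toReal := by
      rw [ContinuousMap.norm_le _ (by positivity)]
      intro u
      have h1 : ‖A 0 u‖ ≤ ((1 / 2 : ℝ) ^ (0 + 1))⁻¹ * ∫ x, ‖g x‖ :=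
        norm_forwardMean_le hgi (by positivity) (by norm_num) u
      have h2 : ∫ x, ‖g x‖ ≤ (eLpNorm g (ENNReal.ofReal q) volume).toReal := by
        rw [integral_norm_eq_lintegral_enorm hgi.1, ← eLpNorm_one_eq_lintegral_enorm]
        exact ENNReal.toReal_mono hgq.2.ne
          (eLpNorm_le_eLpNorm_of_exponent_le (by simpa using hq.le) hgi.1)
      refine h1.trans ?_
      norm_num
      exact h2
    have h1 := dist_le_of_le_geometric_of_tendsto₀ r _ hr1 hstep hB
    rw [dist_eq_norm] at h1
    have h2 : ‖B‖ ≤ ‖A 0‖ + ‖A 0 - B‖ := by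
      have := norm_sub_le (A 0) (A 0 - B)
      rwa [sub_sub_cancel] at this
    have h3 : 2 ^ (1 / q) * N * r / (1 - r) = 2 ^ (1 / q) * r / (1 - r) * N := by ring
    have h4 : 0 ≤ 2 ^ (1 / q) * r / (1 - r) *
        (eLpNorm g (ENNReal.ofReal q) volume).toReal :=
      mul_nonneg (div_nonneg (by positivity) (by linarith)) ENNReal.toReal_nonneg
    have h5 : 0 ≤ N := ENNReal.toReal_nonneg
    rw [h3] at h1
    nlinarith

/-! ### The continuous derivative of a Sobolev curve -/

section DuBoisReymond

lemma hasDerivAt_fourier_coe (k : ℤ) (t : ℝ) :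
    HasDerivAt (fun t : ℝ => (fourier k (t : RModZ) : ℂ))
      ((2 * Real.pi * k : ℝ) * Complex.I * fourier k (t : RModZ)) t := by
  have h := hasDerivAt_fourier 1 k t
  convert h using 1
  push_cast
  simp
  ring

lemma contDiff_fourier_coe (k : ℤ) : ContDiff ℝ ∞ (fun t : ℝ => (fourier k (t : RModZ) : ℂ)) := by
  have : (fun t : ℝ => (fourier k (t : RModZ) : ℂ)) = fun t : ℝ =>
      Complex.exp (2 * Real.pi * Complex.I * k * t / (1 : ℝ)) := funext fun t => fourier_coe_apply
  rw [this]
  have h : ContDiff ℝ ∞ (fun t : ℝ => (t : ℂ)) := Complex.ofRealCLM.contDiff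
  fun_prop

/-- The lemma of du Bois-Reymond on `ℝ/ℤ`. -/
lemma exists_eq_const_of_forall_integral_eq_zero {d : RModZ → ℝ} (hd : Continuous d)
    (h : ∀ φ φ' : RModZ → ℝ, ContDiff ℝ ∞ (fun t : ℝ => φ (t : RModZ)) →
      (∀ t : ℝ, HasDerivAt (fun t : ℝ => φ (t : RModZ)) (φ' (t : RModZ)) t) →
      ∫ x, φ' x * d x = 0) : ∃ c, ∀ x, d x = c := by
  have hint : ∀ k : ℤ, Integrable fun x => fourier k x * (d x : ℂ) := fun k =>
    Continuous.integrable_of_hasCompactSupport (by fun_prop) (HasCompactSupport.of_compactSpace _)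
  -- The test function is the imaginary part of the Fourier mode, whose derivative is 2πk times the
  -- real part. With the companion identity below, all nonconstant Fourier coefficients of d vanish.
  have hre : ∀ k : ℤ, k ≠ 0 → ∫ x, (fourier k x).re * d x = 0 := by
    intro k hk
    have hk' : (2 * Real.pi * k : ℝ) ≠ 0 := by
      have := Real.pi_ne_zero; positivity
    have h1 := h (fun x => (fourier k x).im) (fun x => (2 * Real.pi * k) * (fourier k x).re)
      (Complex.imCLM.contDiff.comp (contDiff_fourier_coe k)) fun t => by
        have := (Complex.imCLM.hasFDerivAt.comp_hasDerivAt t (hasDerivAt_fourier_coe k t))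
        have e : Complex.imCLM ((2 * Real.pi * k : ℝ) * Complex.I * fourier k (t : RModZ))
            = (2 * Real.pi * k) * (fourier k (t : RModZ)).re := by
          rw [Complex.imCLM_apply, mul_assoc, Complex.im_ofReal_mul, Complex.I_mul_im]
        rw [e] at this
        exact this
    have h2 : ∫ x, (2 * Real.pi * k) * ((fourier k x).re * d x) = 0 := by
      simpa only [mul_assoc] using h1
    rw [integral_const_mul] at h2
    exact (mul_eq_zero.1 h2).resolve_left hk'
  have him : ∀ k : ℤ, k ≠ 0 → ∫ x, (fourier k x).im * d x = 0 := by
    intro k hk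
    have hk' : -(2 * Real.pi * k : ℝ) ≠ 0 := by
      have := Real.pi_ne_zero
      exact neg_ne_zero.2 (by positivity)
    have h1 := h (fun x => (fourier k x).re) (fun x => -(2 * Real.pi * k) * (fourier k x).im)
      (Complex.reCLM.contDiff.comp (contDiff_fourier_coe k)) fun t => by
        have := (Complex.reCLM.hasFDerivAt.comp_hasDerivAt t (hasDerivAt_fourier_coe k t))
        have e : Complex.reCLM ((2 * Real.pi * k : ℝ) * Complex.I * fourier k (t : RModZ))
            = -(2 * Real.pi * k) * (fourier k (t : RModZ)).im := by
          rw [Complex.reCLM_apply, mul_assoc, Complex.re_ofReal_mul, Complex.I_mul_re]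
          ring
        rw [e] at this
        exact this
    have h2 : ∫ x, -(2 * Real.pi * k) * ((fourier k x).im * d x) = 0 := by
      simpa only [neg_mul, mul_assoc] using h1
    rw [integral_const_mul] at h2
    exact (mul_eq_zero.1 h2).resolve_left hk'
  have hco : ∀ k : ℤ, k ≠ 0 → ∫ x, fourier k x * (d x : ℂ) = 0 := by
    intro k hk
    apply Complex.ext
    · have := Complex.reCLM.integral_comp_comm (hint k)
      simp only [Complex.reCLM_apply, Complex.re_mul_ofReal] at this
      rw [← this, hre k hk, Complex.zero_re]
    · have := Complex.imCLM.integral_comp_comm (hint k)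
      simp only [Complex.imCLM_apply, Complex.im_mul_ofReal] at this
      rw [← this, him k hk, Complex.zero_im]
  have hhaar : (volume : Measure RModZ) = AddCircle.haarAddCircle := by
    rw [AddCircle.volume_eq_smul_haarAddCircle]; simp
  let D : C(RModZ, ℂ) := ⟨fun x => (d x : ℂ), by fun_prop⟩
  have hzero : ∀ k : ℤ, k ≠ 0 → fourierCoeff D k = 0 := by
    intro k hk
    rw [fourierCoeff, ← hhaar]
    exact hco (-k) (neg_ne_zero.2 hk)
  -- Summability makes the Fourier series converge uniformly to the continuous function D, so D
  -- equals its single remaining term.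
  have hsum : Summable (fourierCoeff D) :=
    summable_of_ne_finset_zero (s := {0}) fun k hk => hzero k (by simpa using hk)
  have h1 := hasSum_fourier_series_of_summable hsum
  have h2 : HasSum (fun i => fourierCoeff D i • (fourier i : C(RModZ, ℂ)))
      (fourierCoeff D 0 • (fourier 0 : C(RModZ, ℂ))) :=
    hasSum_single 0 fun k hk => by ext x; simp [hzero k hk]
  have h3 := h1.unique h2
  refine ⟨(fourierCoeff D 0).re, fun x => ?_⟩
  have h4 := congrArg (fun f : C(RModZ, ℂ) => (f x).re) h3
  simpa [D] using h4

variable {n : ℕ}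

/-- Compare f with a primitive of g. Testing with the constant 1 shows that g has mean zero, so the
primitive is periodic. Integration by parts shows that each coordinate of the difference satisfies
the hypothesis of the du Bois-Reymond lemma. -/
lemma hasDerivAt_of_isWeakDeriv {f g : RModZ → E n} (hf : Continuous f) (hg : Continuous g)
    (h : IsWeakDeriv f g) (t : ℝ) :
    HasDerivAt (fun t : ℝ => f (t : RModZ)) (g (t : RModZ)) t := by
  have hgc : Continuous fun t : ℝ => g (t : RModZ) := by fun_prop
  set P : ℝ → E n := fun t => ∫ τ in (0 : ℝ)..t, g (τ : RModZ) with hP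
  have hPd : ∀ t : ℝ, HasDerivAt P (g (t : RModZ)) t := fun t =>
    intervalIntegral.integral_hasDerivAt_right (hgc.intervalIntegrable _ _)
      (hgc.stronglyMeasurableAtFilter _ _) hgc.continuousAt
  have hPc : Continuous P := continuous_iff_continuousAt.2 fun t => (hPd t).continuousAt
  have hg0 : ∫ x, g x = 0 := by
    have := h (fun _ => 1) (fun _ => 0) contDiff_const (fun t => hasDerivAt_const t _)
    simpa using this.symm
  have hper : Function.Periodic P 1 := by
    intro t
    have h1 := UnitAddCircle.intervalIntegral_preimage t g
    rw [hg0] at h1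
    have h2 := intervalIntegral.integral_interval_sub_left (hgc.intervalIntegrable (μ := volume) 0 (t + 1))
      (hgc.intervalIntegrable 0 t)
    rw [h1] at h2
    exact sub_eq_zero.1 h2
  set Q : RModZ → E n := hper.lift with hQ
  have hQP : ∀ t : ℝ, Q (t : RModZ) = P t := fun t => hper.lift_coe t
  have hQc : Continuous Q := continuous_of_comp_coe (by simp only [hQP]; exact hPc)
  have hconst : ∀ i, ∃ c, ∀ x, (f x - Q x) i = c := by
    intro i
    refine exists_eq_const_of_forall_integral_eq_zero (by fun_prop) fun φ φ' hφ hd => ?_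
    have hφc : Continuous φ := continuous_of_lift hφ.continuous
    have hφd : Continuous fun t : ℝ => φ' (t : RModZ) := by
      have : (fun t : ℝ => φ' (t : RModZ)) = _root_.deriv (fun t : ℝ => φ (t : RModZ)) :=
        funext fun t => (hd t).deriv.symm
      rw [this]
      exact hφ.continuous_deriv (by simp)
    have hφ'c : Continuous φ' := continuous_of_lift hφd
    have hint : ∀ {k : RModZ → E n}, Continuous k → Integrable k := fun hk =>
      hk.integrable_of_hasCompactSupport (HasCompactSupport.of_compactSpace _)
    have hQi : ∫ x, φ' x • Q x = - ∫ x, φ x • g x := by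
      rw [← UnitAddCircle.intervalIntegral_preimage 0, ← UnitAddCircle.intervalIntegral_preimage 0]
      have hmul : ∀ t : ℝ, HasDerivAt (fun t : ℝ => φ (t : RModZ) • P t)
          (φ (t : RModZ) • g (t : RModZ) + φ' (t : RModZ) • P t) t := fun t => (hd t).smul (hPd t)
      have h1 := intervalIntegral.integral_eq_sub_of_hasDerivAt (a := 0) (b := 0 + 1)
        (fun t _ => hmul t) (Continuous.intervalIntegrable (by fun_prop) _ _)
      rw [intervalIntegral.integral_add (Continuous.intervalIntegrable (by fun_prop) _ _)
        (Continuous.intervalIntegrable (by fun_prop) _ _)] at h1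
      have h2 : φ (((0 : ℝ) + 1 : ℝ) : RModZ) = φ ((0 : ℝ) : RModZ) := by
        rw [AddCircle.coe_add, AddCircle.coe_period, add_zero]
      rw [hper 0, h2, sub_self] at h1
      simp only [hQP]
      exact eq_neg_of_add_eq_zero_right h1
    have hw := h φ φ' hφ hd
    have hdiff : ∫ x, φ' x • (f x - Q x) = 0 := by
      simp only [smul_sub]
      rw [integral_sub (hint (by fun_prop)) (hint (by fun_prop)), hw, hQi, sub_self]
    have := (EuclideanSpace.proj i : E n →L[ℝ] ℝ).integral_comp_comm
      (hint (k := fun x => φ' x • (f x - Q x)) (by fun_prop))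
    rw [hdiff] at this
    simpa using this
  choose c hc using hconst
  have hfP : (fun t : ℝ => f (t : RModZ)) = fun t => P t + WithLp.toLp 2 c := by
    ext1 t
    ext i
    have := hc i (t : RModZ)
    rw [hQP] at this
    simp only [PiLp.sub_apply] at this
    simp only [PiLp.add_apply]
    linarith
  rw [hfP]
  exact (hPd t).add_const _

end DuBoisReymond

/-! ### Sobolev curves as C¹ curves -/

section ContDeriv

variable {n : ℕ} {s q : ℝ} [hq : Fact (1 < q)]

open Classical in
/-- The continuous representative of the derivative of a Sobolev curve. -/
def contDeriv (γ : Sobolev n s q) : C(RModZ, E n) :=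
  if h : ∃ A : C(RModZ, E n), ⇑A =ᵐ[volume] ⇑γ.deriv then h.choose else 0

lemma contDeriv_ae (hs : 1 / q < s) (γ : Sobolev n s q) :
    ⇑(contDeriv γ) =ᵐ[volume] ⇑γ.deriv := by
  obtain ⟨K, -, hK⟩ := exists_continuous_representative (n := n) hq.out hs
  have h : ∃ A : C(RModZ, E n), ⇑A =ᵐ[volume] ⇑γ.deriv := by
    obtain ⟨A, hA, -⟩ := hK γ.deriv (Lp.stronglyMeasurable _) (Lp.memLp _) γ.memLp_diffQuot
    exact ⟨A, hA⟩
  rw [contDeriv, dif_pos h]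
  exact h.choose_spec

/-- Continuous functions that agree almost everywhere are equal. This makes the chosen
representative linear in the curve. -/
lemma eq_contDeriv (hs : 1 / q < s) {γ : Sobolev n s q} {A : C(RModZ, E n)}
    (hA : ⇑A =ᵐ[volume] ⇑γ.deriv) : A = contDeriv γ :=
  DFunLike.coe_injective ((A.continuous.ae_eq_iff_eq volume (contDeriv γ).continuous).1
    (hA.trans (contDeriv_ae hs γ).symm))

lemma contDeriv_add (hs : 1 / q < s) (γ η : Sobolev n s q) :
    contDeriv (γ + η) = contDeriv γ + contDeriv η := by
  refine (eq_contDeriv hs ?_).symm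
  rw [Sobolev.deriv_add]
  filter_upwards [Lp.coeFn_add γ.deriv η.deriv, contDeriv_ae hs γ, contDeriv_ae hs η]
    with x h1 h2 h3
  rw [ContinuousMap.add_apply, h2, h3]
  exact h1.symm

lemma contDeriv_smul (hs : 1 / q < s) (c : ℝ) (γ : Sobolev n s q) :
    contDeriv (c • γ) = c • contDeriv γ := by
  refine (eq_contDeriv hs ?_).symm
  rw [Sobolev.deriv_smul]
  filter_upwards [Lp.coeFn_smul c γ.deriv, contDeriv_ae hs γ] with x h1 h2
  rw [ContinuousMap.smul_apply, h2]
  exact h1.symm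

/-- The embedding of W into C¹ in quantitative form. The stability of regular embedded curves and
the boundedness of speeds and secants rest on it. -/
lemma exists_norm_contDeriv_le (n : ℕ) (hs : 1 / q < s) :
    ∃ K, 0 ≤ K ∧ ∀ γ : Sobolev n s q, ‖contDeriv γ‖ ≤ K * ‖γ‖ := by
  obtain ⟨K, hK0, hK⟩ := exists_continuous_representative (n := n) hq.out hs
  refine ⟨K, hK0, fun γ => ?_⟩
  obtain ⟨A, hA, hA'⟩ := hK γ.deriv (Lp.stronglyMeasurable _) (Lp.memLp _) γ.memLp_diffQuot
  rw [← eq_contDeriv hs hA]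
  refine hA'.trans ?_
  gcongr
  rw [Sobolev.norm_def]
  have : 0 ≤ (eLpNorm ⇑γ (ENNReal.ofReal q) volume).toReal := ENNReal.toReal_nonneg
  linarith

lemma hasDerivAt_coe (hs : 1 / q < s) (γ : Sobolev n s q) (t : ℝ) :
    HasDerivAt (fun t : ℝ => γ (t : RModZ)) (contDeriv γ (t : RModZ)) t := by
  refine hasDerivAt_of_isWeakDeriv γ.continuous (contDeriv γ).continuous ?_ t
  intro φ φ' hφ hd
  rw [γ.2.1 φ φ' hφ hd]
  congr 1
  refine integral_congr_ae ?_
  filter_upwards [contDeriv_ae hs γ] with x hx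
  rw [hx]; rfl

lemma hasDerivAt_add_coe (hs : 1 / q < s) (γ : Sobolev n s q) (u : RModZ) (t : ℝ) :
    HasDerivAt (fun t : ℝ => γ (u + (t : RModZ))) (contDeriv γ (u + (t : RModZ))) t := by
  obtain ⟨u, rfl⟩ := QuotientAddGroup.mk_surjective u
  have h := (hasDerivAt_coe hs γ (u + t)).scomp_of_eq t ((hasDerivAt_id t).const_add u) rfl
  rw [one_smul, AddCircle.coe_add] at h
  exact h

/-- The mean of the derivative of a curve over the segment from `u` to `u + v`. -/
def meanDeriv (γ : Sobolev n s q) (u : RModZ) (v : ℝ) : E n :=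
  ∫ θ in (0 : ℝ)..1, contDeriv γ (u + ((θ * v : ℝ) : RModZ))

/-- The fundamental theorem of calculus along θ ↦ u + θv. Here v is a real lift of any size, so the
identity also holds for increments that leave (-1/2, 1/2). -/
lemma sub_eq_smul_meanDeriv (hs : 1 / q < s) (γ : Sobolev n s q) (u : RModZ) (v : ℝ) :
    γ (u + (v : RModZ)) - γ u = v • meanDeriv γ u v := by
  have hd : ∀ θ : ℝ, HasDerivAt (fun θ : ℝ => γ (u + ((θ * v : ℝ) : RModZ)))
      (v • contDeriv γ (u + ((θ * v : ℝ) : RModZ))) θ := fun θ =>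
    HasDerivAt.scomp (h := fun θ : ℝ => θ * v) (g₁ := fun t : ℝ => γ (u + (t : RModZ))) θ
      (hasDerivAt_add_coe hs γ u (θ * v)) (hasDerivAt_mul_const v)
  have := intervalIntegral.integral_eq_sub_of_hasDerivAt (a := 0) (b := 1) (fun t _ => hd t)
    (Continuous.intervalIntegrable (by fun_prop) _ _)
  rw [intervalIntegral.integral_smul] at this
  rw [meanDeriv, this]
  simp

lemma norm_meanDeriv_le (γ : Sobolev n s q) (u : RModZ) (v : ℝ) :
    ‖meanDeriv γ u v‖ ≤ ‖contDeriv γ‖ := by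
  have := intervalIntegral.norm_integral_le_of_norm_le_const (a := 0) (b := 1)
    (f := fun θ : ℝ => contDeriv γ (u + ((θ * v : ℝ) : RModZ))) (C := ‖contDeriv γ‖)
    (fun _ _ => (contDeriv γ).norm_coe_le_norm _)
  rw [meanDeriv]
  simpa using this

lemma exists_coe_eq (x : RModZ) : ∃ v : ℝ, (v : RModZ) = x ∧ |v| = ‖x‖ := by
  obtain ⟨y, rfl⟩ := QuotientAddGroup.mk_surjective x
  refine ⟨y - round y, ?_, ?_⟩
  · rw [AddCircle.coe_sub, sub_eq_self]
    exact (AddCircle.coe_eq_zero_iff 1).2 ⟨round y, by simp⟩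
  · exact UnitAddCircle.norm_eq.symm

lemma norm_sub_le_of_contDeriv (hs : 1 / q < s) (γ : Sobolev n s q) (x y : RModZ) :
    ‖γ x - γ y‖ ≤ ‖contDeriv γ‖ * ‖x - y‖ := by
  obtain ⟨v, hv, hv'⟩ := exists_coe_eq (x - y)
  have := sub_eq_smul_meanDeriv hs γ y v
  rw [hv, add_sub_cancel] at this
  rw [this, norm_smul, Real.norm_eq_abs, hv', mul_comm]
  gcongr
  exact norm_meanDeriv_le _ _ _

end ContDeriv

/-! ### Regular embedded curves -/

section BiLipschitz

variable {n : ℕ} {s q : ℝ} [hq : Fact (1 < q)]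

/-- A quantitative form of being regular and embedded. -/
def IsBiLipschitz (c : ℝ) (γ : Sobolev n s q) : Prop :=
  (∀ u, c ≤ ‖contDeriv γ u‖) ∧ ∀ x y, c * ‖x - y‖ ≤ ‖γ x - γ y‖

lemma norm_le_half (x : RModZ) : ‖x‖ ≤ 1 / 2 := by
  have := AddCircle.norm_le_half_period 1 (x := x) one_ne_zero
  simpa using this

lemma norm_coe_le (v : ℝ) : ‖(v : RModZ)‖ ≤ |v| := by
  rw [UnitAddCircle.norm_eq]
  have := round_le v 0
  simpa using this

/-- The set where the inequality holds is closed, and it is dense because its complement is null. -/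
lemma norm_contDeriv_ge (hs : 1 / q < s) {γ : Sobolev n s q} {c : ℝ}
    (h : ∀ᵐ u, c ≤ ‖γ.deriv u‖) (u : RModZ) : c ≤ ‖contDeriv γ u‖ := by
  have hae : ∀ᵐ u, u ∈ {u | c ≤ ‖contDeriv γ u‖} := by
    filter_upwards [h, contDeriv_ae hs γ] with u h1 h2
    show c ≤ ‖contDeriv γ u‖
    rw [h2]
    exact h1
  have hcl : IsClosed {u | c ≤ ‖contDeriv γ u‖} :=
    isClosed_le continuous_const (contDeriv γ).continuous.norm
  have hd : Dense {u | c ≤ ‖contDeriv γ u‖} := Measure.dense_of_ae hae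
  have := hcl.closure_eq ▸ hd u
  exact this

lemma norm_contDeriv_eq_one (hs : 1 / q < s) {γ : Sobolev n s q} (h : γ.IsArcLength) (u : RModZ) :
    ‖contDeriv γ u‖ = 1 := by
  have hae : (fun u => ‖contDeriv γ u‖) =ᵐ[volume] fun _ => 1 := by
    filter_upwards [h, contDeriv_ae hs γ] with u h1 h2
    rw [h2]
    exact h1
  exact congrFun (((contDeriv γ).continuous.norm.ae_eq_iff_eq volume continuous_const).1 hae) u

lemma IsBiLipschitz.mem_regularEmbedded (hs : 1 / q < s) {γ : Sobolev n s q} {c : ℝ} (hc : 0 < c)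
    (h : IsBiLipschitz c γ) : γ.IsRegular ∧ γ.IsEmbedded := by
  refine ⟨⟨c, hc, ?_⟩, fun x y hxy => ?_⟩
  · filter_upwards [contDeriv_ae hs γ] with u hu
    rw [← hu]
    exact h.1 u
  · have h1 := h.2 x y
    rw [hxy, sub_self, norm_zero] at h1
    have h2 : ‖x - y‖ ≤ 0 := by
      by_contra h3
      rw [not_le] at h3
      exact absurd h1 (not_le.2 (by positivity))
    exact sub_eq_zero.1 (norm_le_zero_iff.1 h2)

/-- Near the diagonal, uniform continuity of γ' keeps the mean derivative within c/2 of γ', hence of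
norm at least c/2. Away from the diagonal, injectivity and compactness give a positive minimum of
the distance. -/
lemma exists_isBiLipschitz (hs : 1 / q < s) {γ : Sobolev n s q} (hr : γ.IsRegular)
    (he : γ.IsEmbedded) : ∃ c, 0 < c ∧ IsBiLipschitz c γ := by
  obtain ⟨c, hc, hreg⟩ := hr
  replace hreg := norm_contDeriv_ge hs hreg
  have huc := CompactSpace.uniformContinuous_of_continuous (contDeriv γ).continuous
  obtain ⟨δ, hδ, hδ'⟩ := Metric.uniformContinuous_iff.1 huc (c / 2) (by positivity)
  have hnear : ∀ x y : RModZ, ‖x - y‖ < δ → c / 2 * ‖x - y‖ ≤ ‖γ x - γ y‖ := by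
    intro x y hxy
    obtain ⟨v, hv, hv'⟩ := exists_coe_eq (x - y)
    have h := sub_eq_smul_meanDeriv hs γ y v
    rw [hv, add_sub_cancel] at h
    rw [h, norm_smul, Real.norm_eq_abs, hv', mul_comm]
    gcongr
    have hm : ‖meanDeriv γ y v - contDeriv γ y‖ ≤ c / 2 := by
      have e : meanDeriv γ y v - contDeriv γ y
          = ∫ θ in (0 : ℝ)..1, (contDeriv γ (y + ((θ * v : ℝ) : RModZ)) - contDeriv γ y) := by
        rw [intervalIntegral.integral_sub (Continuous.intervalIntegrable (by fun_prop) _ _)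
          (Continuous.intervalIntegrable (by fun_prop) _ _), meanDeriv]
        simp
      rw [e]
      have := intervalIntegral.norm_integral_le_of_norm_le_const (a := 0) (b := 1)
        (f := fun θ : ℝ => contDeriv γ (y + ((θ * v : ℝ) : RModZ)) - contDeriv γ y)
        (C := c / 2) fun θ hθ => by
          rw [uIoc_of_le zero_le_one] at hθ
          rw [← dist_eq_norm]
          refine (hδ' ?_).le
          rw [dist_eq_norm, add_sub_cancel_left]
          refine (norm_coe_le _).trans_lt ?_
          rw [abs_mul, abs_of_pos hθ.1, hv']
          exact (mul_le_of_le_one_left (norm_nonneg _) hθ.2).trans_lt hxy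
      simpa using this
    have h1 := hreg y
    have h2 := norm_sub_norm_le (contDeriv γ y) (meanDeriv γ y v)
    rw [norm_sub_rev] at h2
    linarith
  have hK : IsCompact {z : RModZ × RModZ | δ ≤ ‖z.1 - z.2‖} :=
    (isClosed_le continuous_const (by fun_prop)).isCompact
  have hfc : Continuous fun z : RModZ × RModZ => ‖γ z.1 - γ z.2‖ := by
    have := γ.continuous
    fun_prop
  obtain ⟨m, hm, hm'⟩ : ∃ m, 0 < m ∧ ∀ x y : RModZ, δ ≤ ‖x - y‖ → m ≤ ‖γ x - γ y‖ := by
    rcases {z : RModZ × RModZ | δ ≤ ‖z.1 - z.2‖}.eq_empty_or_nonempty with hem | hne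
    · refine ⟨1, one_pos, fun x y hxy => ?_⟩
      have : (x, y) ∈ {z : RModZ × RModZ | δ ≤ ‖z.1 - z.2‖} := hxy
      rw [hem] at this
      exact absurd this (notMem_empty _)
    · obtain ⟨z, hz, hmin⟩ := hK.exists_isMinOn hne hfc.continuousOn
      have hz' : z.1 ≠ z.2 := by
        intro h
        have h1 : δ ≤ ‖z.1 - z.2‖ := hz
        rw [h, sub_self, norm_zero] at h1
        linarith
      refine ⟨‖γ z.1 - γ z.2‖, norm_pos_iff.2 (sub_ne_zero.2 fun h => hz' (he h)), fun x y hxy => ?_⟩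
      exact isMinOn_iff.1 hmin (x, y) hxy
  refine ⟨min (c / 2) m, lt_min (by positivity) hm, fun u => ?_, fun x y => ?_⟩
  · have := min_le_left (c / 2) m
    linarith [hreg u]
  · by_cases hxy : ‖x - y‖ < δ
    · refine le_trans ?_ (hnear x y hxy)
      gcongr
      exact min_le_left _ _
    · refine le_trans ?_ (hm' x y (not_lt.1 hxy))
      have h1 := norm_le_half (x - y)
      calc min (c / 2) m * ‖x - y‖ ≤ m * 1 := by
            gcongr
            · exact min_le_right _ _
            · linarith
        _ = m := mul_one m

lemma contDeriv_sub (hs : 1 / q < s) (γ η : Sobolev n s q) :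
    contDeriv (γ - η) = contDeriv γ - contDeriv η := by
  have := contDeriv_add hs (γ - η) η
  rw [sub_add_cancel] at this
  rw [this, add_sub_cancel_right]

/-- The sup norm of the derivative of η - γ bounds the change of the speed as well as the Lipschitz
constant of the difference, so one smallness condition preserves both inequalities up to c/2. -/
lemma IsBiLipschitz.eventually (hs : 1 / q < s) {γ : Sobolev n s q} {c : ℝ} (hc : 0 < c)
    (h : IsBiLipschitz c γ) : ∀ᶠ η in 𝓝 γ, IsBiLipschitz (c / 2) η := by
  obtain ⟨K, hK0, hK⟩ := exists_norm_contDeriv_le n hs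
  have hlim : Tendsto (fun η : Sobolev n s q => K * ‖η - γ‖) (𝓝 γ) (𝓝 0) := by
    have : Continuous fun η : Sobolev n s q => K * ‖η - γ‖ := by fun_prop
    convert this.tendsto γ
    simp
  filter_upwards [hlim.eventually (gt_mem_nhds (half_pos hc))] with η hη
  have hd : ‖contDeriv (η - γ)‖ ≤ c / 2 := (hK _).trans hη.le
  refine ⟨fun u => ?_, fun x y => ?_⟩
  · have h1 := h.1 u
    have h2 := norm_sub_norm_le (contDeriv γ u) (contDeriv η u)
    have h3 := (contDeriv (η - γ)).norm_coe_le_norm u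
    rw [contDeriv_sub hs, ContinuousMap.sub_apply, norm_sub_rev] at h3
    rw [contDeriv_sub hs] at hd
    linarith
  · have h1 := h.2 x y
    have h2 := norm_sub_norm_le (γ x - γ y) (η x - η y)
    have h3 := norm_sub_le_of_contDeriv hs (η - γ) x y
    have e : (η - γ) x - (η - γ) y = -((γ x - γ y) - (η x - η y)) := by
      have : ∀ z, (η - γ) z = η z - γ z := fun z => rfl
      rw [this, this]; abel
    rw [e, norm_neg] at h3
    have h4 : ‖contDeriv (η - γ)‖ * ‖x - y‖ ≤ c / 2 * ‖x - y‖ := by gcongr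
    linarith

lemma isOpen_regular_embedded (hs : 1 / q < s) :
    IsOpen {γ : Sobolev n s q | γ.IsRegular ∧ γ.IsEmbedded} := by
  rw [isOpen_iff_mem_nhds]
  rintro γ ⟨hr, he⟩
  obtain ⟨c, hc, h⟩ := exists_isBiLipschitz hs hr he
  filter_upwards [h.eventually hs hc] with η hη
  exact hη.mem_regularEmbedded hs (half_pos hc)

end BiLipschitz

/-! ### The `L^q`-estimate for the normalized area -/

/-- The triples of parameters. -/
abbrev Triple := RModZ × RModZ × RModZ

/-- The cyclic permutation of the three parameters. -/
def cyc (x : Triple) : Triple := (x.2.1, x.2.2, x.1)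

lemma measurePreserving_cyc : MeasurePreserving cyc := by
  have h1 : MeasurePreserving (Prod.swap : RModZ × (RModZ × RModZ) → (RModZ × RModZ) × RModZ) :=
    Measure.measurePreserving_swap
  have h2 : MeasurePreserving (MeasurableEquiv.prodAssoc : (RModZ × RModZ) × RModZ ≃ᵐ Triple) :=
    measurePreserving_prodAssoc volume volume volume
  exact h2.comp h1

/-- The product of the mutual distances of the three parameters in `ℝ/ℤ`. -/
def distProd (x : Triple) : ℝ := ‖x.2.1 - x.2.2‖ * ‖x.2.1 - x.1‖ * ‖x.2.2 - x.1‖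

lemma distProd_cyc (x : Triple) : distProd (cyc x) = distProd x := by
  simp only [distProd, cyc]
  rw [norm_sub_rev x.1 x.2.1]
  rw [norm_sub_rev x.2.2 x.2.1]
  ring

lemma distProd_nonneg (x : Triple) : 0 ≤ distProd x := by unfold distProd; positivity

lemma continuous_distProd : Continuous distProd := by unfold distProd; fun_prop

variable {n : ℕ}

/-- Twice the polarization of the oriented area of the triangle of the points of a curve. -/
def polarArea (f g : RModZ → E n) (x : Triple) : ⋀[ℝ]^2 (E n) :=
  wedge (f x.2.1 - f x.1) (g x.2.2 - g x.1) + wedge (g x.2.1 - g x.1) (f x.2.2 - f x.1)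

lemma wedge_sub_left (a b c : E n) : wedge (a - b) c = wedge a c - wedge b c := by
  rw [← wedgeL_apply, map_sub]; rfl

lemma wedge_sub_right (a b c : E n) : wedge a (b - c) = wedge a b - wedge a c := by
  rw [← wedgeL_apply, map_sub]; rfl

lemma wedge_add_right (a b c : E n) : wedge a (b + c) = wedge a b + wedge a c := by
  rw [← wedgeL_apply, map_add]; rfl

lemma wedge_smul_right (t : ℝ) (a b : E n) : wedge a (t • b) = t • wedge a b := by
  rw [← wedgeL_apply, map_smul]; rfl

/-- The oriented area of a triangle does not depend on the vertex from which its edges are drawn;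
the polarization inherits this. -/
lemma polarArea_cyc (f g : RModZ → E n) (x : Triple) :
    polarArea f g (cyc x) = polarArea f g x := by
  simp only [polarArea, cyc, wedge_sub_left, wedge_sub_right]
  rw [wedge_swap (f x.2.2) (g x.1), wedge_swap (f x.2.2) (g x.2.1), wedge_swap (f x.2.1) (g x.1),
    wedge_swap (f x.2.1) (g x.2.1), wedge_swap (g x.2.2) (f x.1), wedge_swap (g x.2.2) (f x.2.1),
    wedge_swap (f x.2.1) (g x.2.2), wedge_swap (f x.1) (g x.2.2), wedge_swap (f x.1) (g x.1)]
  abel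

/-- The area normalized by a power of the parameter distances. -/
def areaQuot (p q : ℝ) (f g : RModZ → E n) (x : Triple) : ⋀[ℝ]^2 (E n) :=
  distProd x ^ (-(p / q)) • polarArea f g x

lemma areaQuot_cyc (p q : ℝ) (f g : RModZ → E n) (x : Triple) :
    areaQuot p q f g (cyc x) = areaQuot p q f g x := by
  rw [areaQuot, distProd_cyc, polarArea_cyc, areaQuot]

/-- The triples for which the first and the third parameter are closest to each other. -/
def shortSide : Set Triple := {x | ‖x.2.2 - x.1‖ ≤ ‖x.2.1 - x.1‖ ∧ ‖x.2.2 - x.1‖ ≤ ‖x.2.1 - x.2.2‖}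

lemma measurableSet_shortSide : MeasurableSet shortSide := by
  have h1 : MeasurableSet {x : Triple | ‖x.2.2 - x.1‖ ≤ ‖x.2.1 - x.1‖} :=
    measurableSet_le (by fun_prop) (by fun_prop)
  have h2 : MeasurableSet {x : Triple | ‖x.2.2 - x.1‖ ≤ ‖x.2.1 - x.2.2‖} :=
    measurableSet_le (by fun_prop) (by fun_prop)
  exact h1.inter h2

lemma mem_shortSide_or (x : Triple) :
    x ∈ shortSide ∨ cyc x ∈ shortSide ∨ cyc (cyc x) ∈ shortSide := by
  simp only [shortSide, cyc, mem_ofPred_eq]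
  rw [norm_sub_rev x.1 x.2.1, norm_sub_rev x.2.2 x.2.1, norm_sub_rev x.1 x.2.2]
  rcases le_total ‖x.2.2 - x.1‖ ‖x.2.1 - x.1‖ with h1 | h1 <;>
  rcases le_total ‖x.2.2 - x.1‖ ‖x.2.1 - x.2.2‖ with h2 | h2 <;>
  rcases le_total ‖x.2.1 - x.1‖ ‖x.2.1 - x.2.2‖ with h3 | h3 <;> grind

/-- Every triple has a shortest side, which some cyclic permutation places between the first and the
third parameter. -/
lemma lintegral_le_of_cyc {f : Triple → ℝ≥0∞} (hf : Measurable f) (hcyc : ∀ x, f (cyc x) = f x) :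
    ∫⁻ x, f x ≤ 3 * ∫⁻ x in shortSide, f x := by
  have hmp := measurePreserving_cyc
  have hF : Measurable (shortSide.indicator f) := hf.indicator measurableSet_shortSide
  have h1 : ∀ x, f x ≤ shortSide.indicator f x + (shortSide.indicator f (cyc x)
      + shortSide.indicator f (cyc (cyc x))) := by
    intro x
    rcases mem_shortSide_or x with h | h | h
    · rw [indicator_of_mem h]; exact le_self_add
    · rw [indicator_of_mem h, hcyc]; exact le_add_left le_self_add
    · rw [indicator_of_mem h, hcyc, hcyc]; exact le_add_left (le_add_left le_rfl)
  have e1 : ∫⁻ x, shortSide.indicator f (cyc x) = ∫⁻ x, shortSide.indicator f x :=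
    hmp.lintegral_comp hF
  have e2 : ∫⁻ x, shortSide.indicator f (cyc (cyc x)) = ∫⁻ x, shortSide.indicator f x :=
    (hmp.comp hmp).lintegral_comp hF
  calc ∫⁻ x, f x ≤ ∫⁻ x, (shortSide.indicator f x + (shortSide.indicator f (cyc x)
      + shortSide.indicator f (cyc (cyc x)))) := lintegral_mono h1
    _ = 3 * ∫⁻ x in shortSide, f x := by
      rw [lintegral_add_left hF, lintegral_add_left (f := fun x => shortSide.indicator f (cyc x))
        (hF.comp hmp.measurable), e1, e2,
        lintegral_indicator measurableSet_shortSide]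
      ring

/-- Translation invariance introduces the increments w and r as coordinates. Lifting them to (-1/2,
1/2] makes their norms in ℝ/ℤ equal to absolute values. -/
lemma lintegral_triple_eq {f : Triple → ℝ≥0∞} (hf : Measurable f) :
    ∫⁻ x, f x = ∫⁻ u : RModZ, ∫⁻ w in Ioc (-1 / 2 : ℝ) (1 / 2), ∫⁻ r in Ioc (-1 / 2 : ℝ) (1 / 2),
      f (u, u + (w : RModZ) + (r : RModZ), u + (w : RModZ)) := by
  have hI : Ioc (-1 / 2 : ℝ) (1 / 2) = Ioc (-1 / 2) (-1 / 2 + 1) := by norm_num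
  rw [Measure.volume_eq_prod, lintegral_prod _ hf.aemeasurable]
  refine lintegral_congr fun u => ?_
  rw [Measure.volume_eq_prod, lintegral_prod_symm _ (by fun_prop), hI]
  rw [← lintegral_add_left_eq_self _ u, ← UnitAddCircle.lintegral_preimage (-1 / 2)]
  refine lintegral_congr fun w => ?_
  rw [← lintegral_add_left_eq_self _ (u + (w : RModZ)), ← UnitAddCircle.lintegral_preimage (-1 / 2)]

lemma lintegral_abs_rpow_le {e : ℝ} (he : -1 < e) (b : ℝ) :
    ∫⁻ w in {w : ℝ | |w| ≤ |b|}, ENNReal.ofReal (|w| ^ e)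
      ≤ ENNReal.ofReal (2 / (e + 1) * |b| ^ (e + 1)) := by
  have hb := abs_nonneg b
  have he1 : 0 < e + 1 := by linarith
  have hIcc : ∫⁻ w in Icc 0 |b|, ENNReal.ofReal (|w| ^ e)
      = ENNReal.ofReal (|b| ^ (e + 1) / (e + 1)) := by
    have hi : IntervalIntegrable (fun w : ℝ => w ^ e) volume 0 |b| :=
      intervalIntegral.intervalIntegrable_rpow' he
    rw [intervalIntegrable_iff_integrableOn_Ioc_of_le hb] at hi
    have h1 : ∫⁻ w in Icc 0 |b|, ENNReal.ofReal (|w| ^ e)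
        = ∫⁻ w in Ioc 0 |b|, ENNReal.ofReal (w ^ e) := by
      rw [restrict_Ioc_eq_restrict_Icc.symm]
      exact setLIntegral_congr_fun measurableSet_Ioc fun w hw => by
        simp only [abs_of_pos hw.1]
    rw [h1, ← ofReal_integral_eq_lintegral_ofReal hi, ← intervalIntegral.integral_of_le hb,
      integral_rpow (Or.inl he), Real.zero_rpow he1.ne', sub_zero]
    filter_upwards [self_mem_ae_restrict measurableSet_Ioc] with w hw
    exact Real.rpow_nonneg hw.1.le _
  have hneg : ∫⁻ w in Icc (-|b|) 0, ENNReal.ofReal (|w| ^ e)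
      = ∫⁻ w in Icc 0 |b|, ENNReal.ofReal (|w| ^ e) := by
    rw [← lintegral_indicator measurableSet_Icc, ← lintegral_indicator measurableSet_Icc,
      ← lintegral_neg_eq_self]
    refine lintegral_congr fun w => ?_
    by_cases hw : w ∈ Icc 0 |b|
    · have hw' : -w ∈ Icc (-|b|) 0 := ⟨by linarith [hw.2], by linarith [hw.1]⟩
      rw [indicator_of_mem hw, indicator_of_mem hw', abs_neg]
    · rw [indicator_of_notMem hw, indicator_of_notMem]
      exact fun h => hw ⟨by linarith [h.2], by linarith [h.1]⟩
  have hsub : {w : ℝ | |w| ≤ |b|} ⊆ Icc (-|b|) 0 ∪ Icc 0 |b| := by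
    intro w hw
    have h := abs_le.1 (show |w| ≤ |b| from hw)
    rcases le_total w 0 with h0 | h0
    · exact Or.inl ⟨h.1, h0⟩
    · exact Or.inr ⟨h0, h.2⟩
  calc ∫⁻ w in {w : ℝ | |w| ≤ |b|}, ENNReal.ofReal (|w| ^ e)
      ≤ ∫⁻ w in Icc (-|b|) 0 ∪ Icc 0 |b|, ENNReal.ofReal (|w| ^ e) := lintegral_mono_set hsub
    _ ≤ _ := lintegral_union_le _ _ _
    _ = _ := by
      rw [hneg, hIcc, ← ENNReal.ofReal_add (by positivity) (by positivity)]
      congr 1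
      ring

/-- Substitute θr for r on the right. Jacobian and weight together contribute θ^(1-a) ≥ 1, and
scaling by θ ≤ 1 maps the interval into itself. -/
lemma lintegral_comp_mul_le {a θ : ℝ} (ha : 1 ≤ a) (hθ : 0 < θ) (hθ' : θ ≤ 1) {M : ℝ → ℝ≥0∞}
    (hM : Measurable M) :
    ∫⁻ r in Ioo (-1 / 2 : ℝ) (1 / 2), ENNReal.ofReal (|r| ^ (-a)) * M (θ * r)
      ≤ ∫⁻ r in Ioo (-1 / 2 : ℝ) (1 / 2), ENNReal.ofReal (|r| ^ (-a)) * M r := by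
  set h : ℝ → ℝ≥0∞ := (Ioo (-1 / 2 : ℝ) (1 / 2)).indicator
    fun r => ENNReal.ofReal (|r| ^ (-a)) * M r with hh
  have hm : Measurable h := Measurable.indicator (by fun_prop) measurableSet_Ioo
  rw [← lintegral_indicator measurableSet_Ioo, ← lintegral_indicator measurableSet_Ioo, ← hh]
  have e : ∫⁻ r, h r = ∫⁻ r, ENNReal.ofReal θ * h (θ * r) := by
    conv_lhs => rw [← Real.smul_map_volume_mul_left hθ.ne']
    rw [lintegral_smul_measure, lintegral_map hm (by fun_prop), abs_of_pos hθ,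
      lintegral_const_mul _ (by fun_prop)]
    rfl
  rw [e]
  refine lintegral_mono fun r => ?_
  by_cases hr : r ∈ Ioo (-1 / 2 : ℝ) (1 / 2)
  · have hr' : θ * r ∈ Ioo (-1 / 2 : ℝ) (1 / 2) := by
      have h1 : |r| < 1 / 2 := abs_lt.2 ⟨by linarith [hr.1], hr.2⟩
      have h2 : |θ * r| < 1 / 2 := by
        rw [abs_mul, abs_of_pos hθ]
        exact (mul_le_of_le_one_left (abs_nonneg _) hθ').trans_lt h1
      have h3 := abs_lt.1 h2
      exact ⟨by linarith [h3.1], h3.2⟩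
    rw [indicator_of_mem hr, hh, indicator_of_mem hr', ← mul_assoc,
      ← ENNReal.ofReal_mul hθ.le]
    gcongr
    rw [abs_mul, abs_of_pos hθ, Real.mul_rpow hθ.le (abs_nonneg _), ← mul_assoc]
    refine le_mul_of_one_le_left (by positivity) ?_
    have e1 : θ * θ ^ (-a) = θ ^ (1 - a) := by
      rw [Real.rpow_sub hθ, Real.rpow_one, Real.rpow_neg hθ.le]; rfl
    rw [e1]
    exact Real.one_le_rpow_of_pos_of_le_one_of_nonpos hθ hθ' (by linarith)
  · rw [indicator_of_notMem hr]
    exact zero_le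

/-- The weight in the `L^q`-estimate of the normalized area. -/
def areaKernel (p q w r : ℝ) : ℝ≥0∞ :=
  {w : ℝ | |w| ≤ |r|}.indicator (fun w => ENNReal.ofReal (|w| ^ (q - p))) w
    * ENNReal.ofReal (|r| ^ (q - 2 * p))

lemma measurable_areaKernel (p q : ℝ) : Measurable fun z : ℝ × ℝ => areaKernel p q z.1 z.2 := by
  have : (fun z : ℝ × ℝ => areaKernel p q z.1 z.2) = fun z : ℝ × ℝ =>
      {z : ℝ × ℝ | |z.1| ≤ |z.2|}.indicator (fun z => ENNReal.ofReal (|z.1| ^ (q - p))) z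
        * ENNReal.ofReal (|z.2| ^ (q - 2 * p)) := rfl
  rw [this]
  refine Measurable.mul (Measurable.indicator (by fun_prop) ?_) (by fun_prop)
  exact measurableSet_le (by fun_prop) (by fun_prop)

/-- The singularity |w|^(q-p) is integrable because q - p > -1. Its integral over |w| ≤ |r| is a
multiple of |r|^(q-p+1), which is then multiplied by |r|^(q-2p). -/
lemma lintegral_areaKernel_le {p q : ℝ} (hpq : p < q + 1) (h2 : q - 2 * p < 0) (r : ℝ) (t : Set ℝ) :
    ∫⁻ w in t, areaKernel p q w r
      ≤ ENNReal.ofReal (2 / (q - p + 1)) * ENNReal.ofReal (|r| ^ (2 * q - 3 * p + 1)) := by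
  have hms : MeasurableSet {w : ℝ | |w| ≤ |r|} := measurableSet_le (by fun_prop) (by fun_prop)
  have hqp : 0 < q - p + 1 := by linarith
  unfold areaKernel
  rw [lintegral_mul_const' _ _ (by simp)]
  have h1 : ∫⁻ w in t, {w : ℝ | |w| ≤ |r|}.indicator (fun w => ENNReal.ofReal (|w| ^ (q - p))) w
      ≤ ENNReal.ofReal (2 / (q - p + 1) * |r| ^ (q - p + 1)) := by
    refine (lintegral_mono' Measure.restrict_le_self le_rfl).trans ?_
    rw [lintegral_indicator hms]
    exact lintegral_abs_rpow_le (by linarith) r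
  refine (mul_le_mul_left h1 _).trans ?_
  rw [← ENNReal.ofReal_mul (by positivity), ← ENNReal.ofReal_mul (by positivity), mul_assoc]
  refine ENNReal.ofReal_le_ofReal ?_
  gcongr
  rcases eq_or_ne r 0 with rfl | hr
  · rw [abs_zero, Real.zero_rpow h2.ne, mul_zero]
    positivity
  · rw [← Real.rpow_add (abs_pos.2 hr)]
    apply le_of_eq
    congr 1
    ring

/-- Translation by θw in u removes w from the integrand, so that afterwards only the kernel depends
on w. -/
lemma lintegral_sub_add_eq_modulus {q : ℝ} (g : RModZ → E n) (w r θ : ℝ) :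
    ∫⁻ u, ‖g (u + ((θ * (w + r) : ℝ) : RModZ)) - g (u + ((θ * w : ℝ) : RModZ))‖ₑ ^ q
      = modulus q g (θ * r) := by
  rw [modulus]
  conv_rhs => rw [← lintegral_add_right_eq_self _ ((θ * w : ℝ) : RModZ)]
  refine lintegral_congr fun u => ?_
  rw [mul_add, AddCircle.coe_add, add_assoc]

/-- The order of integration matters. Integrating in u yields the modulus at θr, independent of w;
integrating the kernel in w yields the weight of the seminorm in r; the scaling estimate then bounds
the r-integral uniformly in θ ∈ (0, 1]. -/
lemma lintegral_areaKernel_mul_le {p q s : ℝ} (hq : 1 < q) (hqs : q * s = 3 * p - 2 - 2 * q)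
    (hs : 0 < s) (hpq : p < q + 1) {g : RModZ → E n} (hg : Continuous g) :
    ∫⁻ u : RModZ, ∫⁻ w in Ioc (-1 / 2 : ℝ) (1 / 2), ∫⁻ r in Ioc (-1 / 2 : ℝ) (1 / 2),
      areaKernel p q w r * ∫⁻ θ in Ioc (0 : ℝ) 1,
        ‖g (u + ((θ * (w + r) : ℝ) : RModZ)) - g (u + ((θ * w : ℝ) : RModZ))‖ₑ ^ q
      ≤ ENNReal.ofReal (2 / (q - p + 1)) * slobodeckij s q g := by
  have hqs0 : 0 < q * s := by positivity
  have hgm := hg.measurable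
  have hM := measurable_modulus (q := q) hgm
  have hkm := measurable_areaKernel p q
  set I := Ioc (-1 / 2 : ℝ) (1 / 2) with hI
  set N : RModZ → ℝ → ℝ → ℝ → ℝ≥0∞ := fun u w r θ =>
    ‖g (u + ((θ * (w + r) : ℝ) : RModZ)) - g (u + ((θ * w : ℝ) : RModZ))‖ₑ ^ q with hN
  have hNm : Measurable fun z : ((RModZ × ℝ) × ℝ) × ℝ => N z.1.1.1 z.1.1.2 z.1.2 z.2 := by
    simp only [hN]; fun_prop
  set P : (RModZ × ℝ) × ℝ → ℝ≥0∞ := fun z => ∫⁻ θ in Ioc (0 : ℝ) 1, N z.1.1 z.1.2 z.2 θ with hP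
  have hPm : Measurable P := Measurable.lintegral_prod_right' hNm
  have hkP : Measurable fun z : (RModZ × ℝ) × ℝ => areaKernel p q z.1.2 z.2 * P z :=
    (hkm.comp (by fun_prop : Measurable fun z : (RModZ × ℝ) × ℝ => (z.1.2, z.2))).mul hPm
  have hkP' : Measurable fun z : RModZ × ℝ => ∫⁻ r in I, areaKernel p q z.2 r * P (z, r) :=
    Measurable.lintegral_prod_right' hkP
  have hL : ∀ w r, ∫⁻ u, P ((u, w), r) = ∫⁻ θ in Ioc (0 : ℝ) 1, modulus q g (θ * r) := by
    intro w r
    simp only [hP]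
    rw [lintegral_lintegral_swap]
    · exact lintegral_congr fun θ => lintegral_sub_add_eq_modulus g w r θ
    · exact (hNm.comp (by fun_prop : Measurable fun z : RModZ × ℝ =>
        (((z.1, w), r), z.2))).aemeasurable
  have hLm : Measurable fun r : ℝ => ∫⁻ θ in Ioc (0 : ℝ) 1, modulus q g (θ * r) :=
    Measurable.lintegral_prod_right' (f := fun z : ℝ × ℝ => modulus q g (z.2 * z.1)) (by fun_prop)
  calc ∫⁻ u : RModZ, ∫⁻ w in I, ∫⁻ r in I, areaKernel p q w r * P ((u, w), r)
      = ∫⁻ w in I, ∫⁻ u : RModZ, ∫⁻ r in I, areaKernel p q w r * P ((u, w), r) :=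
        lintegral_lintegral_swap hkP'.aemeasurable
    _ = ∫⁻ w in I, ∫⁻ r in I, areaKernel p q w r * ∫⁻ θ in Ioc (0 : ℝ) 1, modulus q g (θ * r) := by
        refine lintegral_congr fun w => ?_
        rw [lintegral_lintegral_swap]
        · refine lintegral_congr fun r => ?_
          rw [← hL w r, lintegral_const_mul]
          exact hPm.comp (by fun_prop : Measurable fun u : RModZ => ((u, w), r))
        · exact (hkP.comp (by fun_prop : Measurable fun z : RModZ × ℝ =>
            ((z.1, w), z.2))).aemeasurable
    _ = ∫⁻ r in I, ∫⁻ w in I, areaKernel p q w r * ∫⁻ θ in Ioc (0 : ℝ) 1, modulus q g (θ * r) := by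
        refine lintegral_lintegral_swap ?_
        exact (hkm.mul (hLm.comp measurable_snd)).aemeasurable
    _ ≤ ∫⁻ r in I, ENNReal.ofReal (2 / (q - p + 1)) * (ENNReal.ofReal (|r| ^ (-(1 + q * s)))
          * ∫⁻ θ in Ioc (0 : ℝ) 1, modulus q g (θ * r)) := by
        refine lintegral_mono fun r => ?_
        have hkr : Measurable fun w => areaKernel p q w r :=
          hkm.comp (by fun_prop : Measurable fun w : ℝ => (w, r))
        rw [lintegral_mul_const _ hkr, ← mul_assoc]
        gcongr
        -- Here the smoothness s is matched to p and q: the kernel integrates to exactly the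
        -- Slobodeckij weight.
        have e : -(1 + q * s) = 2 * q - 3 * p + 1 := by rw [hqs]; ring
        rw [e]
        exact lintegral_areaKernel_le hpq (by linarith) r I
    _ = ENNReal.ofReal (2 / (q - p + 1)) * ∫⁻ r in I, ∫⁻ θ in Ioc (0 : ℝ) 1,
          ENNReal.ofReal (|r| ^ (-(1 + q * s))) * modulus q g (θ * r) := by
        rw [lintegral_const_mul' _ _ (by simp)]
        congr 1
        refine lintegral_congr fun r => ?_
        rw [lintegral_const_mul' _ _ (by simp)]
    _ = ENNReal.ofReal (2 / (q - p + 1)) * ∫⁻ θ in Ioc (0 : ℝ) 1, ∫⁻ r in I,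
          ENNReal.ofReal (|r| ^ (-(1 + q * s))) * modulus q g (θ * r) := by
        rw [lintegral_lintegral_swap (by unfold Function.uncurry; fun_prop)]
    _ ≤ ENNReal.ofReal (2 / (q - p + 1)) * ∫⁻ _ in Ioc (0 : ℝ) 1, slobodeckij s q g := by
        gcongr ENNReal.ofReal (2 / (q - p + 1)) * ?_
        refine setLIntegral_mono' measurableSet_Ioc fun θ hθ => ?_
        rw [hI, ← restrict_Ioo_eq_restrict_Ioc]
        exact lintegral_comp_mul_le (by linarith) hθ.1 hθ.2 hM
    _ = _ := by simp

variable {n : ℕ} {s q : ℝ} [hq : Fact (1 < q)]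

/-- Both edges from u are multiples of mean derivatives. Taking both increments equal to w gives two
wedge products that cancel by antisymmetry; subtracting them replaces the mean derivatives over w +
r by differences of means. -/
lemma norm_polarArea_le (hs : 1 / q < s) (γ η : Sobolev n s q) (u : RModZ) (w r : ℝ) :
    ‖polarArea γ η (u, u + (w : RModZ) + (r : RModZ), u + (w : RModZ))‖ ≤ |w + r| * |w| *
      (‖meanDeriv γ u (w + r) - meanDeriv γ u w‖ * ‖contDeriv η‖
        + ‖meanDeriv η u (w + r) - meanDeriv η u w‖ * ‖contDeriv γ‖) := by
  have e : polarArea γ η (u, u + (w : RModZ) + (r : RModZ), u + (w : RModZ)) = ((w + r) * w) •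
      (wedge (meanDeriv γ u (w + r) - meanDeriv γ u w) (meanDeriv η u w)
        + wedge (meanDeriv η u (w + r) - meanDeriv η u w) (meanDeriv γ u w)) := by
    have h : u + (w : RModZ) + (r : RModZ) = u + ((w + r : ℝ) : RModZ) := by
      rw [AddCircle.coe_add, add_assoc]
    simp only [polarArea, h, sub_eq_smul_meanDeriv hs, wedge_smul_left, wedge_smul_right, smul_smul,
      wedge_sub_left]
    rw [wedge_swap (meanDeriv η u w), ← smul_add]
    congr 1
    · ring
    · abel
  rw [e, norm_smul, Real.norm_eq_abs, abs_mul]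
  gcongr
  refine (norm_add_le _ _).trans (add_le_add ?_ ?_)
  · refine (norm_wedge_le _ _).trans ?_
    gcongr
    exact norm_meanDeriv_le _ _ _
  · refine (norm_wedge_le _ _).trans ?_
    gcongr
    exact norm_meanDeriv_le _ _ _

lemma norm_coe_eq_abs {w : ℝ} (h : |w| ≤ 1 / 2) : ‖(w : RModZ)‖ = |w| :=
  (AddCircle.norm_coe_eq_abs_iff 1 one_ne_zero).2 (by simpa using h)

/-- When w is the shortest side, the two other parameter distances are comparable to |r|. Hence D is
at least |w||r|²/2, while the area carries the factor |w + r||w| ≤ 2|r||w|. -/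
lemma norm_areaQuot_le {p : ℝ} (hp : 0 < p) (hs : 1 / q < s) (γ η : Sobolev n s q) (u : RModZ)
    {w r : ℝ} (hw : |w| ≤ 1 / 2) (hr : |r| ≤ 1 / 2)
    (hx : (u, u + (w : RModZ) + (r : RModZ), u + (w : RModZ)) ∈ shortSide) :
    |w| ≤ |r| ∧
    ‖areaQuot p q γ η (u, u + (w : RModZ) + (r : RModZ), u + (w : RModZ))‖ ≤
      2 * 2 ^ (p / q) * (|w| ^ (1 - p / q) * |r| ^ (1 - 2 * (p / q))) *
      (‖meanDeriv γ u (w + r) - meanDeriv γ u w‖ * ‖contDeriv η‖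
        + ‖meanDeriv η u (w + r) - meanDeriv η u w‖ * ‖contDeriv γ‖) := by
  have hq0 : 0 < q := by linarith [hq.out]
  have hpq : 0 < p / q := by positivity
  obtain ⟨h1, h2⟩ := hx
  have e1 : u + (w : RModZ) + (r : RModZ) - u = (w : RModZ) + (r : RModZ) := by abel
  have e2 : u + (w : RModZ) - u = (w : RModZ) := by abel
  have e3 : u + (w : RModZ) + (r : RModZ) - (u + (w : RModZ)) = (r : RModZ) := by abel
  simp only [e1, e2, e3, norm_coe_eq_abs hw, norm_coe_eq_abs hr] at h1 h2
  refine ⟨h2, ?_⟩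
  rw [areaQuot, norm_smul, Real.norm_of_nonneg (Real.rpow_nonneg (distProd_nonneg _) _)]
  simp only [distProd, e1, e2, e3, norm_coe_eq_abs hw, norm_coe_eq_abs hr]
  have hA := norm_polarArea_le hs γ η u w r
  set S := ‖meanDeriv γ u (w + r) - meanDeriv γ u w‖ * ‖contDeriv η‖
        + ‖meanDeriv η u (w + r) - meanDeriv η u w‖ * ‖contDeriv γ‖ with hS
  have hS0 : 0 ≤ S := by positivity
  rcases eq_or_ne w 0 with rfl | hw0
  · rw [abs_zero, mul_zero, Real.zero_rpow (by linarith), zero_mul]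
    positivity
  · have hwp : 0 < |w| := abs_pos.2 hw0
    have hrp : 0 < |r| := hwp.trans_le h2
    -- The triangle inequality gives |r| ≤ ‖w + r‖ + |w|, and |w| ≤ ‖w + r‖ since w is shortest.
    have hvr : |r| / 2 ≤ ‖(w : RModZ) + (r : RModZ)‖ := by
      have := norm_sub_le ((w : RModZ) + (r : RModZ)) (w : RModZ)
      rw [add_sub_cancel_left, norm_coe_eq_abs hr, norm_coe_eq_abs hw] at this
      linarith
    have hD : (|r| * ‖(w : RModZ) + (r : RModZ)‖ * |w|) ^ (-(p / q))
        ≤ (|r| * (|r| / 2) * |w|) ^ (-(p / q)) := by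
      refine Real.rpow_le_rpow_of_nonpos (by positivity) (by gcongr) (by linarith)
    have hwr : |w + r| ≤ 2 * |r| := (abs_add_le _ _).trans (by linarith)
    calc (|r| * ‖(w : RModZ) + (r : RModZ)‖ * |w|) ^ (-(p / q)) *
          ‖polarArea γ η (u, u + (w : RModZ) + (r : RModZ), u + (w : RModZ))‖
        ≤ (|r| * (|r| / 2) * |w|) ^ (-(p / q)) * (2 * |r| * |w| * S) := by
          refine mul_le_mul hD (hA.trans ?_) (norm_nonneg _) (by positivity)
          gcongr
      _ = _ := by
          have e4 : 1 - 2 * (p / q) = 1 + -(p / q) + -(p / q) := by ring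
          have e5 : 1 - p / q = 1 + -(p / q) := by ring
          rw [e4, e5, Real.rpow_add hrp, Real.rpow_add hrp, Real.rpow_add hwp, Real.rpow_one,
            Real.rpow_one, Real.mul_rpow (by positivity) (by positivity),
            Real.mul_rpow (by positivity) (by positivity),
            Real.div_rpow (by positivity) (by positivity), Real.rpow_neg zero_le_two, div_inv_eq_mul]
          ring

lemma enorm_meanDeriv_sub_rpow_le (γ : Sobolev n s q) (u : RModZ) (v w : ℝ) :
    ‖meanDeriv γ u v - meanDeriv γ u w‖ₑ ^ q ≤ ∫⁻ θ in Ioc (0 : ℝ) 1,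
      ‖contDeriv γ (u + ((θ * v : ℝ) : RModZ)) - contDeriv γ (u + ((θ * w : ℝ) : RModZ))‖ₑ ^ q := by
  have hq1 := hq.out
  have : IsProbabilityMeasure ((volume : Measure ℝ).restrict (Ioc 0 1)) := ⟨by simp⟩
  have hc := (contDeriv γ).continuous
  rw [meanDeriv, meanDeriv, ← intervalIntegral.integral_sub
    (Continuous.intervalIntegrable (by fun_prop) _ _)
    (Continuous.intervalIntegrable (by fun_prop) _ _), intervalIntegral.integral_of_le zero_le_one]
  refine le_trans ?_ (rpow_lintegral_le hq1 ?_)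
  · gcongr
    exact enorm_integral_le_lintegral_enorm _
  · have : Continuous fun θ : ℝ => contDeriv γ (u + ((θ * v : ℝ) : RModZ))
      - contDeriv γ (u + ((θ * w : ℝ) : RModZ)) := by fun_prop
    exact this.enorm.measurable.aemeasurable

/-- Raising the pointwise bound to the power q turns its weights into |w|^(q-p)|r|^(q-2p). The sum
costs 2^(q-1) by convexity, and Jensen in θ replaces mean derivatives by derivatives. -/
lemma enorm_areaQuot_rpow_le {p : ℝ} (hp : 0 < p) (hs : 1 / q < s) (γ η : Sobolev n s q) (u : RModZ)
    {w r : ℝ} (hw : |w| ≤ 1 / 2) (hr : |r| ≤ 1 / 2)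
    (hx : (u, u + (w : RModZ) + (r : RModZ), u + (w : RModZ)) ∈ shortSide) :
    ‖areaQuot p q γ η (u, u + (w : RModZ) + (r : RModZ), u + (w : RModZ))‖ₑ ^ q ≤
      ENNReal.ofReal ((2 * 2 ^ (p / q)) ^ q) * 2 ^ (q - 1) *
      (‖contDeriv η‖ₑ ^ q * (areaKernel p q w r * ∫⁻ θ in Ioc (0 : ℝ) 1,
        ‖contDeriv γ (u + ((θ * (w + r) : ℝ) : RModZ))
          - contDeriv γ (u + ((θ * w : ℝ) : RModZ))‖ₑ ^ q)
      + ‖contDeriv γ‖ₑ ^ q * (areaKernel p q w r * ∫⁻ θ in Ioc (0 : ℝ) 1,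
        ‖contDeriv η (u + ((θ * (w + r) : ℝ) : RModZ))
          - contDeriv η (u + ((θ * w : ℝ) : RModZ))‖ₑ ^ q)) := by
  have hq1 := hq.out
  have hq0 : 0 < q := by linarith
  obtain ⟨hwr, hle⟩ := norm_areaQuot_le hp hs γ η u hw hr hx
  set c := 2 * 2 ^ (p / q) * (|w| ^ (1 - p / q) * |r| ^ (1 - 2 * (p / q))) with hc
  have hc0 : 0 ≤ c := by positivity
  have h1 : ‖areaQuot p q γ η (u, u + (w : RModZ) + (r : RModZ), u + (w : RModZ))‖ₑ ≤
      ENNReal.ofReal c * (‖meanDeriv γ u (w + r) - meanDeriv γ u w‖ₑ * ‖contDeriv η‖ₑ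
        + ‖meanDeriv η u (w + r) - meanDeriv η u w‖ₑ * ‖contDeriv γ‖ₑ) := by
    rw [← ofReal_norm]
    refine (ENNReal.ofReal_le_ofReal hle).trans_eq ?_
    rw [ENNReal.ofReal_mul hc0, ENNReal.ofReal_add (by positivity) (by positivity),
      ENNReal.ofReal_mul (norm_nonneg _), ENNReal.ofReal_mul (norm_nonneg _)]
    simp only [ofReal_norm]
  have hcq : ENNReal.ofReal c ^ q = ENNReal.ofReal ((2 * 2 ^ (p / q)) ^ q) * areaKernel p q w r := by
    have hmem : w ∈ {w : ℝ | |w| ≤ |r|} := hwr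
    rw [areaKernel, indicator_of_mem hmem, ENNReal.ofReal_rpow_of_nonneg hc0 hq0.le,
      ← ENNReal.ofReal_mul (by positivity), ← ENNReal.ofReal_mul (by positivity), hc,
      Real.mul_rpow (by positivity) (by positivity),
      Real.mul_rpow (x := |w| ^ (1 - p / q)) (by positivity) (by positivity),
      ← Real.rpow_mul (abs_nonneg _), ← Real.rpow_mul (abs_nonneg _)]
    congr 3
    · congr 1; field_simp
    · congr 1; field_simp
  calc ‖areaQuot p q γ η (u, u + (w : RModZ) + (r : RModZ), u + (w : RModZ))‖ₑ ^ q
      ≤ (ENNReal.ofReal c * (‖meanDeriv γ u (w + r) - meanDeriv γ u w‖ₑ * ‖contDeriv η‖ₑ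
        + ‖meanDeriv η u (w + r) - meanDeriv η u w‖ₑ * ‖contDeriv γ‖ₑ)) ^ q := by gcongr
    _ ≤ ENNReal.ofReal c ^ q * (2 ^ (q - 1) *
        ((‖meanDeriv γ u (w + r) - meanDeriv γ u w‖ₑ * ‖contDeriv η‖ₑ) ^ q
        + (‖meanDeriv η u (w + r) - meanDeriv η u w‖ₑ * ‖contDeriv γ‖ₑ) ^ q)) := by
        rw [ENNReal.mul_rpow_of_nonneg _ _ hq0.le]
        gcongr
        exact ENNReal.rpow_add_le_mul_rpow_add_rpow _ _ hq1.le
    _ ≤ ENNReal.ofReal c ^ q * (2 ^ (q - 1) *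
        ((∫⁻ θ in Ioc (0 : ℝ) 1, ‖contDeriv γ (u + ((θ * (w + r) : ℝ) : RModZ))
          - contDeriv γ (u + ((θ * w : ℝ) : RModZ))‖ₑ ^ q) * ‖contDeriv η‖ₑ ^ q
        + (∫⁻ θ in Ioc (0 : ℝ) 1, ‖contDeriv η (u + ((θ * (w + r) : ℝ) : RModZ))
          - contDeriv η (u + ((θ * w : ℝ) : RModZ))‖ₑ ^ q) * ‖contDeriv γ‖ₑ ^ q)) := by
        rw [ENNReal.mul_rpow_of_nonneg _ _ hq0.le, ENNReal.mul_rpow_of_nonneg _ _ hq0.le]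
        gcongr
        · exact enorm_meanDeriv_sub_rpow_le γ u (w + r) w
        · exact enorm_meanDeriv_sub_rpow_le η u (w + r) w
    _ = _ := by
        rw [hcq]
        ring

lemma measurable_areaQuot (p : ℝ) (γ η : Sobolev n s q) :
    Measurable fun x => ‖areaQuot p q γ η x‖ₑ ^ q := by
  have h1 := γ.continuous
  have h2 := η.continuous
  have h3 := continuous_distProd
  have hA : Continuous (polarArea γ η) := by
    unfold polarArea
    simp only [← wedgeL_apply]
    fun_prop
  simp only [areaQuot, enorm_smul]
  have := hA.enorm.measurable
  have := h3.measurable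
  fun_prop

lemma lintegral_areaQuot_le {p : ℝ} (hp : 0 < p) (hs : 1 / q < s)
    (hqs : q * s = 3 * p - 2 - 2 * q) (hpq : p < q + 1) (γ η : Sobolev n s q) :
    ∫⁻ x, ‖areaQuot p q γ η x‖ₑ ^ q ≤
      3 * (ENNReal.ofReal ((2 * 2 ^ (p / q)) ^ q) * 2 ^ (q - 1)
        * ENNReal.ofReal (2 / (q - p + 1))) *
      (‖contDeriv η‖ₑ ^ q * slobodeckij s q (contDeriv γ)
        + ‖contDeriv γ‖ₑ ^ q * slobodeckij s q (contDeriv η)) := by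
  have hq1 := hq.out
  have hs0 : 0 < s := lt_trans (by positivity) hs
  have hm := measurable_areaQuot p γ η
  set C := ENNReal.ofReal ((2 * 2 ^ (p / q)) ^ q) * (2 : ℝ≥0∞) ^ (q - 1) with hC
  have hCtop : C ≠ ⊤ := ENNReal.mul_ne_top (by simp) (by simp)
  set I := Ioc (-1 / 2 : ℝ) (1 / 2) with hI
  have habs : ∀ w ∈ I, |w| ≤ 1 / 2 := fun w hw => abs_le.2 ⟨by linarith [hw.1], hw.2⟩
  set Q : Sobolev n s q → RModZ → ℝ → ℝ → ℝ≥0∞ := fun γ u w r =>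
    areaKernel p q w r * ∫⁻ θ in Ioc (0 : ℝ) 1, ‖contDeriv γ (u + ((θ * (w + r) : ℝ) : RModZ))
      - contDeriv γ (u + ((θ * w : ℝ) : RModZ))‖ₑ ^ q with hQ
  have hQm : ∀ γ : Sobolev n s q, Measurable fun z : (RModZ × ℝ) × ℝ => Q γ z.1.1 z.1.2 z.2 := by
    intro γ
    have hc := (contDeriv γ).continuous.measurable
    refine Measurable.mul ((measurable_areaKernel p q).comp
      (by fun_prop : Measurable fun z : (RModZ × ℝ) × ℝ => (z.1.2, z.2))) ?_
    exact Measurable.lintegral_prod_right' (f := fun z : ((RModZ × ℝ) × ℝ) × ℝ =>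
      ‖contDeriv γ (z.1.1.1 + ((z.2 * (z.1.1.2 + z.1.2) : ℝ) : RModZ))
        - contDeriv γ (z.1.1.1 + ((z.2 * z.1.1.2 : ℝ) : RModZ))‖ₑ ^ q) (by fun_prop)
  have hQm₂ : ∀ γ : Sobolev n s q, Measurable fun z : RModZ × ℝ => ∫⁻ r in I, Q γ z.1 z.2 r :=
    fun γ => Measurable.lintegral_prod_right' (hQm γ)
  have hQm₁ : ∀ γ : Sobolev n s q, Measurable fun u : RModZ => ∫⁻ w in I, ∫⁻ r in I, Q γ u w r :=
    fun γ => Measurable.lintegral_prod_right' (hQm₂ γ)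
  have hmain : ∀ γ : Sobolev n s q, ∫⁻ u : RModZ, ∫⁻ w in I, ∫⁻ r in I, Q γ u w r
      ≤ ENNReal.ofReal (2 / (q - p + 1)) * slobodeckij s q (contDeriv γ) := fun γ =>
    lintegral_areaKernel_mul_le hq1 hqs hs0 hpq (contDeriv γ).continuous
  have hη : ‖contDeriv η‖ₑ ^ q ≠ ⊤ := by
    exact ENNReal.rpow_ne_top_of_nonneg (by linarith) enorm_ne_top
  have hγ : ‖contDeriv γ‖ₑ ^ q ≠ ⊤ := by
    exact ENNReal.rpow_ne_top_of_nonneg (by linarith) enorm_ne_top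
  refine (lintegral_le_of_cyc hm fun x => by rw [areaQuot_cyc]).trans ?_
  rw [mul_assoc]
  gcongr
  rw [← lintegral_indicator measurableSet_shortSide,
    lintegral_triple_eq (hm.indicator measurableSet_shortSide)]
  calc ∫⁻ u : RModZ, ∫⁻ w in I, ∫⁻ r in I,
        shortSide.indicator (fun x => ‖areaQuot p q γ η x‖ₑ ^ q)
          (u, u + (w : RModZ) + (r : RModZ), u + (w : RModZ))
      ≤ ∫⁻ u : RModZ, ∫⁻ w in I, ∫⁻ r in I,
        C * (‖contDeriv η‖ₑ ^ q * Q γ u w r + ‖contDeriv γ‖ₑ ^ q * Q η u w r) := by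
        refine lintegral_mono fun u => setLIntegral_mono' measurableSet_Ioc fun w hw =>
          setLIntegral_mono' measurableSet_Ioc fun r hr => ?_
        by_cases hx : (u, u + (w : RModZ) + (r : RModZ), u + (w : RModZ)) ∈ shortSide
        · rw [indicator_of_mem hx]
          exact enorm_areaQuot_rpow_le hp hs γ η u (habs w hw) (habs r hr) hx
        · rw [indicator_of_notMem hx]
          exact zero_le
    _ = C * (‖contDeriv η‖ₑ ^ q * (∫⁻ u : RModZ, ∫⁻ w in I, ∫⁻ r in I, Q γ u w r)
          + ‖contDeriv γ‖ₑ ^ q * ∫⁻ u : RModZ, ∫⁻ w in I, ∫⁻ r in I, Q η u w r) := by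
        have m1 : ∀ (γ : Sobolev n s q) u w, Measurable fun r => Q γ u w r := fun γ u w =>
          (hQm γ).comp (by fun_prop : Measurable fun r : ℝ => ((u, w), r))
        have m2 : ∀ (γ : Sobolev n s q) u, Measurable fun w => ∫⁻ r in I, Q γ u w r := fun γ u =>
          (hQm₂ γ).comp (by fun_prop : Measurable fun w : ℝ => (u, w))
        simp only [lintegral_const_mul' _ _ hCtop, lintegral_add_left ((m1 γ _ _).const_mul _),
          lintegral_const_mul' _ _ hη, lintegral_const_mul' _ _ hγ,
          lintegral_add_left ((m2 γ _).const_mul _), lintegral_add_left ((hQm₁ γ).const_mul _)]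
    _ ≤ C * (‖contDeriv η‖ₑ ^ q *
          (ENNReal.ofReal (2 / (q - p + 1)) * slobodeckij s q (contDeriv γ))
          + ‖contDeriv γ‖ₑ ^ q *
          (ENNReal.ofReal (2 / (q - p + 1)) * slobodeckij s q (contDeriv η))) := by
        gcongr
        · exact hmain γ
        · exact hmain η
    _ = _ := by ring

lemma slobodeckij_contDeriv_le (hs : 1 / q < s) (γ : Sobolev n s q) :
    slobodeckij s q (contDeriv γ) ≤ ENNReal.ofReal ‖γ‖ ^ q := by
  have hq1 := hq.out
  have hae : diffQuot s q (contDeriv γ) =ᵐ[slobodeckijMeasure] diffQuot s q ⇑γ.deriv := by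
    filter_upwards [quasi_add.ae (contDeriv_ae hs γ), quasi_snd.ae (contDeriv_ae hs γ)]
      with z h1 h2
    simp only [diffQuot, h1, h2]
  rw [slobodeckij_eq hq1 (contDeriv γ).continuous.stronglyMeasurable, eLpNorm_congr_ae hae,
    ← ENNReal.ofReal_toReal γ.memLp_diffQuot.2.ne]
  gcongr
  rw [Sobolev.norm_def]
  have h1 : 0 ≤ (eLpNorm ⇑γ (ENNReal.ofReal q) volume).toReal := ENNReal.toReal_nonneg
  have h2 : 0 ≤ (eLpNorm ⇑γ.deriv (ENNReal.ofReal q) volume).toReal := ENNReal.toReal_nonneg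
  linarith

lemma exists_lintegral_areaQuot_le (n : ℕ) {p : ℝ} (hp : 0 < p) (hs : 1 / q < s)
    (hqs : q * s = 3 * p - 2 - 2 * q) (hpq : p < q + 1) : ∃ C, 0 ≤ C ∧ ∀ γ η : Sobolev n s q,
      ∫⁻ x, ‖areaQuot p q γ η x‖ₑ ^ q ≤ ENNReal.ofReal (C * ‖γ‖ * ‖η‖) ^ q := by
  have hq1 := hq.out
  have hq0 : 0 < q := by linarith
  obtain ⟨K, hK0, hK⟩ := exists_norm_contDeriv_le n hs
  set C₀ : ℝ≥0∞ := 3 * (ENNReal.ofReal ((2 * 2 ^ (p / q)) ^ q) * 2 ^ (q - 1)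
        * ENNReal.ofReal (2 / (q - p + 1))) with hC₀
  have hC₀top : C₀ ≠ ⊤ := ENNReal.mul_ne_top (by simp)
    (ENNReal.mul_ne_top (ENNReal.mul_ne_top (by simp) (by simp)) (by simp))
  -- A q-th root of C₀ times the number of summands, each of which is at most (K‖γ‖‖η‖)^q.
  set C₁ := (C₀ * 2).toReal ^ (1 / q) with hC₁
  have hC₁q : ENNReal.ofReal C₁ ^ q = C₀ * 2 := by
    rw [hC₁, ENNReal.ofReal_rpow_of_nonneg (by positivity) hq0.le,
      ← Real.rpow_mul ENNReal.toReal_nonneg, one_div_mul_cancel hq0.ne', Real.rpow_one,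
      ENNReal.ofReal_toReal (ENNReal.mul_ne_top hC₀top (by simp))]
  refine ⟨C₁ * K, by positivity, fun γ η => (lintegral_areaQuot_le hp hs hqs hpq γ η).trans ?_⟩
  have hG : ∀ γ : Sobolev n s q, ‖contDeriv γ‖ₑ ≤ ENNReal.ofReal K * ENNReal.ofReal ‖γ‖ := by
    intro γ
    rw [← ofReal_norm, ← ENNReal.ofReal_mul hK0]
    exact ENNReal.ofReal_le_ofReal (hK γ)
  calc C₀ * (‖contDeriv η‖ₑ ^ q * slobodeckij s q (contDeriv γ)
        + ‖contDeriv γ‖ₑ ^ q * slobodeckij s q (contDeriv η))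
      ≤ C₀ * ((ENNReal.ofReal K * ENNReal.ofReal ‖η‖) ^ q * ENNReal.ofReal ‖γ‖ ^ q
        + (ENNReal.ofReal K * ENNReal.ofReal ‖γ‖) ^ q * ENNReal.ofReal ‖η‖ ^ q) := by
        gcongr
        · exact hG η
        · exact slobodeckij_contDeriv_le hs γ
        · exact hG γ
        · exact slobodeckij_contDeriv_le hs η
    _ = _ := by
        rw [ENNReal.ofReal_mul (by positivity), ENNReal.ofReal_mul (by positivity),
          ENNReal.ofReal_mul (by positivity), ENNReal.mul_rpow_of_nonneg _ _ hq0.le,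
          ENNReal.mul_rpow_of_nonneg _ _ hq0.le, ENNReal.mul_rpow_of_nonneg _ _ hq0.le,
          ENNReal.mul_rpow_of_nonneg _ _ hq0.le, ENNReal.mul_rpow_of_nonneg _ _ hq0.le, hC₁q]
        ring

/-! ### Triples of distinct parameters -/

/-- The triples of mutually distinct parameters. -/
def distinct : Set Triple := {x | x.2.1 ≠ x.2.2 ∧ x.2.1 ≠ x.1 ∧ x.2.2 ≠ x.1}

lemma isOpen_distinct : IsOpen distinct := by
  have h1 : IsOpen {x : Triple | x.2.1 ≠ x.2.2} := isOpen_ne_fun (by fun_prop) (by fun_prop)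
  have h2 : IsOpen {x : Triple | x.2.1 ≠ x.1} := isOpen_ne_fun (by fun_prop) (by fun_prop)
  have h3 : IsOpen {x : Triple | x.2.2 ≠ x.1} := isOpen_ne_fun (by fun_prop) (by fun_prop)
  exact h1.inter (h2.inter h3)

lemma measurableSet_distinct : MeasurableSet distinct := isOpen_distinct.measurableSet

lemma distProd_pos {x : Triple} (hx : x ∈ distinct) : 0 < distProd x := by
  have h1 := norm_pos_iff.2 (sub_ne_zero.2 hx.1)
  have h2 := norm_pos_iff.2 (sub_ne_zero.2 hx.2.1)
  have h3 := norm_pos_iff.2 (sub_ne_zero.2 hx.2.2)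
  unfold distProd
  positivity

/-- The measure on the triples of distinct parameters. -/
def distinctMeasure : Measure distinct := Measure.comap Subtype.val volume

instance : IsFiniteMeasure distinctMeasure := by
  refine ⟨?_⟩
  rw [distinctMeasure, (MeasurableEmbedding.subtype_coe measurableSet_distinct).comap_apply]
  exact measure_lt_top _ _

/-- The algebra of bounded continuous functions on the triples of distinct parameters. -/
abbrev BddFun := BoundedContinuousFunction distinct ℝ

/-! ### Logarithms in the algebra of bounded continuous functions -/

section Log

/-- Evaluation of a bounded continuous function as a ring homomorphism. -/
def evalHom (x : distinct) : BddFun →+* ℝ where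
  toFun f := f x
  map_one' := rfl
  map_mul' _ _ := rfl
  map_zero' := rfl
  map_add' _ _ := rfl

/-- Evaluation at a point is a continuous ring homomorphism, hence commutes with the exponential
series. -/
lemma exp_apply (f : BddFun) (x : distinct) : NormedSpace.exp f x = Real.exp (f x) := by
  let _ : NormedAlgebra ℚ BddFun := NormedAlgebra.restrictScalars ℚ ℝ BddFun
  have h := NormedSpace.map_exp (evalHom x)
    (BoundedContinuousFunction.evalCLM ℝ x : BddFun →L[ℝ] ℝ).continuous f
  rw [Real.exp_eq_exp_ℝ]
  exact h

lemma contDiff_exp_bddFun {k : ℕ∞ω} : ContDiff ℝ k (NormedSpace.exp : BddFun → BddFun) :=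
  contDiff_iff_contDiffAt.2 fun f => (NormedSpace.exp_analytic (𝕂 := ℝ) f).contDiffAt

lemma hasFDerivAt_exp_bddFun (f : BddFun) :
    HasFDerivAt NormedSpace.exp (NormedSpace.exp f • (1 : BddFun →L[ℝ] BddFun)) f :=
  hasFDerivAt_exp

/-- Multiplication by the exponential of a function, as an isomorphism. -/
def mulExp (f : BddFun) : BddFun ≃L[ℝ] BddFun :=
  ContinuousLinearEquiv.equivOfInverse (NormedSpace.exp f • (1 : BddFun →L[ℝ] BddFun))
    (NormedSpace.exp (-f) • (1 : BddFun →L[ℝ] BddFun))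
    (fun g => by
      ext x
      change NormedSpace.exp (-f) x * (NormedSpace.exp f x * g x) = g x
      rw [exp_apply, exp_apply, BoundedContinuousFunction.neg_apply, ← mul_assoc, ← Real.exp_add,
        neg_add_cancel, Real.exp_zero, one_mul])
    (fun g => by
      ext x
      change NormedSpace.exp f x * (NormedSpace.exp (-f) x * g x) = g x
      rw [exp_apply, exp_apply, BoundedContinuousFunction.neg_apply, ← mul_assoc, ← Real.exp_add,
        add_neg_cancel, Real.exp_zero, one_mul])

/-- Bounded continuous functions near one which is bounded away from zero have a logarithm which
depends smoothly on the function. -/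
lemma exists_log_bddFun {g₀ : BddFun} {c : ℝ} (hc : 0 < c) (h : ∀ x, c ≤ g₀ x) :
    ∃ Log : BddFun → BddFun, ContDiffAt ℝ 1 Log g₀ ∧
      ∀ᶠ g in 𝓝 g₀, NormedSpace.exp (Log g) = g := by
  have hpos : ∀ x, 0 < g₀ x := fun x => hc.trans_le (h x)
  -- The pointwise logarithm is bounded because c ≤ g₀ ≤ ‖g₀‖ with c > 0.
  let f₀ : BddFun := BoundedContinuousFunction.ofNormedAddCommGroup (fun x => Real.log (g₀ x))
    (g₀.continuous.log fun x => (hpos x).ne') (max |Real.log c| |Real.log (max c ‖g₀‖)|)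
    (fun x => by
      have h1 : Real.log c ≤ Real.log (g₀ x) := Real.log_le_log hc (h x)
      have h2 : Real.log (g₀ x) ≤ Real.log (max c ‖g₀‖) := Real.log_le_log (hpos x)
        ((le_abs_self _).trans ((g₀.norm_coe_le_norm x).trans (le_max_right _ _)))
      rw [Real.norm_eq_abs, abs_le]
      constructor
      · have := neg_abs_le (Real.log c)
        have := le_max_left |Real.log c| |Real.log (max c ‖g₀‖)|
        linarith
      · have := le_abs_self (Real.log (max c ‖g₀‖))
        have := le_max_right |Real.log c| |Real.log (max c ‖g₀‖)|
        linarith)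
  have hf₀ : NormedSpace.exp f₀ = g₀ := by
    ext x
    rw [exp_apply]
    exact Real.exp_log (hpos x)
  have hcd : ContDiffAt ℝ 1 (NormedSpace.exp : BddFun → BddFun) f₀ :=
    contDiff_exp_bddFun.contDiffAt
  have hd : HasFDerivAt NormedSpace.exp (mulExp f₀ : BddFun →L[ℝ] BddFun) f₀ :=
    hasFDerivAt_exp_bddFun f₀
  -- Inverse function theorem at f₀: the derivative of the exponential there is multiplication by
  -- e^f₀, inverted by multiplication by e^(-f₀).
  refine ⟨hcd.localInverse hd one_ne_zero, ?_, ?_⟩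
  · have := hcd.to_localInverse hd one_ne_zero
    rwa [hf₀] at this
  · have := (hcd.hasStrictFDerivAt' hd one_ne_zero).eventually_right_inverse
    rwa [hf₀] at this

variable {n : ℕ} {W : Type*} [NormedAddCommGroup W] [NormedSpace ℝ W]

/-- The coordinates of T are bounded linear maps into a Banach algebra, and the sum of their squares
is a polynomial in them. This is why the square of the norm is used. -/
lemma exists_contDiff_norm_sq (T : W →ₗ[ℝ] distinct → E n) (hT : ∀ γ, Continuous (T γ)) {C : ℝ}
    (hC0 : 0 ≤ C) (hC : ∀ γ x, ‖T γ x‖ ≤ C * ‖γ‖) :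
    ∃ R : W → BddFun, ContDiff ℝ 1 R ∧ ∀ γ x, R γ x = ‖T γ x‖ ^ 2 := by
  have hcoord : ∀ (v : E n) i, ‖v i‖ ≤ ‖v‖ := fun v i => PiLp.norm_apply_le v i
  let L : Fin n → W →L[ℝ] BddFun := fun i => LinearMap.mkContinuous
    { toFun := fun γ => BoundedContinuousFunction.ofNormedAddCommGroup (fun x => T γ x i)
        (by have := hT γ; fun_prop) (C * ‖γ‖) (fun x => (hcoord _ _).trans (hC γ x))
      map_add' := fun γ η => by ext x; simp
      map_smul' := fun t γ => by ext x; simp } C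
    (fun γ => BoundedContinuousFunction.norm_ofNormedAddCommGroup_le _ (by positivity)
      fun x => (hcoord _ _).trans (hC γ x))
  refine ⟨fun γ => ∑ i, L i γ ^ 2, by fun_prop, fun γ x => ?_⟩
  have h1 : (∑ i, L i γ ^ 2) x = ∑ i, (L i γ x) ^ 2 := by
    have := map_sum (evalHom x) (fun i => L i γ ^ 2) Finset.univ
    exact this
  rw [h1, EuclideanSpace.real_norm_sq_eq]
  rfl

/-- The logarithm of `‖T γ‖ ^ 2` as a bounded continuous function, for `γ` near `γ₀`. -/
lemma exists_log_norm_sq (T : W →ₗ[ℝ] distinct → E n) (hT : ∀ γ, Continuous (T γ)) {C : ℝ}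
    (hC0 : 0 ≤ C) (hC : ∀ γ x, ‖T γ x‖ ≤ C * ‖γ‖) {c : ℝ} (hc : 0 < c) {γ₀ : W}
    (hγ₀ : ∀ x, c ≤ ‖T γ₀ x‖) :
    ∃ Λ : W → BddFun, ContDiffAt ℝ 1 Λ γ₀ ∧
      (∀ᶠ γ in 𝓝 γ₀, ∀ x, Real.exp (Λ γ x) = ‖T γ x‖ ^ 2) ∧
      ∀ h x, fderiv ℝ Λ γ₀ h x = 2 * ⟪T γ₀ x, T h x⟫ / ‖T γ₀ x‖ ^ 2 := by
  obtain ⟨R, hR, hRx⟩ := exists_contDiff_norm_sq T hT hC0 hC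
  obtain ⟨Log, hLog, hexp⟩ := exists_log_bddFun (g₀ := R γ₀) (c := c ^ 2) (by positivity)
    fun x => by rw [hRx]; gcongr; exact hγ₀ x
  have hΛ : ContDiffAt ℝ 1 (fun γ => Log (R γ)) γ₀ := hLog.comp γ₀ hR.contDiffAt
  have hev : ∀ᶠ γ in 𝓝 γ₀, ∀ x, Real.exp (Log (R γ) x) = ‖T γ x‖ ^ 2 := by
    filter_upwards [hR.continuous.continuousAt.eventually hexp] with γ hγ x
    rw [← exp_apply, hγ, hRx]
  refine ⟨fun γ => Log (R γ), hΛ, hev, fun h x => ?_⟩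
  have hd := (hΛ.differentiableAt one_ne_zero).hasFDerivAt
  set L := fderiv ℝ (fun γ => Log (R γ)) γ₀ with hL
  -- The local inverse is not explicit. Its derivative is read off by differentiating exp Λ = ‖T γ‖²
  -- at a fixed point x along a line through γ₀.
  have hline : HasDerivAt (fun τ : ℝ => γ₀ + τ • h) h 0 := by
    simpa using ((hasDerivAt_id (0 : ℝ)).smul_const h).const_add γ₀
  have hd' : HasFDerivAt (fun γ => Log (R γ)) L (γ₀ + (0 : ℝ) • h) := by simpa using hd
  have h0 : HasDerivAt (fun τ : ℝ => Log (R (γ₀ + τ • h))) (L h) 0 :=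
    HasFDerivAt.comp_hasDerivAt (l := fun γ => Log (R γ)) (l' := L) (0 : ℝ) hd' hline
  have h1 : HasDerivAt (fun τ : ℝ => Log (R (γ₀ + τ • h)) x) (L h x) 0 :=
    (BoundedContinuousFunction.evalCLM ℝ x : BddFun →L[ℝ] ℝ).hasFDerivAt.comp_hasDerivAt (0 : ℝ) h0
  have h2 := h1.exp
  have h3 : HasDerivAt (fun τ : ℝ => ‖T γ₀ x + τ • T h x‖ ^ 2) (2 * ⟪T γ₀ x, T h x⟫) 0 := by
    have hl : HasDerivAt (fun τ : ℝ => T γ₀ x + τ • T h x) (T h x) 0 := by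
      simpa using ((hasDerivAt_id (0 : ℝ)).smul_const (T h x)).const_add (T γ₀ x)
    simpa using hl.norm_sq
  have htend : Tendsto (fun τ : ℝ => γ₀ + τ • h) (𝓝 0) (𝓝 γ₀) := by
    simpa using hline.continuousAt.tendsto
  have h4 : (fun τ : ℝ => Real.exp (Log (R (γ₀ + τ • h)) x)) =ᶠ[𝓝 0]
      fun τ : ℝ => ‖T γ₀ x + τ • T h x‖ ^ 2 := by
    filter_upwards [htend.eventually hev] with τ hτ
    rw [hτ x, map_add, map_smul]
    rfl
  have h5 := (h2.congr_of_eventuallyEq h4.symm).unique h3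
  have h6 := hev.self_of_nhds x
  rw [zero_smul, add_zero, h6] at h5
  have h7 : ‖T γ₀ x‖ ^ 2 ≠ 0 := by
    have := hc.trans_le (hγ₀ x)
    positivity
  rw [eq_div_iff h7, mul_comm]
  exact h5

end Log

/-! ### Bilinearity of the normalized area -/

section Bilinear

variable {n : ℕ}

lemma polarArea_add_left (f₁ f₂ g : RModZ → E n) (x : Triple) :
    polarArea (f₁ + f₂) g x = polarArea f₁ g x + polarArea f₂ g x := by
  simp only [polarArea, Pi.add_apply, add_sub_add_comm, wedge_add_left, wedge_add_right]
  abel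

lemma polarArea_smul_left (t : ℝ) (f g : RModZ → E n) (x : Triple) :
    polarArea (t • f) g x = t • polarArea f g x := by
  simp only [polarArea, Pi.smul_apply, ← smul_sub, wedge_smul_left, wedge_smul_right, smul_add]

lemma polarArea_comm (f g : RModZ → E n) (x : Triple) : polarArea f g x = polarArea g f x := by
  rw [polarArea, polarArea, add_comm]

lemma areaQuot_add_left (p q : ℝ) (f₁ f₂ g : RModZ → E n) (x : Triple) :
    areaQuot p q (f₁ + f₂) g x = areaQuot p q f₁ g x + areaQuot p q f₂ g x := by
  simp only [areaQuot, polarArea_add_left, smul_add]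

lemma areaQuot_smul_left (p q t : ℝ) (f g : RModZ → E n) (x : Triple) :
    areaQuot p q (t • f) g x = t • areaQuot p q f g x := by
  simp only [areaQuot, polarArea_smul_left]
  rw [smul_comm]

lemma areaQuot_comm (p q : ℝ) (f g : RModZ → E n) (x : Triple) :
    areaQuot p q f g x = areaQuot p q g f x := by
  simp only [areaQuot, polarArea_comm f g]

end Bilinear

/-! ### The normalized area as an element of `L^q` -/

section Algebra

variable {n : ℕ} {q : ℝ} [hq : Fact (1 < q)]

instance factOneLeOfReal : Fact (1 ≤ ENNReal.ofReal q) := ⟨by simpa using hq.out.le⟩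

variable {s : ℝ}

lemma lintegral_distinct (f : Triple → ℝ≥0∞) :
    ∫⁻ x, f x ∂distinctMeasure = ∫⁻ x in distinct, f x :=
  lintegral_subtype_comap measurableSet_distinct f

lemma continuous_areaQuot_distinct (p : ℝ) (γ η : Sobolev n s q) :
    Continuous fun x : distinct => areaQuot p q γ η x := by
  have h1 := γ.continuous
  have h2 := η.continuous
  have hA : Continuous fun x : distinct => polarArea γ η x := by
    unfold polarArea
    simp only [← wedgeL_apply]
    fun_prop
  exact ((continuous_distProd.comp continuous_subtype_val).rpow_const fun x =>
    Or.inl (distProd_pos x.2).ne').smul hA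

lemma exists_eLpNorm_areaQuot_le (n : ℕ) {p : ℝ} (hp : 0 < p) (hs : 1 / q < s)
    (hqs : q * s = 3 * p - 2 - 2 * q) (hpq : p < q + 1) : ∃ C, 0 ≤ C ∧ ∀ γ η : Sobolev n s q,
      eLpNorm (fun x : distinct => areaQuot p q γ η x) (ENNReal.ofReal q) distinctMeasure
        ≤ ENNReal.ofReal (C * ‖γ‖ * ‖η‖) := by
  have hq1 := hq.out
  have hq0 : 0 < q := by linarith
  obtain ⟨C, hC0, hC⟩ := exists_lintegral_areaQuot_le n hp hs hqs hpq
  refine ⟨C, hC0, fun γ η => ?_⟩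
  rw [eLpNorm_eq_lintegral_rpow_enorm_toReal (by simpa using hq0) (by simp),
    ENNReal.toReal_ofReal hq0.le, one_div, ENNReal.rpow_inv_le_iff hq0,
    lintegral_distinct fun x => ‖areaQuot p q γ η x‖ₑ ^ q]
  exact (setLIntegral_le_lintegral _ _).trans (hC γ η)

lemma memLp_areaQuot {p : ℝ} (hp : 0 < p) (hs : 1 / q < s)
    (hqs : q * s = 3 * p - 2 - 2 * q) (hpq : p < q + 1) (γ η : Sobolev n s q) :
    MemLp (fun x : distinct => areaQuot p q γ η x) (ENNReal.ofReal q) distinctMeasure := by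
  obtain ⟨C, -, hC⟩ := exists_eLpNorm_areaQuot_le n hp hs hqs hpq
  exact ⟨(continuous_areaQuot_distinct p γ η).aestronglyMeasurable,
    (hC γ η).trans_lt ENNReal.ofReal_lt_top⟩

end Algebra

/-! ### The energy density -/

section Exponential

variable {W G : Type*} [NormedAddCommGroup W] [NormedSpace ℝ W] [NormedAddCommGroup G]
  [NormedSpace ℝ G]

lemma contDiffAt_mul_exp {Λ : W → BddFun} {γ : W} (hΛ : ContDiffAt ℝ 1 Λ γ)
    (M : BddFun →L[ℝ] G →L[ℝ] G) (B : W →L[ℝ] W →L[ℝ] G) :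
    ContDiffAt ℝ 1 (fun η => M (NormedSpace.exp (Λ η)) ((1 / 2 : ℝ) • B η η)) γ := by
  have h1 : ContDiffAt ℝ 1 (fun η => M (NormedSpace.exp (Λ η))) γ :=
    M.contDiff.contDiffAt.comp γ
      ((contDiff_exp_bddFun (k := 1)).contDiffAt.comp γ hΛ)
  have h2 : ContDiffAt ℝ 1 (fun η => (1 / 2 : ℝ) • B η η) γ :=
    ((B.contDiff.contDiffAt (x := γ)).clm_apply contDiffAt_id).const_smul (1 / 2 : ℝ)
  exact h1.clm_apply h2

lemma hasDerivAt_mul_exp {Λ : W → BddFun} {γ : W} (hΛ : DifferentiableAt ℝ Λ γ)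
    (M : BddFun →L[ℝ] G →L[ℝ] G) (B : W →L[ℝ] W →L[ℝ] G) 
    (hB : ∀ η ζ, B η ζ = B ζ η) (h : W) :
    HasDerivAt (fun τ : ℝ => M (NormedSpace.exp (Λ (γ + τ • h)))
        ((1 / 2 : ℝ) • B (γ + τ • h) (γ + τ • h)))
      (M (NormedSpace.exp (Λ γ) * fderiv ℝ Λ γ h) ((1 / 2 : ℝ) • B γ γ)
        + M (NormedSpace.exp (Λ γ)) (B γ h)) 0 := by
  have e0 : γ + (0 : ℝ) • h = γ := by rw [zero_smul, add_zero]
  have hline : HasDerivAt (fun τ : ℝ => γ + τ • h) h 0 := by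
    simpa using ((hasDerivAt_id (0 : ℝ)).smul_const h).const_add γ
  have hd : HasFDerivAt Λ (fderiv ℝ Λ γ) (γ + (0 : ℝ) • h) := by
    rw [e0]
    exact hΛ.hasFDerivAt
  have h1 : HasDerivAt (fun τ : ℝ => Λ (γ + τ • h)) (fderiv ℝ Λ γ h) 0 :=
    HasFDerivAt.comp_hasDerivAt (l := Λ) (l' := fderiv ℝ Λ γ) (0 : ℝ) hd hline
  have hexp : HasFDerivAt NormedSpace.exp (NormedSpace.exp (Λ γ) • (1 : BddFun →L[ℝ] BddFun))
      (Λ (γ + (0 : ℝ) • h)) := by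
    rw [e0]
    exact hasFDerivAt_exp_bddFun _
  have h2 : HasDerivAt (fun τ : ℝ => NormedSpace.exp (Λ (γ + τ • h)))
      (NormedSpace.exp (Λ γ) * fderiv ℝ Λ γ h) 0 :=
    HasFDerivAt.comp_hasDerivAt (l := NormedSpace.exp)
      (l' := NormedSpace.exp (Λ γ) • (1 : BddFun →L[ℝ] BddFun)) (0 : ℝ) hexp h1
  have h3 : HasDerivAt (fun τ : ℝ => M (NormedSpace.exp (Λ (γ + τ • h))))
      (M (NormedSpace.exp (Λ γ) * fderiv ℝ Λ γ h)) 0 :=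
    M.hasFDerivAt.comp_hasDerivAt (0 : ℝ) h2
  have h4 : HasDerivAt (fun τ : ℝ => B (γ + τ • h)) (B h) 0 :=
    B.hasFDerivAt.comp_hasDerivAt (0 : ℝ) hline
  have h5 := (h4.clm_apply hline).const_smul (1 / 2 : ℝ)
  have h6 := h3.clm_apply h5
  -- Symmetry of B cancels the factor 1/2 of the quadratic form.
  have e1 : (1 / 2 : ℝ) • (B h γ + B γ h) = B γ h := by
    rw [hB h γ, ← two_smul ℝ, smul_smul]
    norm_num
  simp only [Pi.smul_apply, e0, e1] at h6
  exact h6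

/-- A bounded symmetric map which is linear in its first argument is a continuous bilinear map. -/
lemma exists_continuousBilinear {V G : Type*} [NormedAddCommGroup V] [NormedSpace ℝ V]
    [NormedAddCommGroup G] [NormedSpace ℝ G] (f : V → V → G)
    (hadd : ∀ x y z, f (x + y) z = f x z + f y z) (hsmul : ∀ (t : ℝ) x y, f (t • x) y = t • f x y)
    (hcomm : ∀ x y, f x y = f y x) (C : ℝ) (hC : ∀ x y, ‖f x y‖ ≤ C * ‖x‖ * ‖y‖) :
    ∃ B : V →L[ℝ] V →L[ℝ] G, ∀ x y, B x y = f x y := by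
  let B₀ : V →ₗ[ℝ] V →ₗ[ℝ] G := LinearMap.mk₂ ℝ f hadd hsmul
    (fun x y z => by rw [hcomm, hadd, hcomm y, hcomm z])
    (fun t x y => by rw [hcomm, hsmul, hcomm y])
  exact ⟨LinearMap.mkContinuous₂ B₀ C hC, fun x y => rfl⟩

variable {F : Type*} [NormedAddCommGroup F] [InnerProductSpace ℝ F] {q : ℝ} [hq : Fact (1 < q)]

/-- Multiplication of an `L^q`-function by a bounded continuous function. -/
def mulLp (F : Type*) [NormedAddCommGroup F] [InnerProductSpace ℝ F] (q : ℝ) [Fact (1 < q)] :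
    BddFun →L[ℝ] Lp F (ENNReal.ofReal q) distinctMeasure →L[ℝ]
      Lp F (ENNReal.ofReal q) distinctMeasure :=
  ((ContinuousLinearMap.lsmul ℝ ℝ : ℝ →L[ℝ] F →L[ℝ] F).holderL
    distinctMeasure ⊤ (ENNReal.ofReal q) (ENNReal.ofReal q)).comp
    (BoundedContinuousFunction.toLp ⊤ distinctMeasure ℝ)

lemma mulLp_ae (φ : BddFun) (ψ : Lp F (ENNReal.ofReal q) distinctMeasure) :
    ⇑(mulLp F q φ ψ) =ᵐ[distinctMeasure] fun x => φ x • ψ x := by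
  have h1 := BoundedContinuousFunction.coeFn_toLp ⊤ distinctMeasure ℝ φ
  have h2 := (ContinuousLinearMap.lsmul ℝ ℝ : ℝ →L[ℝ] F →L[ℝ] F).coeFn_holder
    (r := ENNReal.ofReal q) (BoundedContinuousFunction.toLp ⊤ distinctMeasure ℝ φ) ψ
  filter_upwards [h1, h2] with x hx1 hx2
  refine Eq.trans hx2 ?_
  rw [hx1]
  rfl

/-- A bounded symmetric bilinear form with values in `L^q`, from its values at points. -/
lemma exists_bilinear_Lp {f : W → W → distinct → F}
    (hf : ∀ γ η, MemLp (f γ η) (ENNReal.ofReal q) distinctMeasure)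
    (hadd : ∀ γ₁ γ₂ η x, f (γ₁ + γ₂) η x = f γ₁ η x + f γ₂ η x)
    (hsmul : ∀ (t : ℝ) γ η x, f (t • γ) η x = t • f γ η x) (hcomm : ∀ γ η x, f γ η x = f η γ x)
    {C : ℝ} (hC0 : 0 ≤ C) (hC : ∀ γ η, eLpNorm (f γ η) (ENNReal.ofReal q) distinctMeasure
      ≤ ENNReal.ofReal (C * ‖γ‖ * ‖η‖)) :
    ∃ B : W →L[ℝ] W →L[ℝ] Lp F (ENNReal.ofReal q) distinctMeasure,
      (∀ γ η, ⇑(B γ η) =ᵐ[distinctMeasure] f γ η) ∧ ∀ γ η, B γ η = B η γ := by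
  have hae : ∀ γ η, ⇑(hf γ η).toLp =ᵐ[distinctMeasure] f γ η := fun γ η => (hf γ η).coeFn_toLp
  obtain ⟨B, hB⟩ := exists_continuousBilinear (fun γ η => (hf γ η).toLp)
    (fun γ₁ γ₂ η => by
      refine Lp.ext ?_
      filter_upwards [hae (γ₁ + γ₂) η, hae γ₁ η, hae γ₂ η,
        Lp.coeFn_add (hf γ₁ η).toLp (hf γ₂ η).toLp] with x h1 h2 h3 h4
      rw [h1, h4, Pi.add_apply, h2, h3, hadd])
    (fun t γ η => by
      refine Lp.ext ?_
      filter_upwards [hae (t • γ) η, hae γ η, Lp.coeFn_smul t (hf γ η).toLp] with x h1 h2 h3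
      rw [h1, h3, Pi.smul_apply, h2, hsmul])
    (fun γ η => by
      refine Lp.ext ?_
      filter_upwards [hae γ η, hae η γ] with x h1 h2
      rw [h1, h2, hcomm]) C
    (fun γ η => by
      rw [Lp.norm_toLp]
      exact ENNReal.toReal_le_of_le_ofReal (by positivity) (hC γ η))
  refine ⟨B, fun γ η => by rw [hB]; exact hae γ η, fun γ η => ?_⟩
  rw [hB, hB]
  refine Lp.ext ?_
  filter_upwards [hae γ η, hae η γ] with x h1 h2
  rw [h1, h2, hcomm]

/-- The derivative of `e ^ {qΛ} |a| ^ q` for the logarithmic derivative `l` of `e ^ Λ` and the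
derivative `b` of `a`. -/
def weightedPowDeriv (q Λ l : ℝ) (a b : F) : ℝ :=
  Real.exp (q * Λ) * (q * l * ‖a‖ ^ q + q * ‖a‖ ^ (q - 2) * ⟪a, b⟫)

/-- Both summands are homogeneous of degree r in the pair (a, b). For k a power of D this lets the
distance factors in the weight and in the area cancel. -/
lemma weightedPowDeriv_smul {r k : ℝ} (hk : 0 < k) (Λ l : ℝ) (a b : F) :
    weightedPowDeriv r Λ l (k • a) (k • b)
      = Real.exp (r * Λ) * k ^ r * (r * l * ‖a‖ ^ r + r * ‖a‖ ^ (r - 2) * ⟪a, b⟫) := by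
  have e : k ^ r = k ^ (r - 2) * (k * k) := by
    rw [← pow_two, ← Real.rpow_natCast, ← Real.rpow_add hk]
    congr 1
    push_cast
    ring
  rw [weightedPowDeriv, norm_smul, Real.norm_of_nonneg hk.le, Real.mul_rpow hk.le (norm_nonneg _),
    Real.mul_rpow hk.le (norm_nonneg _), real_inner_smul_left, real_inner_smul_right, e]
  ring

lemma normPowDeriv_exp_smul (Λ l : ℝ) (a b : F) :
    normPowDeriv q (Real.exp Λ • a) ((Real.exp Λ * l) • a + Real.exp Λ • b)
      = weightedPowDeriv q Λ l a b := by
  have hq0 : q ≠ 0 := by have := hq.out; positivity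
  have e1 : Real.exp (q * Λ) = Real.exp Λ ^ (q - 1) * Real.exp Λ := by
    rw [← Real.exp_mul, ← Real.exp_add]
    congr 1
    ring
  -- Adding real exponents needs a positive base; at a = 0 both sides vanish.
  have e2 : ‖a‖ ^ q = ‖a‖ ^ (q - 2) * ‖a‖ ^ 2 := by
    rcases eq_or_ne a 0 with rfl | ha
    · simp [Real.zero_rpow hq0]
    · rw [← Real.rpow_natCast, ← Real.rpow_add (norm_pos_iff.2 ha)]
      congr 1
      push_cast
      ring
  rw [normPowDeriv_smul (Real.exp_pos Λ), _root_.smul_apply, map_add, map_smul, map_smul,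
    normPowDeriv_apply, normPowDeriv_apply, weightedPowDeriv, e1, e2, real_inner_self_eq_norm_sq]
  simp only [smul_eq_mul]
  ring

variable [ProperSpace F]

/-- Differentiability of the `q`-th power of the `L^q`-norm of `e ^ Λ · f(γ, γ) / 2`, for a bounded
symmetric bilinear form `f`. -/
lemma contDiffAt_weighted_integral {f : W → W → distinct → F}
    (hf : ∀ γ η, MemLp (f γ η) (ENNReal.ofReal q) distinctMeasure)
    (hadd : ∀ γ₁ γ₂ η x, f (γ₁ + γ₂) η x = f γ₁ η x + f γ₂ η x)
    (hsmul : ∀ (t : ℝ) γ η x, f (t • γ) η x = t • f γ η x) (hcomm : ∀ γ η x, f γ η x = f η γ x)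
    {C : ℝ} (hC0 : 0 ≤ C) (hC : ∀ γ η, eLpNorm (f γ η) (ENNReal.ofReal q) distinctMeasure
      ≤ ENNReal.ofReal (C * ‖γ‖ * ‖η‖)) {Λ : W → BddFun} {γ : W} (hΛ : ContDiffAt ℝ 1 Λ γ) :
    (∀ η, Integrable (fun x => Real.exp (q * Λ η x) * ‖(1 / 2 : ℝ) • f η η x‖ ^ q)
      distinctMeasure) ∧
    ContDiffAt ℝ 1 (fun η => ∫ x, Real.exp (q * Λ η x) * ‖(1 / 2 : ℝ) • f η η x‖ ^ q
      ∂distinctMeasure) γ ∧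
    ∀ h, Integrable (fun x => weightedPowDeriv q (Λ γ x) (fderiv ℝ Λ γ h x)
        ((1 / 2 : ℝ) • f γ γ x) (f γ h x)) distinctMeasure ∧
      HasDerivAt (fun τ : ℝ => ∫ x, Real.exp (q * Λ (γ + τ • h) x)
          * ‖(1 / 2 : ℝ) • f (γ + τ • h) (γ + τ • h) x‖ ^ q ∂distinctMeasure)
        (∫ x, weightedPowDeriv q (Λ γ x) (fderiv ℝ Λ γ h x)
          ((1 / 2 : ℝ) • f γ γ x) (f γ h x) ∂distinctMeasure) 0 := by
  obtain ⟨B, hB, hsymm⟩ := exists_bilinear_Lp hf hadd hsmul hcomm hC0 hC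
  have hhalf : ∀ η, ⇑((1 / 2 : ℝ) • B η η) =ᵐ[distinctMeasure] fun x => (1 / 2 : ℝ) • f η η x := by
    intro η
    filter_upwards [Lp.coeFn_smul (1 / 2 : ℝ) (B η η), hB η η] with x h1 h2
    rw [h1, Pi.smul_apply, h2]
  -- The integral equals ∫ ‖Ψ η‖^q, so the claims follow from the chain rule for Ψ and the q-th
  -- power of the `L^q`-norm.
  set Ψ : W → Lp F (ENNReal.ofReal q) distinctMeasure :=
    fun η => mulLp F q (NormedSpace.exp (Λ η)) ((1 / 2 : ℝ) • B η η) with hΨdef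
  have hΨ : ∀ η, ⇑(Ψ η) =ᵐ[distinctMeasure] fun x => Real.exp (Λ η x) • (1 / 2 : ℝ) • f η η x := by
    intro η
    filter_upwards [mulLp_ae (NormedSpace.exp (Λ η)) ((1 / 2 : ℝ) • B η η), hhalf η] with x h1 h2
    rw [hΨdef, h1, h2, exp_apply]
  have hnorm : ∀ η, (fun x => ‖Ψ η x‖ ^ q) =ᵐ[distinctMeasure]
      fun x => Real.exp (q * Λ η x) * ‖(1 / 2 : ℝ) • f η η x‖ ^ q := by
    intro η
    filter_upwards [hΨ η] with x hx
    rw [hx, norm_smul, Real.norm_of_nonneg (Real.exp_pos _).le,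
      Real.mul_rpow (Real.exp_pos _).le (norm_nonneg _), ← Real.exp_mul, mul_comm q]
  have hint : ∀ η, ∫ x, Real.exp (q * Λ η x) * ‖(1 / 2 : ℝ) • f η η x‖ ^ q ∂distinctMeasure
      = ∫ x, ‖Ψ η x‖ ^ q ∂distinctMeasure := fun η => (integral_congr_ae (hnorm η)).symm
  simp only [hint]
  refine ⟨fun η => (integrable_norm_rpow hq.out (Ψ η)).congr (hnorm η), ?_, fun h => ?_⟩
  · exact contDiff_integral_norm_rpow.contDiffAt.comp γ (contDiffAt_mul_exp hΛ (mulLp F q) B)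
  · have hd : HasDerivAt (fun τ : ℝ => Ψ (γ + τ • h)) _ 0 :=
      hasDerivAt_mul_exp (hΛ.differentiableAt one_ne_zero) (mulLp F q) B hsymm h
    set φ := mulLp F q (NormedSpace.exp (Λ γ) * fderiv ℝ Λ γ h) ((1 / 2 : ℝ) • B γ γ)
        + mulLp F q (NormedSpace.exp (Λ γ)) (B γ h) with hφ
    have hae : (fun x => normPowDeriv q (Ψ γ x) (φ x)) =ᵐ[distinctMeasure]
        fun x => weightedPowDeriv q (Λ γ x) (fderiv ℝ Λ γ h x)
          ((1 / 2 : ℝ) • f γ γ x) (f γ h x) := by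
      filter_upwards [hΨ γ, Lp.coeFn_add
        (mulLp F q (NormedSpace.exp (Λ γ) * fderiv ℝ Λ γ h) ((1 / 2 : ℝ) • B γ γ))
        (mulLp F q (NormedSpace.exp (Λ γ)) (B γ h)),
        mulLp_ae (NormedSpace.exp (Λ γ) * fderiv ℝ Λ γ h) ((1 / 2 : ℝ) • B γ γ),
        mulLp_ae (NormedSpace.exp (Λ γ)) (B γ h), hhalf γ, hB γ h] with x h1 h2 h3 h4 h5 h6
      rw [h1, hφ, h2, Pi.add_apply, h3, h4, h5, h6, BoundedContinuousFunction.mul_apply, exp_apply,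
        normPowDeriv_exp_smul]
    refine ⟨(integrable_normPowDeriv hq.out (Ψ γ) φ).congr hae, ?_⟩
    have e0 : γ + (0 : ℝ) • h = γ := by rw [zero_smul, add_zero]
    have hF : HasFDerivAt (fun ψ : Lp F (ENNReal.ofReal q) distinctMeasure =>
        ∫ x, ‖ψ x‖ ^ q ∂distinctMeasure) (lpPowDeriv (Ψ γ)) (Ψ (γ + (0 : ℝ) • h)) := by
      rw [e0]
      exact hasFDerivAt_integral_norm_rpow (Ψ γ)
    have := HasFDerivAt.comp_hasDerivAt (l := fun ψ : Lp F (ENNReal.ofReal q) distinctMeasure =>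
        ∫ x, ‖ψ x‖ ^ q ∂distinctMeasure) (l' := lpPowDeriv (Ψ γ)) (0 : ℝ) hF hd
    rw [lpPowDeriv_apply, integral_congr_ae hae] at this
    exact this

end Exponential

/-! ### Logarithms of the speeds and of the normalized secants -/

section Density

variable {n : ℕ} {s q : ℝ} [hq : Fact (1 < q)]

/-- `γ ↦ γ'` along a family of parameters, as a linear map. -/
def velocityAlong (hs : 1 / q < s) {X : Type*} (π : X → RModZ) :
    Sobolev n s q →ₗ[ℝ] X → E n where
  toFun γ x := contDeriv γ (π x)
  map_add' γ η := by
    funext x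
    rw [contDeriv_add hs]
    rfl
  map_smul' t γ := by
    funext x
    change contDeriv (t • γ) (π x) = _
    rw [contDeriv_smul hs]
    rfl

/-- The normalized secants of `γ` along a family of pairs of parameters, as a linear map. -/
def secantAlong {X : Type*} (π₁ π₂ : X → RModZ) :
    Sobolev n s q →ₗ[ℝ] X → E n where
  toFun γ x := ‖π₁ x - π₂ x‖⁻¹ • (γ (π₁ x) - γ (π₂ x))
  map_add' γ η := by
    funext x
    rw [Sobolev.coe_add, Pi.add_apply, Pi.add_apply, add_sub_add_comm, smul_add]
    rfl
  map_smul' t γ := by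
    funext x
    change ‖π₁ x - π₂ x‖⁻¹ • ((t • γ) (π₁ x) - (t • γ) (π₂ x)) = _
    rw [Sobolev.coe_smul, Pi.smul_apply, Pi.smul_apply, ← smul_sub, smul_comm]
    rfl

/-- The logarithmic derivative of `|γ'(u)|` in the direction `h`. -/
def speedVar (γ h : Sobolev n s q) (u : RModZ) : ℝ :=
  ⟪contDeriv γ u, contDeriv h u⟫ / ‖contDeriv γ u‖ ^ 2

/-- The logarithmic derivative of `|γ(u) - γ(v)|` in the direction `h`. -/
def secantVar (γ h : Sobolev n s q) (u v : RModZ) : ℝ :=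
  ⟪γ u - γ v, h u - h v⟫ / ‖γ u - γ v‖ ^ 2

lemma exists_log_speed (hs : 1 / q < s) {γ : Sobolev n s q} {c : ℝ} (hc : 0 < c)
    (hγ : IsBiLipschitz c γ) {π : distinct → RModZ} (hπ : Continuous π) :
    ∃ Λ : Sobolev n s q → BddFun, ContDiffAt ℝ 1 Λ γ ∧
      (∀ᶠ η in 𝓝 γ, ∀ x, Real.exp (Λ η x) = ‖contDeriv η (π x)‖ ^ 2) ∧
      ∀ h x, fderiv ℝ Λ γ h x = 2 * speedVar γ h (π x) := by
  obtain ⟨K, hK0, hK⟩ := exists_norm_contDeriv_le n hs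
  obtain ⟨Λ, h1, h2, h3⟩ := exists_log_norm_sq (velocityAlong hs π)
    (fun η => (contDeriv η).continuous.comp hπ) hK0
    (fun η x => ((contDeriv η).norm_coe_le_norm (π x)).trans (hK η)) hc (γ₀ := γ)
    (fun x => hγ.1 (π x))
  refine ⟨Λ, h1, h2, fun h x => ?_⟩
  rw [h3, speedVar, mul_div_assoc]
  rfl

/-- Dividing secants by the parameter distance makes them bounded above and below up to the
diagonal. The divisor does not depend on the curve and drops out of the logarithmic derivative. -/
lemma exists_log_secant (hs : 1 / q < s) {γ : Sobolev n s q} {c : ℝ} (hc : 0 < c)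
    (hγ : IsBiLipschitz c γ) {π₁ π₂ : distinct → RModZ} (hπ₁ : Continuous π₁) (hπ₂ : Continuous π₂)
    (hne : ∀ x, π₁ x ≠ π₂ x) :
    ∃ Λ : Sobolev n s q → BddFun, ContDiffAt ℝ 1 Λ γ ∧
      (∀ᶠ η in 𝓝 γ, ∀ x, Real.exp (Λ η x)
        = (‖π₁ x - π₂ x‖⁻¹ * ‖η (π₁ x) - η (π₂ x)‖) ^ 2) ∧
      ∀ h x, fderiv ℝ Λ γ h x = 2 * secantVar γ h (π₁ x) (π₂ x) := by
  obtain ⟨K, hK0, hK⟩ := exists_norm_contDeriv_le n hs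
  have hpos : ∀ x, 0 < ‖π₁ x - π₂ x‖ := fun x => norm_pos_iff.2 (sub_ne_zero.2 (hne x))
  have hnorm : ∀ (η : Sobolev n s q) x, ‖secantAlong π₁ π₂ η x‖
      = ‖π₁ x - π₂ x‖⁻¹ * ‖η (π₁ x) - η (π₂ x)‖ := fun η x => by
    change ‖‖π₁ x - π₂ x‖⁻¹ • (η (π₁ x) - η (π₂ x))‖ = _
    rw [norm_smul, norm_inv, norm_norm]
  obtain ⟨Λ, h1, h2, h3⟩ := exists_log_norm_sq (secantAlong π₁ π₂)
    (fun η => ((hπ₁.sub hπ₂).norm.inv₀ fun x => (hpos x).ne').smul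
      ((η.continuous.comp hπ₁).sub (η.continuous.comp hπ₂))) hK0
    (fun η x => by
      rw [hnorm, inv_mul_le_iff₀ (hpos x), mul_comm]
      exact (norm_sub_le_of_contDeriv hs η _ _).trans
        (mul_le_mul_of_nonneg_right (hK η) (hpos x).le)) hc (γ₀ := γ)
    (fun x => by
      rw [hnorm, le_inv_mul_iff₀ (hpos x), mul_comm]
      exact hγ.2 _ _)
  refine ⟨Λ, h1, ?_, fun h x => ?_⟩
  · filter_upwards [h2] with η hη x
    rw [hη, hnorm]
  · rw [h3, hnorm, secantVar]
    change 2 * ⟪‖π₁ x - π₂ x‖⁻¹ • (γ (π₁ x) - γ (π₂ x)), ‖π₁ x - π₂ x‖⁻¹ • (h (π₁ x) - h (π₂ x))⟫ / _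
      = _
    have := (hpos x).ne'
    rw [real_inner_smul_left, real_inner_smul_right, mul_pow]
    field_simp

end Density

/-! ### The weight of the area and its logarithm -/

section Representation

variable {n : ℕ} {s q : ℝ} [hq : Fact (1 < q)]

/-- The oriented area of the parallelogram spanned by three points of a curve. -/
def area (f : RModZ → E n) (x : Triple) : ⋀[ℝ]^2 (E n) :=
  wedge (f x.2.1 - f x.1) (f x.2.2 - f x.1)

/-- The product of the lengths of the sides of the triangle of three points of a curve. -/
def sideProd (f : RModZ → E n) (x : Triple) : ℝ :=
  ‖f x.2.1 - f x.2.2‖ * ‖f x.2.1 - f x.1‖ * ‖f x.2.2 - f x.1‖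

/-- The factor of `|area| ^ q` in the integrand of the energy. -/
def areaWeight (p : ℝ) (γ : Sobolev n s q) (x : Triple) : ℝ :=
  ‖contDeriv γ x.1‖ * ‖contDeriv γ x.2.1‖ * ‖contDeriv γ x.2.2‖ / sideProd γ x ^ p

/-- The logarithmic derivative of `areaWeight` in the direction `h`. -/
def weightVar (p : ℝ) (γ h : Sobolev n s q) (x : Triple) : ℝ :=
  speedVar γ h x.1 + speedVar γ h x.2.1 + speedVar γ h x.2.2
    - p * (secantVar γ h x.2.1 x.2.2 + secantVar γ h x.2.1 x.1 + secantVar γ h x.2.2 x.1)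

lemma polarArea_self (f : RModZ → E n) (x : Triple) : polarArea f f x = (2 : ℝ) • area f x := by
  rw [polarArea, two_smul, area]

/-- The weight times D^p is a product of three speeds and of powers of three normalized secants. Its
logarithm is therefore a linear combination of functions already known to be C¹ at γ. -/
lemma exists_log_areaWeight (p : ℝ) (hs : 1 / q < s) {γ : Sobolev n s q} {c : ℝ} (hc : 0 < c)
    (hγ : IsBiLipschitz c γ) :
    ∃ Λ : Sobolev n s q → BddFun, ContDiffAt ℝ 1 Λ γ ∧
      (∀ᶠ η in 𝓝 γ, ∀ x, Real.exp (Λ η x) = (areaWeight p η x * distProd x ^ p) ^ (1 / q)) ∧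
      ∀ h x, fderiv ℝ Λ γ h x = (1 / q) * weightVar p γ h x := by
  obtain ⟨Λ₁, hd₁, he₁, hf₁⟩ := exists_log_speed hs hc hγ (π := fun x => x.1.1) (by fun_prop)
  obtain ⟨Λ₂, hd₂, he₂, hf₂⟩ := exists_log_speed hs hc hγ (π := fun x => x.1.2.1) (by fun_prop)
  obtain ⟨Λ₃, hd₃, he₃, hf₃⟩ := exists_log_speed hs hc hγ (π := fun x => x.1.2.2) (by fun_prop)
  obtain ⟨M₁, kd₁, ke₁, kf₁⟩ := exists_log_secant hs hc hγ (π₁ := fun x => x.1.2.1)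
    (π₂ := fun x => x.1.2.2) (by fun_prop) (by fun_prop) (fun x => x.2.1)
  obtain ⟨M₂, kd₂, ke₂, kf₂⟩ := exists_log_secant hs hc hγ (π₁ := fun x => x.1.2.1)
    (π₂ := fun x => x.1.1) (by fun_prop) (by fun_prop) (fun x => x.2.2.1)
  obtain ⟨M₃, kd₃, ke₃, kf₃⟩ := exists_log_secant hs hc hγ (π₁ := fun x => x.1.2.2)
    (π₂ := fun x => x.1.1) (by fun_prop) (by fun_prop) (fun x => x.2.2.2)
  -- The factor 1/2 appears because the Λᵢ and Mᵢ are logarithms of squares, the factor 1/q because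
  -- the weight goes inside the `L^q`-norm.
  refine ⟨fun η => (1 / (2 * q)) • (Λ₁ η + Λ₂ η + Λ₃ η - p • (M₁ η + M₂ η + M₃ η)),
    (((hd₁.add hd₂).add hd₃).sub (((kd₁.add kd₂).add kd₃).const_smul p)).const_smul _, ?_, ?_⟩
  · filter_upwards [he₁, he₂, he₃, ke₁, ke₂, ke₃, hγ.eventually hs hc]
      with η h1 h2 h3 k1 k2 k3 hη x
    have hx := x.2
    change Real.exp ((1 / (2 * q)) * (Λ₁ η x + Λ₂ η x + Λ₃ η x - p * (M₁ η x + M₂ η x + M₃ η x))) = _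
    have dp : ∀ a b : RModZ, a ≠ b → 0 < ‖a - b‖ := fun a b h => norm_pos_iff.2 (sub_ne_zero.2 h)
    have sp : ∀ u, 0 < ‖contDeriv η u‖ := fun u => (half_pos hc).trans_le (hη.1 u)
    have np : ∀ a b : RModZ, a ≠ b → 0 < ‖η a - η b‖ := fun a b h =>
      (mul_pos (half_pos hc) (dp a b h)).trans_le (hη.2 a b)
    have hlog : ∀ {a b : ℝ}, 0 < b → Real.exp a = b ^ 2 → a = 2 * Real.log b := by
      intro a b hb h
      rw [← Real.log_exp a, h, Real.log_pow]
      norm_num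
    have d1 := dp _ _ hx.1
    have d2 := dp _ _ hx.2.1
    have d3 := dp _ _ hx.2.2
    have n1 := np _ _ hx.1
    have n2 := np _ _ hx.2.1
    have n3 := np _ _ hx.2.2
    have s1 := sp x.1.1
    have s2 := sp x.1.2.1
    have s3 := sp x.1.2.2
    rw [hlog s1 (h1 x), hlog s2 (h2 x), hlog s3 (h3 x),
      hlog (mul_pos (inv_pos.2 d1) n1) (k1 x), hlog (mul_pos (inv_pos.2 d2) n2) (k2 x),
      hlog (mul_pos (inv_pos.2 d3) n3) (k3 x), Real.log_mul (inv_pos.2 d1).ne' n1.ne',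
      Real.log_mul (inv_pos.2 d2).ne' n2.ne', Real.log_mul (inv_pos.2 d3).ne' n3.ne',
      Real.log_inv, Real.log_inv, Real.log_inv]
    have hN : 0 < sideProd η x := by unfold sideProd; positivity
    have hD := distProd_pos hx
    have hW : 0 < areaWeight p η x * distProd x ^ p := by
      unfold areaWeight
      positivity
    rw [Real.rpow_def_of_pos hW, areaWeight, Real.log_mul (by positivity) (by positivity),
      Real.log_div (by positivity) (by positivity), Real.log_mul (by positivity) s3.ne',
      Real.log_mul s1.ne' s2.ne', Real.log_rpow hN, Real.log_rpow hD, sideProd, distProd,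
      Real.log_mul (by positivity) (by positivity), Real.log_mul (by positivity) (by positivity),
      Real.log_mul (by positivity) (by positivity), Real.log_mul (by positivity) (by positivity)]
    congr 1
    have hq0 : q ≠ 0 := by have := hq.out; positivity
    field_simp
    ring
  · intro h x
    have e1 := (hd₁.differentiableAt one_ne_zero).hasFDerivAt
    have e2 := (hd₂.differentiableAt one_ne_zero).hasFDerivAt
    have e3 := (hd₃.differentiableAt one_ne_zero).hasFDerivAt
    have g1 := (kd₁.differentiableAt one_ne_zero).hasFDerivAt
    have g2 := (kd₂.differentiableAt one_ne_zero).hasFDerivAt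
    have g3 := (kd₃.differentiableAt one_ne_zero).hasFDerivAt
    have key : fderiv ℝ (fun η => (1 / (2 * q)) •
        (Λ₁ η + Λ₂ η + Λ₃ η - p • (M₁ η + M₂ η + M₃ η))) γ = _ :=
      ((((e1.add e2).add e3).sub (((g1.add g2).add g3).const_smul p)).const_smul
        (1 / (2 * q))).fderiv
    rw [key]
    change (1 / (2 * q)) * (fderiv ℝ Λ₁ γ h x + fderiv ℝ Λ₂ γ h x + fderiv ℝ Λ₃ γ h x
      - p * (fderiv ℝ M₁ γ h x + fderiv ℝ M₂ γ h x + fderiv ℝ M₃ γ h x)) = _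
    rw [hf₁, hf₂, hf₃, kf₁, kf₂, kf₃, weightVar]
    have hq0 : q ≠ 0 := by have := hq.out; positivity
    field_simp

end Representation

/-! ### The energy as the q-th power of an `L^q`-norm -/

section Representation

variable {n : ℕ} {s q : ℝ} [hq : Fact (1 < q)]

lemma areaWeight_nonneg (p : ℝ) (γ : Sobolev n s q) (x : Triple) : 0 ≤ areaWeight p γ x := by
  unfold areaWeight sideProd
  positivity

lemma energy_eq_lintegral_contDeriv (hs : 1 / q < s) (p : ℝ) (γ : Sobolev n s q) :
    energy p q γ = ∫⁻ x, ENNReal.ofReal (areaWeight p γ x * ‖area γ x‖ ^ q) := by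
  have h := contDeriv_ae hs γ
  have h1 : ∀ᵐ x : Triple, contDeriv γ x.1 = γ.deriv x.1 :=
    Measure.quasiMeasurePreserving_fst.ae h
  have h2 : ∀ᵐ x : Triple, contDeriv γ x.2.1 = γ.deriv x.2.1 :=
    (Measure.quasiMeasurePreserving_fst.comp Measure.quasiMeasurePreserving_snd).ae h
  have h3 : ∀ᵐ x : Triple, contDeriv γ x.2.2 = γ.deriv x.2.2 :=
    (Measure.quasiMeasurePreserving_snd.comp Measure.quasiMeasurePreserving_snd).ae h
  rw [energy]
  refine lintegral_congr_ae ?_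
  filter_upwards [h1, h2, h3] with x h1 h2 h3
  rw [← h1, ← h2, ← h3, invR, areaWeight, sideProd, area]
  congr 1
  ring

/-- A triangle with two coinciding vertices is degenerate. As the integrands vanish on the
diagonals, integrals over distinct triples are integrals over all triples. -/
lemma area_eq_zero (f : RModZ → E n) {x : Triple} (hx : x ∉ distinct) : area f x = 0 := by
  have hz : ∀ a : E n, wedge 0 a = 0 := fun a => by
    have := wedge_smul_left 0 0 a
    simpa using this
  have hz' : ∀ a : E n, wedge a 0 = 0 := fun a => by rw [wedge_swap, hz, neg_zero]
  by_cases h1 : x.2.1 = x.2.2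
  · rw [area, h1, wedge_self]
  by_cases h2 : x.2.1 = x.1
  · rw [area, h2, sub_self, hz]
  by_cases h3 : x.2.2 = x.1
  · rw [area, h3, sub_self, hz']
  exact absurd ⟨h1, h2, h3⟩ hx

/-- The integrand of the first variation at a regular curve. -/
def energyVar (p : ℝ) (γ h : Sobolev n s q) (x : Triple) : ℝ :=
  areaWeight p γ x * (weightVar p γ h x * ‖area γ x‖ ^ q
    + q * ‖area γ x‖ ^ (q - 2) * ⟪area γ x, polarArea γ h x⟫)

lemma energyVar_eq_zero (p : ℝ) (γ h : Sobolev n s q) {x : Triple} (hx : x ∉ distinct) :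
    energyVar p γ h x = 0 := by
  have hq0 : q ≠ 0 := by have := hq.out; positivity
  rw [energyVar, area_eq_zero γ hx, norm_zero, Real.zero_rpow hq0, inner_zero_left]
  ring

/-- The factor D^p inside e^(qΛ) cancels the q-th power of D^(-p/q), leaving the weight of the
energy. -/
lemma exp_mul_norm_areaQuot_rpow {p : ℝ} {γ : Sobolev n s q} {Λ : BddFun}
    (hΛ : ∀ x : distinct, Real.exp (Λ x) = (areaWeight p γ x * distProd x ^ p) ^ (1 / q))
    (x : distinct) : Real.exp (q * Λ x) * (distProd x ^ (-(p / q))) ^ q = areaWeight p γ x := by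
  have hq0 : q ≠ 0 := by have := hq.out; positivity
  have hD := distProd_pos x.2
  have hW := areaWeight_nonneg p γ x
  rw [mul_comm q, Real.exp_mul, hΛ, ← Real.rpow_mul (by positivity), one_div_mul_cancel hq0,
    Real.rpow_one, ← Real.rpow_mul hD.le, mul_assoc, ← Real.rpow_add hD, neg_mul,
    div_mul_cancel₀ _ hq0, add_neg_cancel, Real.rpow_zero, mul_one]

lemma half_smul_areaQuot (p : ℝ) (γ : Sobolev n s q) (x : Triple) :
    (1 / 2 : ℝ) • areaQuot p q γ γ x = distProd x ^ (-(p / q)) • area γ x := by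
  rw [areaQuot, polarArea_self, smul_comm (1 / 2 : ℝ), smul_smul (1 / 2 : ℝ)]
  norm_num

lemma exp_mul_norm_half_areaQuot {p : ℝ} {γ : Sobolev n s q} {Λ : BddFun}
    (hΛ : ∀ x : distinct, Real.exp (Λ x) = (areaWeight p γ x * distProd x ^ p) ^ (1 / q))
    (x : distinct) : Real.exp (q * Λ x) * ‖(1 / 2 : ℝ) • areaQuot p q γ γ x‖ ^ q
      = areaWeight p γ x * ‖area γ x‖ ^ q := by
  have hD := distProd_pos x.2
  rw [half_smul_areaQuot, norm_smul, Real.norm_of_nonneg (by positivity),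
    Real.mul_rpow (by positivity) (norm_nonneg _), ← mul_assoc, exp_mul_norm_areaQuot_rpow hΛ]

lemma weightedPowDeriv_areaQuot {p : ℝ} {γ h : Sobolev n s q} {Λ χ : BddFun}
    (hΛ : ∀ x : distinct, Real.exp (Λ x) = (areaWeight p γ x * distProd x ^ p) ^ (1 / q))
    (hχ : ∀ x : distinct, χ x = 1 / q * weightVar p γ h x) (x : distinct) :
    weightedPowDeriv q (Λ x) (χ x) ((1 / 2 : ℝ) • areaQuot p q γ γ x) (areaQuot p q γ h x)
      = energyVar p γ h x := by
  have hq0 : q ≠ 0 := by have := hq.out; positivity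
  have hD := distProd_pos x.2
  have e := weightedPowDeriv_smul (r := q) (Real.rpow_pos_of_pos hD (-(p / q))) (Λ x) (χ x)
    (area γ x) (polarArea γ h x)
  rw [half_smul_areaQuot, areaQuot]
  refine e.trans ?_
  rw [exp_mul_norm_areaQuot_rpow hΛ x, hχ, energyVar, ← mul_assoc q, mul_one_div_cancel hq0, one_mul]

lemma integral_distinct_eq {f : Triple → ℝ} (hf : ∀ x ∉ distinct, f x = 0) :
    ∫ x : distinct, f x ∂distinctMeasure = ∫ x, f x := by
  rw [distinctMeasure, integral_subtype_comap measurableSet_distinct f,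
    setIntegral_eq_integral_of_forall_compl_eq_zero hf]

lemma integrable_of_distinct {f : Triple → ℝ} (hf : ∀ x ∉ distinct, f x = 0)
    (h : Integrable (fun x : distinct => f x) distinctMeasure) : Integrable f := by
  have h1 : IntegrableOn f distinct :=
    (integrableOn_iff_comap_subtypeVal measurableSet_distinct).2 h
  exact (integrableOn_iff_integrable_of_support_subset fun x hx =>
    not_not.1 fun hx' => hx (hf x hx')).1 h1

/-- Finiteness and continuous differentiability of the energy near a regular embedded curve,
with the first variation. -/
lemma energy_differentiable {p : ℝ} (hp : 0 < p) (hs : 1 / q < s)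
    (hqs : q * s = 3 * p - 2 - 2 * q) (hpq : p < q + 1) {γ : Sobolev n s q} {c : ℝ} (hc : 0 < c)
    (hγ : IsBiLipschitz c γ) :
    energy p q γ < ⊤ ∧ Integrable (fun x => areaWeight p γ x * ‖area γ x‖ ^ q) ∧
    ContDiffAt ℝ 1 (fun η : Sobolev n s q => (energy p q η).toReal) γ ∧
    ∀ h : Sobolev n s q, Integrable (energyVar p γ h) ∧
      HasDerivAt (fun τ : ℝ => (energy p q (γ + τ • h)).toReal) (∫ x, energyVar p γ h x) 0 := by
  obtain ⟨Λ, hΛ, hexp, hfd⟩ := exists_log_areaWeight p hs hc hγ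
  obtain ⟨C, hC0, hC⟩ := exists_eLpNorm_areaQuot_le (q := q) (s := s) n hp hs hqs hpq
  obtain ⟨h1, h2, h3⟩ := contDiffAt_weighted_integral (q := q)
    (f := fun (γ η : Sobolev n s q) (x : distinct) => areaQuot p q γ η x)
    (memLp_areaQuot hp hs hqs hpq) (fun γ₁ γ₂ η x => areaQuot_add_left p q γ₁ γ₂ η x)
    (fun t γ η x => areaQuot_smul_left p q t γ η x) (fun γ η x => areaQuot_comm p q γ η x) hC0 hC hΛ
  have hq0 : q ≠ 0 := by have := hq.out; positivity
  have hz : ∀ η : Sobolev n s q, ∀ x ∉ distinct, areaWeight p η x * ‖area η x‖ ^ q = 0 :=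
    fun η x hx => by rw [area_eq_zero η hx, norm_zero, Real.zero_rpow hq0, mul_zero]
  have hnn : ∀ (η : Sobolev n s q) x, 0 ≤ areaWeight p η x * ‖area η x‖ ^ q := fun η x =>
    mul_nonneg (areaWeight_nonneg p η x) (by positivity)
  have hi : ∀ {η : Sobolev n s q}, (∀ x : distinct, Real.exp (Λ η x)
      = (areaWeight p η x * distProd x ^ p) ^ (1 / q)) →
      Integrable fun x => areaWeight p η x * ‖area η x‖ ^ q := fun {η} hη => by
    refine integrable_of_distinct (hz η) ((h1 η).congr (ae_of_all _ fun x => ?_))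
    exact exp_mul_norm_half_areaQuot hη x
  -- This representation needs the formula for exp Λ, which holds only for η near γ; that is enough
  -- for differentiability at γ.
  have he : ∀ {η : Sobolev n s q}, (∀ x : distinct, Real.exp (Λ η x)
      = (areaWeight p η x * distProd x ^ p) ^ (1 / q)) → (energy p q η).toReal
      = ∫ x : distinct, Real.exp (q * Λ η x) * ‖(1 / 2 : ℝ) • areaQuot p q η η x‖ ^ q
        ∂distinctMeasure := fun {η} hη => by
    rw [energy_eq_lintegral_contDeriv hs, ← integral_eq_lintegral_of_nonneg_ae
      (ae_of_all _ (hnn η)) (hi hη).aestronglyMeasurable, ← integral_distinct_eq (hz η)]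
    exact integral_congr_ae (ae_of_all _ fun x => (exp_mul_norm_half_areaQuot hη x).symm)
  have hγ₀ := hexp.self_of_nhds
  refine ⟨?_, hi hγ₀, h2.congr_of_eventuallyEq (hexp.mono fun η hη => he hη), fun h => ?_⟩
  · rw [energy_eq_lintegral_contDeriv hs]
    exact (hi hγ₀).lintegral_lt_top
  · obtain ⟨k1, k2⟩ := h3 h
    have hw : ∀ x : distinct, weightedPowDeriv q (Λ γ x) (fderiv ℝ Λ γ h x)
        ((1 / 2 : ℝ) • areaQuot p q γ γ x) (areaQuot p q γ h x) = energyVar p γ h x :=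
      weightedPowDeriv_areaQuot hγ₀ (hfd h)
    simp only [hw] at k1 k2
    rw [integral_distinct_eq fun x => energyVar_eq_zero p γ h] at k2
    refine ⟨integrable_of_distinct (fun x => energyVar_eq_zero p γ h) k1,
      k2.congr_of_eventuallyEq ?_⟩
    have htend : Tendsto (fun τ : ℝ => γ + τ • h) (𝓝 0) (𝓝 γ) := by
      have hc : Continuous fun τ : ℝ => γ + τ • h :=
        continuous_const.add (continuous_id.smul continuous_const)
      have := hc.tendsto 0
      rwa [zero_smul, add_zero] at this
    exact (htend.eventually hexp).mono fun τ hτ => he hτ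

end Representation

/-! ### The first variation at curves parametrized by arc-length -/

section Triples

lemma measurableEmbedding_cyc : MeasurableEmbedding cyc := by
  refine (Continuous.isClosedEmbedding (by unfold cyc; fun_prop) ?_).measurableEmbedding
  rintro ⟨a, b, c⟩ ⟨a', b', c'⟩ h
  simp only [cyc, Prod.mk.injEq] at h ⊢
  tauto

/-- The interchange of the last two parameters. -/
def swapLast (x : Triple) : Triple := (x.1, x.2.2, x.2.1)

lemma measurePreserving_swapLast : MeasurePreserving swapLast :=
  (MeasurePreserving.id volume).prod Measure.measurePreserving_swap

lemma measurableEmbedding_swapLast : MeasurableEmbedding swapLast := by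
  refine (Continuous.isClosedEmbedding (by unfold swapLast; fun_prop) ?_).measurableEmbedding
  rintro ⟨a, b, c⟩ ⟨a', b', c'⟩ h
  simp only [swapLast, Prod.mk.injEq] at h ⊢
  tauto

/-- The parameters `u`, `u + v` and `u + w`. -/
def shift (x : Triple) : Triple := (x.1, x.1 + x.2.1, x.1 + x.2.2)

lemma measurePreserving_shift : MeasurePreserving shift :=
  MeasurePreserving.skew_product (g := fun (u : RModZ) (y : RModZ × RModZ) => (u + y.1, u + y.2))
    (MeasurePreserving.id volume) (by unfold Function.uncurry; fun_prop)
    (ae_of_all _ fun u => ((measurePreserving_add_left volume u).prod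
      (measurePreserving_add_left volume u)).map_eq)

lemma measurableEmbedding_shift : MeasurableEmbedding shift := by
  refine (Continuous.isClosedEmbedding (by unfold shift; fun_prop) ?_).measurableEmbedding
  rintro ⟨a, b, c⟩ ⟨a', b', c'⟩ h
  simp only [shift, Prod.mk.injEq] at h ⊢
  obtain ⟨rfl, h1, h2⟩ := h
  exact ⟨rfl, add_left_cancel h1, add_left_cancel h2⟩

/-- The cyclic permutation preserves the measure. This is the origin of the factors 3 in the first
variation. -/
lemma integral_add_cyc {f : Triple → ℝ} (hf : Integrable f) :
    Integrable (fun x => f x + f (cyc x) + f (cyc (cyc x))) ∧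
      ∫ x, (f x + f (cyc x) + f (cyc (cyc x))) = 3 * ∫ x, f x := by
  have h1 : Integrable fun x => f (cyc x) := measurePreserving_cyc.integrable_comp_of_integrable hf
  have h2 : Integrable fun x => f (cyc (cyc x)) :=
    measurePreserving_cyc.integrable_comp_of_integrable h1
  have e1 : ∫ x, f (cyc x) = ∫ x, f x := measurePreserving_cyc.integral_comp measurableEmbedding_cyc f
  have e2 : ∫ x, f (cyc (cyc x)) = ∫ x, f (cyc x) :=
    measurePreserving_cyc.integral_comp measurableEmbedding_cyc fun x => f (cyc x)
  refine ⟨(hf.add h1).add h2, ?_⟩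
  rw [integral_add (f := fun x => f x + f (cyc x)) (hf.add h1) h2, integral_add hf h1, e2, e1]
  ring

end Triples

/-! ### The variation integrand at unit speed -/

section ArcLength

variable {n : ℕ} {s q : ℝ} [hq : Fact (1 < q)]

/-- The integrand of the energy at a curve parametrized by arc-length. -/
def arcDensity (p : ℝ) (γ : Sobolev n s q) (x : Triple) : ℝ := ‖area γ x‖ ^ q / sideProd γ x ^ p

/-- The part of the first variation that comes from the variation of the area. -/
def areaVar (p : ℝ) (γ h : Sobolev n s q) (x : Triple) : ℝ :=
  q * (‖area γ x‖ ^ (q - 2) / sideProd γ x ^ p) * ⟪area γ x, polarArea γ h x⟫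

lemma area_cyc (f : RModZ → E n) (x : Triple) : area f (cyc x) = area f x := by
  have h := polarArea_cyc f f x
  rw [polarArea_self, polarArea_self] at h
  exact smul_right_injective _ (two_ne_zero (α := ℝ)) h

lemma sideProd_cyc (f : RModZ → E n) (x : Triple) : sideProd f (cyc x) = sideProd f x := by
  simp only [sideProd, cyc]
  rw [norm_sub_rev (f x.1) (f x.2.1), norm_sub_rev (f x.2.2) (f x.2.1)]
  ring

lemma arcDensity_cyc (p : ℝ) (γ : Sobolev n s q) (x : Triple) :
    arcDensity p γ (cyc x) = arcDensity p γ x := by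
  rw [arcDensity, area_cyc, sideProd_cyc, arcDensity]

lemma secantVar_comm (γ h : Sobolev n s q) (u v : RModZ) :
    secantVar γ h u v = secantVar γ h v u := by
  rw [secantVar, secantVar, norm_sub_rev, ← neg_sub (γ v), ← neg_sub (h v), inner_neg_neg]

/-- At unit speed the weight depends only on the side lengths and is cyclically invariant. The three
speed terms are then the cyclic images of one of them, and likewise the three secant terms. -/
lemma energyVar_eq (p : ℝ) (γ h : Sobolev n s q) (hγ : ∀ u, ‖contDeriv γ u‖ = 1) (x : Triple) :
    energyVar p γ h x = areaVar p γ h x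
      + (arcDensity p γ x * ⟪contDeriv γ x.1, contDeriv h x.1⟫
        + arcDensity p γ (cyc x) * ⟪contDeriv γ (cyc x).1, contDeriv h (cyc x).1⟫
        + arcDensity p γ (cyc (cyc x)) * ⟪contDeriv γ (cyc (cyc x)).1, contDeriv h (cyc (cyc x)).1⟫)
      - p * (arcDensity p γ x * secantVar γ h x.2.1 x.2.2
        + arcDensity p γ (cyc x) * secantVar γ h (cyc x).2.1 (cyc x).2.2
        + arcDensity p γ (cyc (cyc x)) * secantVar γ h (cyc (cyc x)).2.1 (cyc (cyc x)).2.2) := by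
  rw [arcDensity_cyc, arcDensity_cyc, arcDensity_cyc, energyVar, areaWeight, hγ, hγ, hγ, weightVar,
    speedVar, speedVar, speedVar, hγ, hγ, hγ, areaVar, arcDensity, secantVar_comm γ h x.2.1 x.1]
  simp only [cyc]
  ring

lemma abs_secantVar_le (hs : 1 / q < s) {γ : Sobolev n s q} {c : ℝ} (hc : 0 < c)
    (hγ : IsBiLipschitz c γ) (h : Sobolev n s q) (u v : RModZ) :
    |secantVar γ h u v| ≤ ‖contDeriv h‖ / c := by
  have h0 := (norm_nonneg (contDeriv h))
  rcases eq_or_ne u v with rfl | huv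
  · rw [secantVar, sub_self, inner_zero_left, zero_div, abs_zero]
    positivity
  have h1 := norm_pos_iff.2 (sub_ne_zero.2 huv)
  have h2 := hγ.2 u v
  have h3 : 0 < ‖γ u - γ v‖ := (mul_pos hc h1).trans_le h2
  have h4 := norm_sub_le_of_contDeriv hs h u v
  rw [secantVar, abs_div, abs_of_pos (pow_pos h3 2), div_le_div_iff₀ (by positivity) hc]
  calc |⟪γ u - γ v, h u - h v⟫| * c ≤ (‖γ u - γ v‖ * ‖h u - h v‖) * c := by
        gcongr
        exact abs_real_inner_le_norm _ _
    _ ≤ (‖γ u - γ v‖ * (‖contDeriv h‖ * ‖u - v‖)) * c := by gcongr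
    _ = ‖γ u - γ v‖ * ‖contDeriv h‖ * (c * ‖u - v‖) := by ring
    _ ≤ ‖γ u - γ v‖ * ‖contDeriv h‖ * ‖γ u - γ v‖ := by gcongr
    _ = ‖contDeriv h‖ * ‖γ u - γ v‖ ^ 2 := by ring

/-- The integrand of the first variation with the symmetries under cyclic permutations used. -/
def symmVar (p : ℝ) (γ h : Sobolev n s q) (x : Triple) : ℝ :=
  areaVar p γ h x + (3 * (arcDensity p γ x * ⟪contDeriv γ x.1, contDeriv h x.1⟫)
    - 3 * p * (arcDensity p γ x * secantVar γ h x.2.1 x.2.2))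

lemma integrable_lower (p : ℝ) (hs : 1 / q < s) {γ : Sobolev n s q} {c : ℝ} (hc : 0 < c)
    (hγ : IsBiLipschitz c γ) (h : Sobolev n s q) (hJ : Integrable (arcDensity p γ)) :
    Integrable (fun x => arcDensity p γ x * ⟪contDeriv γ x.1, contDeriv h x.1⟫) ∧
    Integrable fun x => arcDensity p γ x * secantVar γ h x.2.1 x.2.2 := by
  have c1 := (contDeriv γ).continuous
  have c2 := (contDeriv h).continuous
  have c3 := γ.continuous
  have c4 := h.continuous
  constructor
  · have hc : Continuous fun x : Triple => ⟪contDeriv γ x.1, contDeriv h x.1⟫ := by fun_prop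
    refine hJ.mul_bdd (c := ‖contDeriv γ‖ * ‖contDeriv h‖) hc.aestronglyMeasurable
      (ae_of_all _ fun x => ?_)
    refine (norm_inner_le_norm _ _).trans ?_
    exact mul_le_mul ((contDeriv γ).norm_coe_le_norm _) ((contDeriv h).norm_coe_le_norm _)
      (norm_nonneg _) (norm_nonneg _)
  · have hm : Measurable fun x : Triple => secantVar γ h x.2.1 x.2.2 := by
      have h1 : Continuous fun x : Triple => ⟪γ x.2.1 - γ x.2.2, h x.2.1 - h x.2.2⟫ := by fun_prop
      have h2 : Continuous fun x : Triple => ‖γ x.2.1 - γ x.2.2‖ ^ 2 := by fun_prop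
      exact h1.measurable.div h2.measurable
    exact hJ.mul_bdd hm.aestronglyMeasurable
      (ae_of_all _ fun x => abs_secantVar_le hs hc hγ h _ _)

/-- The speed and secant terms are an integrable density times bounded factors, so the area term is
integrable as a difference. Each part can therefore be integrated separately and its cyclic sum
collected. -/
lemma integral_energyVar (p : ℝ) (hs : 1 / q < s) {γ : Sobolev n s q} {c : ℝ} (hc : 0 < c)
    (hγ : IsBiLipschitz c γ) (hγ' : ∀ u, ‖contDeriv γ u‖ = 1) (h : Sobolev n s q)
    (hJ : Integrable (arcDensity p γ)) (hE : Integrable (energyVar p γ h)) :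
    Integrable (symmVar p γ h) ∧ ∫ x, symmVar p γ h x = ∫ x, energyVar p γ h x := by
  obtain ⟨ha, hm⟩ := integrable_lower p hs hc hγ h hJ
  obtain ⟨ia, ea⟩ := integral_add_cyc ha
  obtain ⟨im, em⟩ := integral_add_cyc hm
  set a := fun x => arcDensity p γ x * ⟪contDeriv γ x.1, contDeriv h x.1⟫ with hadef
  set m := fun x => arcDensity p γ x * secantVar γ h x.2.1 x.2.2 with hmdef
  have hEeq : ∀ x, energyVar p γ h x = areaVar p γ h x + (a x + a (cyc x) + a (cyc (cyc x)))
      - p * (m x + m (cyc x) + m (cyc (cyc x))) := energyVar_eq p γ h hγ'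
  have hA : Integrable (areaVar p γ h) := by
    refine ((hE.sub ia).add (im.const_mul p)).congr (ae_of_all _ fun x => ?_)
    simp only [Pi.add_apply, Pi.sub_apply, hEeq]
    ring
  have hS : ∀ x, symmVar p γ h x = areaVar p γ h x + (3 * a x - 3 * p * m x) := fun x => rfl
  have i3 : Integrable fun x => 3 * a x - 3 * p * m x := (ha.const_mul 3).sub (hm.const_mul (3 * p))
  have hSi : Integrable (symmVar p γ h) := (hA.add i3).congr (ae_of_all _ fun x => (hS x).symm)
  refine ⟨hSi, ?_⟩
  simp only [hS, hEeq]
  rw [integral_add hA i3, integral_sub (ha.const_mul 3) (hm.const_mul (3 * p)),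
    integral_sub (f := fun x => areaVar p γ h x + (a x + a (cyc x) + a (cyc (cyc x))))
      (hA.add ia) (im.const_mul p), integral_add hA ia, integral_const_mul, integral_const_mul,
    integral_const_mul, ea, em]
  ring

lemma wedgeTermSymm_eq (p : ℝ) (γ h : Sobolev n s q) (x : Triple) :
    wedgeTermSymm p q γ h x.1 x.2.1 x.2.2 = areaVar p γ h (shift x) := by
  simp only [wedgeTermSymm, areaVar, denom, T, area, sideProd, polarArea, shift, add_zero]
  rw [add_comm (wedge (h (x.1 + x.2.1) - h x.1) (γ (x.1 + x.2.2) - γ x.1))]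

lemma lowerTerms_ae (hs : 1 / q < s) (p : ℝ) (γ h : Sobolev n s q) :
    ∀ᵐ x : Triple, lowerTerms p q γ h x.1 x.2.1 x.2.2
      = 3 * (arcDensity p γ (shift x) * ⟪contDeriv γ (shift x).1, contDeriv h (shift x).1⟫)
    - 3 * p * (arcDensity p γ (shift x) * secantVar γ h (shift x).2.1 (shift x).2.2) := by
  have h1 : ∀ᵐ x : Triple, contDeriv γ x.1 = γ.deriv x.1 :=
    Measure.quasiMeasurePreserving_fst.ae (contDeriv_ae hs γ)
  have h2 : ∀ᵐ x : Triple, contDeriv h x.1 = h.deriv x.1 :=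
    Measure.quasiMeasurePreserving_fst.ae (contDeriv_ae hs h)
  filter_upwards [h1, h2] with x h1 h2
  simp only [lowerTerms, arcDensity, secantVar, denom, T, area, sideProd, shift, add_zero]
  rw [h1, h2]
  ring

lemma variationIntegrandSymm_ae (hs : 1 / q < s) (p : ℝ) (γ h : Sobolev n s q) :
    ∀ᵐ x : Triple, variationIntegrandSymm p q γ h x = symmVar p γ h (shift x) := by
  filter_upwards [lowerTerms_ae hs p γ h] with x hx
  rw [variationIntegrandSymm, hx, wedgeTermSymm_eq, symmVar]

end ArcLength

/-! ### Symmetrization and the principal value -/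

section PrincipalValue

variable {n : ℕ} {s q : ℝ} [hq : Fact (1 < q)]

lemma isOpen_offDiagonal (ε : ℝ) : IsOpen (offDiagonal ε) := by
  have h1 : IsOpen {x : Triple | ε < ‖x.2.1‖} := isOpen_lt continuous_const (by fun_prop)
  have h2 : IsOpen {x : Triple | ε < ‖x.2.2‖} := isOpen_lt continuous_const (by fun_prop)
  have h3 : IsOpen {x : Triple | ε < ‖x.2.1 - x.2.2‖} := isOpen_lt continuous_const (by fun_prop)
  exact h1.inter (h2.inter h3)

lemma swapLast_preimage_offDiagonal (ε : ℝ) : swapLast ⁻¹' offDiagonal ε = offDiagonal ε := by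
  ext x
  change (ε < ‖x.2.2‖ ∧ ε < ‖x.2.1‖ ∧ ε < ‖x.2.2 - x.2.1‖) ↔
    (ε < ‖x.2.1‖ ∧ ε < ‖x.2.2‖ ∧ ε < ‖x.2.1 - x.2.2‖)
  rw [norm_sub_rev x.2.2]
  tauto

lemma wedgeTermSymm_eq_half_add (p : ℝ) (γ h : Sobolev n s q) (x : Triple) :
    wedgeTermSymm p q γ h x.1 x.2.1 x.2.2 = 1 / 2 * (wedgeTerm p q γ h x.1 x.2.1 x.2.2
      + wedgeTerm p q γ h (swapLast x).1 (swapLast x).2.1 (swapLast x).2.2) := by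
  simp only [swapLast]
  have hd : denom p γ x.1 x.2.2 x.2.1 = denom p γ x.1 x.2.1 x.2.2 := by
    simp only [denom, T]
    rw [norm_sub_rev (γ (x.1 + x.2.2)) (γ (x.1 + x.2.1))]
    congr 1
    ring
  rw [wedgeTermSymm, wedgeTerm, wedgeTerm, hd, wedge_swap (T γ x.1 x.2.2 0) (T γ x.1 x.2.1 0),
    wedge_swap (T γ x.1 x.2.2 0) (T h x.1 x.2.1 0), norm_neg, inner_neg_neg, inner_add_right]
  ring

/-- The symmetrized term is the mean of the plain one and its image under v ↔ w. On a domain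
invariant under this measure-preserving exchange both have the same integral. -/
lemma integral_wedgeTermSymm {p : ℝ} {γ h : Sobolev n s q} {S : Set Triple}
    (hS : swapLast ⁻¹' S = S)
    (hi : IntegrableOn (fun x => wedgeTerm p q γ h x.1 x.2.1 x.2.2) S) :
    IntegrableOn (fun x => wedgeTermSymm p q γ h x.1 x.2.1 x.2.2) S ∧
    ∫ x in S, wedgeTermSymm p q γ h x.1 x.2.1 x.2.2
      = ∫ x in S, wedgeTerm p q γ h x.1 x.2.1 x.2.2 := by
  set f : Triple → ℝ := fun x => wedgeTerm p q γ h x.1 x.2.1 x.2.2 with hf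
  have h1 : IntegrableOn (fun x => f (swapLast x)) (swapLast ⁻¹' S) :=
    (measurePreserving_swapLast.integrableOn_comp_preimage measurableEmbedding_swapLast).2 hi
  have h2 := measurePreserving_swapLast.setIntegral_preimage_emb measurableEmbedding_swapLast f S
  rw [hS] at h1 h2
  have e : (fun x : Triple => wedgeTermSymm p q γ h x.1 x.2.1 x.2.2)
      = fun x => 1 / 2 * (f x + f (swapLast x)) := funext fun x => wedgeTermSymm_eq_half_add p γ h x
  rw [e]
  refine ⟨(hi.add h1).const_mul (1 / 2), ?_⟩
  rw [integral_const_mul, integral_add hi h1, h2]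
  ring

lemma integral_variationIntegrandSymm {p : ℝ} {γ h : Sobolev n s q} {S : Set Triple}
    (hS : swapLast ⁻¹' S = S)
    (hi : IntegrableOn (fun x => wedgeTerm p q γ h x.1 x.2.1 x.2.2) S)
    (hl : IntegrableOn (fun x => lowerTerms p q γ h x.1 x.2.1 x.2.2) S) :
    ∫ x in S, variationIntegrandSymm p q γ h x = ∫ x in S, variationIntegrand p q γ h x := by
  obtain ⟨h1, h2⟩ := integral_wedgeTermSymm hS hi
  simp only [variationIntegrandSymm, variationIntegrand]
  rw [integral_add h1 hl, integral_add hi hl, h2]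

/-- On the compact set where all three distances are at least ε, injectivity keeps the denominator
away from zero, and the integrand is continuous. -/
lemma integrableOn_wedgeTerm (p : ℝ) {γ : Sobolev n s q} (he : γ.IsEmbedded) (h : Sobolev n s q)
    {ε : ℝ} (hε : 0 < ε) :
    IntegrableOn (fun x : Triple => wedgeTerm p q γ h x.1 x.2.1 x.2.2) (offDiagonal ε) := by
  have c3 := γ.continuous
  have c4 := h.continuous
  set K : Set Triple := {x | ε ≤ ‖x.2.1‖ ∧ ε ≤ ‖x.2.2‖ ∧ ε ≤ ‖x.2.1 - x.2.2‖} with hK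
  have hKc : IsCompact K := by
    have h1 : IsClosed {x : Triple | ε ≤ ‖x.2.1‖} := isClosed_le continuous_const (by fun_prop)
    have h2 : IsClosed {x : Triple | ε ≤ ‖x.2.2‖} := isClosed_le continuous_const (by fun_prop)
    have h3 : IsClosed {x : Triple | ε ≤ ‖x.2.1 - x.2.2‖} :=
      isClosed_le continuous_const (by fun_prop)
    exact (h1.inter (h2.inter h3)).isCompact
  have hsub : offDiagonal ε ⊆ K := fun x hx => ⟨hx.1.le, hx.2.1.le, hx.2.2.le⟩
  refine (ContinuousOn.integrableOn_compact hKc ?_).mono_set hsub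
  have hA : Continuous fun x : Triple => wedge (T γ x.1 x.2.1 0) (T γ x.1 x.2.2 0) := by
    simp only [← wedgeL_apply, T]
    fun_prop
  have hP : Continuous fun x : Triple => wedge (T γ x.1 x.2.1 0) (T h x.1 x.2.2 0) := by
    simp only [← wedgeL_apply, T]
    fun_prop
  -- Writing the term through the derivative of ‖·‖^q gives continuity also at zeros of the area,
  -- where ‖A‖^(q-2) alone may be singular.
  have hN : Continuous fun x : Triple => normPowDeriv q (wedge (T γ x.1 x.2.1 0) (T γ x.1 x.2.2 0))
      (wedge (T γ x.1 x.2.1 0) (T h x.1 x.2.2 0)) :=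
    ((continuous_normPowDeriv hq.out).comp hA).clm_apply hP
  have hD : Continuous fun x : Triple => ‖T γ x.1 x.2.1 x.2.2‖ * ‖T γ x.1 x.2.1 0‖
      * ‖T γ x.1 x.2.2 0‖ := by
    simp only [T]
    fun_prop
  have hpos : ∀ x ∈ K, 0 < ‖T γ x.1 x.2.1 x.2.2‖ * ‖T γ x.1 x.2.1 0‖ * ‖T γ x.1 x.2.2 0‖ := by
    intro x hx
    have hne : ∀ {a b : RModZ}, ε ≤ ‖a - b‖ → 0 < ‖T γ x.1 a b‖ := fun {a b} hab => by
      refine norm_pos_iff.2 (sub_ne_zero.2 fun heq => ?_)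
      have : a = b := add_left_cancel (he heq)
      rw [this, sub_self, norm_zero] at hab
      linarith
    have h1 := hne hx.2.2
    have h2 : 0 < ‖T γ x.1 x.2.1 0‖ := hne (by rw [sub_zero]; exact hx.1)
    have h3 : 0 < ‖T γ x.1 x.2.2 0‖ := hne (by rw [sub_zero]; exact hx.2.1)
    positivity
  have hfun : ContinuousOn (fun x : Triple => 2 * (normPowDeriv q
      (wedge (T γ x.1 x.2.1 0) (T γ x.1 x.2.2 0)) (wedge (T γ x.1 x.2.1 0) (T h x.1 x.2.2 0))
      / (‖T γ x.1 x.2.1 x.2.2‖ * ‖T γ x.1 x.2.1 0‖ * ‖T γ x.1 x.2.2 0‖) ^ p)) K :=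
    continuousOn_const.mul (hN.continuousOn.div
      (hD.continuousOn.rpow_const fun x hx => Or.inl (hpos x hx).ne')
      fun x hx => (Real.rpow_pos_of_pos (hpos x hx) p).ne')
  refine hfun.congr fun x hx => ?_
  have e := normPowDeriv_apply q (wedge (T γ x.1 x.2.1 0) (T γ x.1 x.2.2 0))
    (wedge (T γ x.1 x.2.1 0) (T h x.1 x.2.2 0))
  refine Eq.trans ?_ (congrArg (fun t => 2 * (t / (‖T γ x.1 x.2.1 x.2.2‖ * ‖T γ x.1 x.2.1 0‖
    * ‖T γ x.1 x.2.2 0‖) ^ p)) e.symm)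
  rw [wedgeTerm, denom]
  ring

lemma variationIntegrandSymm_eq_zero (p : ℝ) (γ h : Sobolev n s q) {x : Triple}
    (hx : shift x ∉ distinct) : variationIntegrandSymm p q γ h x = 0 := by
  have hq0 : q ≠ 0 := by have := hq.out; positivity
  have hA : wedge (T γ x.1 x.2.1 0) (T γ x.1 x.2.2 0) = 0 := by
    have := area_eq_zero γ hx
    simpa only [area, shift, T, add_zero] using this
  rw [variationIntegrandSymm, wedgeTermSymm, lowerTerms, hA, norm_zero, Real.zero_rpow hq0,
    inner_zero_left]
  ring

/-- Dominated convergence: a triple of distinct parameters lies in the domain for all small ε > 0,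
and at all other triples the integrand is zero. -/
lemma tendsto_integral_offDiagonal (p : ℝ) {γ h : Sobolev n s q}
    (hi : Integrable (variationIntegrandSymm p q γ h)) :
    Tendsto (fun ε : ℝ => ∫ x in offDiagonal ε, variationIntegrandSymm p q γ h x) (𝓝[>] 0)
      (𝓝 (∫ x, variationIntegrandSymm p q γ h x)) := by
  have e : ∀ ε, ∫ x in offDiagonal ε, variationIntegrandSymm p q γ h x
      = ∫ x, (offDiagonal ε).indicator (variationIntegrandSymm p q γ h) x := fun ε =>
    (integral_indicator (isOpen_offDiagonal ε).measurableSet).symm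
  simp only [e]
  refine tendsto_integral_filter_of_dominated_convergence
    (fun x => ‖variationIntegrandSymm p q γ h x‖)
    (Eventually.of_forall fun ε =>
      hi.aestronglyMeasurable.indicator (isOpen_offDiagonal ε).measurableSet)
    (Eventually.of_forall fun ε => ae_of_all _ fun x => norm_indicator_le_norm_self _ _)
    hi.norm (ae_of_all _ fun x => ?_)
  by_cases hx : shift x ∈ distinct
  · refine tendsto_const_nhds.congr' ?_
    have h1 : 0 < ‖x.2.1 - x.2.2‖ := norm_pos_iff.2 (sub_ne_zero.2 fun h => hx.1 (by
      change x.1 + x.2.1 = x.1 + x.2.2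
      rw [h]))
    have h2 : 0 < ‖x.2.1‖ := norm_pos_iff.2 fun h => hx.2.1 (by
      change x.1 + x.2.1 = x.1
      rw [h, add_zero])
    have h3 : 0 < ‖x.2.2‖ := norm_pos_iff.2 fun h => hx.2.2 (by
      change x.1 + x.2.2 = x.1
      rw [h, add_zero])
    filter_upwards [Ioo_mem_nhdsGT (lt_min h1 (lt_min h2 h3))] with ε hε
    have hlt := hε.2
    rw [lt_min_iff, lt_min_iff] at hlt
    exact (indicator_of_mem (show x ∈ offDiagonal ε from ⟨hlt.2.1, hlt.2.2, hlt.1⟩) _).symm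
  · have h0 : ∀ ε, (offDiagonal ε).indicator (variationIntegrandSymm p q γ h) x
        = variationIntegrandSymm p q γ h x := fun ε => by
      rw [indicator_apply_eq_self]
      exact fun _ => variationIntegrandSymm_eq_zero p γ h hx
    simp only [h0]
    exact tendsto_const_nhds

/-- The formulas for the first variation at an embedded curve parametrized by arc-length. -/
lemma firstVariation {p : ℝ} (hp : 0 < p) (hs : 1 / q < s)
    (hqs : q * s = 3 * p - 2 - 2 * q) (hpq : p < q + 1) {γ : Sobolev n s q} (ha : γ.IsArcLength)
    (he : γ.IsEmbedded) (h : Sobolev n s q) :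
    ∃ δE : ℝ, HasDerivAt (fun τ : ℝ => (energy p q (γ + τ • h)).toReal) δE 0 ∧
      (∀ ε : ℝ, 0 < ε → IntegrableOn (variationIntegrand p q γ h) (offDiagonal ε)) ∧
      Tendsto (fun ε : ℝ => ∫ x in offDiagonal ε, variationIntegrand p q γ h x) (𝓝[>] 0) (𝓝 δE) ∧
      Integrable (variationIntegrandSymm p q γ h) ∧
      δE = ∫ x, variationIntegrandSymm p q γ h x ∧
      (Integrable (variationIntegrand p q γ h) → δE = ∫ x, variationIntegrand p q γ h x) := by
  have hunit := norm_contDeriv_eq_one hs ha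
  obtain ⟨c, hc, hγ⟩ := exists_isBiLipschitz hs ⟨1, one_pos, ha.mono fun u hu => hu.ge⟩ he
  obtain ⟨-, hJ, -, hder⟩ := energy_differentiable hp hs hqs hpq hc hγ
  obtain ⟨hEi, hEd⟩ := hder h
  have hJ' : Integrable (arcDensity p γ) := by
    refine hJ.congr (ae_of_all _ fun x => ?_)
    simp only [areaWeight, arcDensity, hunit]
    ring
  obtain ⟨hSi, hSe⟩ := integral_energyVar p hs hc hγ hunit h hJ' hEi
  obtain ⟨hai, hmi⟩ := integrable_lower p hs hc hγ h hJ'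
  have hVae := variationIntegrandSymm_ae hs p γ h
  have hVi : Integrable (variationIntegrandSymm p q γ h) :=
    (measurePreserving_shift.integrable_comp_of_integrable hSi).congr
      (hVae.mono fun x hx => hx.symm)
  have hVe : ∫ x, energyVar p γ h x = ∫ x, variationIntegrandSymm p q γ h x := by
    rw [integral_congr_ae hVae, ← hSe]
    exact (measurePreserving_shift.integral_comp measurableEmbedding_shift _).symm
  have hL : Integrable fun x : Triple => lowerTerms p q γ h x.1 x.2.1 x.2.2 :=
    (measurePreserving_shift.integrable_comp_of_integrable
      ((hai.const_mul 3).sub (hmi.const_mul (3 * p)))).congr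
      ((lowerTerms_ae hs p γ h).mono fun x hx => hx.symm)
  have hW : ∀ ε : ℝ, 0 < ε → IntegrableOn (fun x : Triple => wedgeTerm p q γ h x.1 x.2.1 x.2.2)
      (offDiagonal ε) := fun ε hε => integrableOn_wedgeTerm p he h hε
  refine ⟨∫ x, energyVar p γ h x, hEd, fun ε hε => (hW ε hε).add hL.integrableOn, ?_, hVi, hVe,
    fun hV => ?_⟩
  · rw [hVe]
    -- The limit is taken for the symmetrized integrand, which is globally integrable, and
    -- transferred because the truncated integrals agree for every ε > 0.
    refine (tendsto_integral_offDiagonal p hVi).congr' ?_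
    filter_upwards [self_mem_nhdsWithin] with ε hε
    exact integral_variationIntegrandSymm (swapLast_preimage_offDiagonal ε) (hW ε hε)
      hL.integrableOn
  -- The lower terms are always integrable, so integrability of the whole integrand passes to the
  -- area term; then the whole space serves as the invariant domain.
  · have hW' : Integrable fun x : Triple => wedgeTerm p q γ h x.1 x.2.1 x.2.2 := by
      refine (hV.sub hL).congr (ae_of_all _ fun x => ?_)
      simp only [Pi.sub_apply, variationIntegrand]
      ring
    rw [hVe, ← setIntegral_univ, ← setIntegral_univ (f := variationIntegrand p q γ h)]
    exact integral_variationIntegrandSymm preimage_univ hW'.integrableOn hL.integrableOn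

end PrincipalValue

end MengerCurvature

end

/-! ### The theorem for the energy space -/

theorem theorem3 (n : ℕ) (p q : ℝ) [Fact (1 < q)]
    (hp : 2 / 3 * q + 1 < p) (hp' : p < q + 2 / 3) :
    -- the regular embedded curves form an open set, on which the energy is finite and `C¹`
    IsOpen (MengerCurvature.regularEmbedded n p q) ∧
    (∀ γ ∈ MengerCurvature.regularEmbedded n p q, MengerCurvature.energy p q γ < ⊤) ∧
    ContDiffOn ℝ 1 (fun γ : MengerCurvature.EnergySpace n p q =>
      (MengerCurvature.energy p q γ).toReal) (MengerCurvature.regularEmbedded n p q) ∧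
    -- the first variation at arc-length parametrized embedded curves
    ∀ γ : MengerCurvature.EnergySpace n p q, γ.IsArcLength → γ.IsEmbedded →
      ∀ h : MengerCurvature.EnergySpace n p q,
        ∃ δE : ℝ,
          HasDerivAt (fun τ : ℝ => (MengerCurvature.energy p q (γ + τ • h)).toReal) δE 0 ∧
          -- the formula as a limit of integrals off the diagonals
          (∀ ε : ℝ, 0 < ε → IntegrableOn (MengerCurvature.variationIntegrand p q γ h)
            (MengerCurvature.offDiagonal ε)) ∧
          Tendsto (fun ε : ℝ => ∫ x in MengerCurvature.offDiagonal ε,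
            MengerCurvature.variationIntegrand p q γ h x) (𝓝[>] 0) (𝓝 δE) ∧
          -- the formula as an absolutely convergent integral, after symmetrization
          Integrable (MengerCurvature.variationIntegrandSymm p q γ h) ∧
          δE = ∫ x, MengerCurvature.variationIntegrandSymm p q γ h x ∧
          -- the formula as a plain integral, whenever its integrand is integrable
          (Integrable (MengerCurvature.variationIntegrand p q γ h) →
            δE = ∫ x, MengerCurvature.variationIntegrand p q γ h x) := by
  have hq1 : 1 < q := Fact.out
  have hq0 : 0 < q := by linarith
  have hp0 : 0 < p := by linarith
  have hpq : p < q + 1 := by linarith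
  have hqs : q * ((3 * p - 2) / q - 2) = 3 * p - 2 - 2 * q := by
    field_simp
  -- After multiplication by q this is 1 < 3p - 2 - 2q, the lower bound on p.
  have hs : 1 / q < (3 * p - 2) / q - 2 := by
    rw [div_lt_iff₀ hq0, mul_comm, hqs]
    linarith
  have hloc : ∀ γ ∈ MengerCurvature.regularEmbedded n p q,
      MengerCurvature.energy p q γ < ⊤ ∧ ContDiffAt ℝ 1
        (fun η : MengerCurvature.EnergySpace n p q => (MengerCurvature.energy p q η).toReal) γ := by
    intro γ hγ
    obtain ⟨c, hc, hb⟩ := MengerCurvature.exists_isBiLipschitz hs hγ.1 hγ.2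
    obtain ⟨h1, -, h2, -⟩ := MengerCurvature.energy_differentiable hp0 hs hqs hpq hc hb
    exact ⟨h1, h2⟩
  exact ⟨MengerCurvature.isOpen_regular_embedded hs, fun γ hγ => (hloc γ hγ).1,
    fun γ hγ => (hloc γ hγ).2.contDiffWithinAt, fun γ ha he h =>
      MengerCurvature.firstVariation hp0 hs hqs hpq ha he h⟩
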